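/- **Setting.** For each $n$ let $X_n$ and $P_n$ be independent $n\times n$ real symmetric (respectively complex Hermitian) random matrices, all defined on one probability space, such that, for each $n$, the law of $X_n$ or the law of $P_n$ is invariant under conjugation by all orthogonal (respectively unitary) matrices. Let $\lambda_1(M)\ge\cdots\ge\lambda_n(M)$ denote the ordered eigenvalues (with multiplicity) of an $n\times n$ matrix $M$ with real spectrum. Assume that $X_n$ is non-negative definite and that, almost surely, $\frac1n\sum_{j=1}^n\delta_{\lambda_j(X_n)}$ converges weakly to a deterministic compactly supported probability measure $\mu_X\neq\delta_0$ and $\lambda_1(X_n)\to b$, $\lambda_n(X_n)\to a$, where $a$ and $b$ are the infimum and the supremum of the support of $\mu_X$. Let $r\ge1$ and let $\theta_1\ge\cdots\ge\theta_r$ be non-zero real numbers not depending on $n$; for $n\ge r$ the matrix $P_n$ has rank $r$ and its non-zero eigenvalues, counted with multiplicity, are $\theta_1,\dots,\theta_r$. Put $\widetilde X_n=X_n(I_n+P_n)$ (its eigenvalues are real) and $$T_{\mu_X}(z)=\int\frac{t}{z-t}\,\mathrm d\mu_X(t),\qquad z\notin[a,b],$$ and let $T_{\mu_X}(a^-)=\lim_{z\uparrow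 a}T_{\mu_X}(z)$ and $T_{\mu_X}(b^+)=\lim_{z\downarrow b}T_{\mu_X}(z)$, which may be infinite. For a subspace $F$, $\langle x,F\rangle$ denotes the norm of the orthogonal projection of $x$ onto $F$. **Theorem 2.7 (Norm of eigenvector projection, multiplicative).** Let $i_0\in\{1,\dots,r\}$ be such that $1/\theta_{i_0}\in(T_{\mu_X}(a^-),T_{\mu_X}(b^+))$. For $n\ge r$ let $$\widetilde\lambda_{i_0}=\begin{cases}\lambda_{i_0}(\widetilde X_n)&\text{if }\theta_{i_0}>0,\\ \lambda_{n-r+i_0}(\widetilde X_n)&\text{if }\theta_{i_0}<0,\end{cases}$$ and let $\widetilde u$ be a unit-norm eigenvector of $\widetilde X_n$ for the eigenvalue $\widetilde\lambda_{i_0}$. Then there is exactly one real number $\rho=T_{\mu_X}^{-1}(1/\theta_{i_0})\notin[a,b]$ with $T_{\mu_X}(\rho)=1/\theta_{i_0}$, $T_{\mu_X}$ is differentiable at $\rho$, and, as $n\to\infty$, almost surely $\widetilde\lambda_{i_0}\to\rho$ and (a) $\displaystyle |\langle\widetilde u,\ker(\theta_{i_0}I_n-P_n)\rangle|^2\longrightarrow\frac{-1}{\theta_{i_0}^2\,\rho\,T_{\mu_X}'(\rho)+\theta_{i_0}}$;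 (b) $\displaystyle \Big\langle\widetilde u,\ \bigoplus_{\theta\in\{\theta_1,\dots,\theta_r\},\ \theta\ne\theta_{i_0}}\ker(\theta I_n-P_n)\Big\rangle\longrightarrow0$. -/

import Mathlib

open MeasureTheory ProbabilityTheory Filter Topology
open scoped BoundedContinuousFunction ENNReal ComplexOrder

noncomputable section

namespace SpikedModel

/-- Matrices carry the product (entrywise) σ-algebra. -/
instance matrixMeasurableSpace {𝕜 : Type*} [MeasurableSpace 𝕜] {n : ℕ} :
    MeasurableSpace (Matrix (Fin n) (Fin n) 𝕜) :=
  inferInstanceAs (MeasurableSpace (Fin n → Fin n → 𝕜))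

/-- The eigenvalues of a square matrix with real spectrum, counted with algebraic multiplicity and
listed in decreasing order: `orderedEigenvalue A 0 ≥ orderedEigenvalue A 1 ≥ ⋯`, so that
`orderedEigenvalue A k` is the `(k + 1)`-st largest eigenvalue of `A` (for `k < n`).
It is used for Hermitian matrices and for products `X * (1 + P)` with `X` non-negative definite and
`P` Hermitian; the latter have the same characteristic polynomial as the Hermitian matrix
`X^{1/2} * (1 + P) * X^{1/2}`, hence a real spectrum. -/
def orderedEigenvalue {𝕜 : Type*} [RCLike 𝕜] {n : ℕ} (A : Matrix (Fin n) (Fin n) 𝕜) (k : ℕ) : ℝ :=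
  ((A.charpoly.roots.map RCLike.re).sort (· ≥ ·)).getD k 0

/-- On Hermitian matrices this is Mathlib's decreasing list of eigenvalues. -/
theorem orderedEigenvalue_eq {𝕜 : Type*} [RCLike 𝕜] {n : ℕ} {A : Matrix (Fin n) (Fin n) 𝕜}
    (hA : A.IsHermitian) (k : Fin (Fintype.card (Fin n))) :
    orderedEigenvalue A k = hA.eigenvalues₀ k := by
  simp [orderedEigenvalue, hA.sort_roots_charpoly_eq_eigenvalues₀, List.getD_eq_getElem?_getD,
    show (k : ℕ) < n by simpa using k.2]

/-- The empirical eigenvalue distribution `(1 / n) ∑ j, δ_{λ_j(A)}`. -/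
def empiricalMeasure {𝕜 : Type*} [RCLike 𝕜] {n : ℕ} (A : Matrix (Fin n) (Fin n) 𝕜) : Measure ℝ :=
  (n : ℝ≥0∞)⁻¹ • ∑ j : Fin n, Measure.dirac (orderedEigenvalue A j)

/-- Weak convergence of a sequence of finite measures on `ℝ`. -/
def WeaklyConverges (ν : ℕ → Measure ℝ) (μ : Measure ℝ) : Prop :=
  ∀ f : ℝ →ᵇ ℝ, Tendsto (fun n => ∫ t, f t ∂(ν n)) atTop (𝓝 (∫ t, f t ∂μ))

/-- The law of the random matrix `M` is invariant under conjugation by every element of the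
unitary group over `𝕜` (the orthogonal group when `𝕜 = ℝ`). -/
def ConjInvariant {𝕜 : Type*} [RCLike 𝕜] {Ω : Type*} [MeasurableSpace Ω] (Pr : Measure Ω) {n : ℕ}
    (M : Ω → Matrix (Fin n) (Fin n) 𝕜) : Prop :=
  ∀ U ∈ Matrix.unitaryGroup (Fin n) 𝕜,
    Measure.map (fun ω => U * M ω * star U) Pr = Measure.map M Pr

/-- `P` is an `n × n` Hermitian matrix of rank `r` whose non-zero eigenvalues, counted with
multiplicity, are `θ 0, …, θ (r - 1)` (to be used with `r ≤ n` and all `θ i` non-zero). -/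
def HasNonzeroSpectrum {𝕜 : Type*} [RCLike 𝕜] {n r : ℕ} (P : Matrix (Fin n) (Fin n) 𝕜)
    (θ : Fin r → ℝ) : Prop :=
  P.IsHermitian ∧
    P.charpoly = Polynomial.X ^ (n - r) *
      ∏ i : Fin r, (Polynomial.X - Polynomial.C ((θ i : ℝ) : 𝕜))

/-- The `T`-transform `T_μ(z) = ∫ t / (z - t) dμ(t)`, on the real line. -/
def tTransform (μ : Measure ℝ) (z : ℝ) : ℝ := ∫ t, t / (z - t) ∂μ

/-- The limit `T_μ(c⁻)` from the left, which may be infinite. -/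
def tTransformLeft (μ : Measure ℝ) (c : ℝ) : EReal :=
  Function.leftLim (fun z => (tTransform μ z : EReal)) c

/-- The limit `T_μ(c⁺)` from the right, which may be infinite. -/
def tTransformRight (μ : Measure ℝ) (c : ℝ) : EReal :=
  Function.rightLim (fun z => (tTransform μ z : EReal)) c

/-- The subspace `ker (θ I - P)` of the Euclidean space `𝕜ⁿ`. -/
def kerSub {𝕜 : Type*} [RCLike 𝕜] {n : ℕ} (P : Matrix (Fin n) (Fin n) 𝕜) (θ : ℝ) :
    Submodule 𝕜 (EuclideanSpace 𝕜 (Fin n)) :=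
  LinearMap.ker (Matrix.toEuclideanLin (((θ : ℝ) : 𝕜) • (1 : Matrix (Fin n) (Fin n) 𝕜) - P))

/-- `⟨x, F⟩`: the norm of the orthogonal projection of `x` onto the subspace `F`. -/
def projNorm {𝕜 : Type*} [RCLike 𝕜] {n : ℕ} (x : EuclideanSpace 𝕜 (Fin n))
    (F : Submodule 𝕜 (EuclideanSpace 𝕜 (Fin n))) : ℝ :=
  ‖F.starProjection x‖

/-- `x` is a unit-norm eigenvector of `A` for the real eigenvalue `l`. -/
def IsUnitEigenvector {𝕜 : Type*} [RCLike 𝕜] {n : ℕ} (A : Matrix (Fin n) (Fin n) 𝕜) (l : ℝ)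
    (x : EuclideanSpace 𝕜 (Fin n)) : Prop :=
  ‖x‖ = 1 ∧ Matrix.toEuclideanLin A x = ((l : ℝ) : 𝕜) • x

/-- The multiplicative perturbation `X (I + P)`. -/
def perturbed {𝕜 : Type*} [RCLike 𝕜] {n : ℕ} (X P : Matrix (Fin n) (Fin n) 𝕜) :
    Matrix (Fin n) (Fin n) 𝕜 :=
  X * (1 + P)

/-- The eigenvalue attached to the (zero-based) index `i : Fin r` of `θ`: the eigenvalue
of `X (I + P)` with the same rank from the top if `θ i > 0`, and the eigenvalue with the
corresponding rank from the bottom if `θ i < 0`. -/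
def outlierEigenvalue {𝕜 : Type*} [RCLike 𝕜] {n r : ℕ} (X P : Matrix (Fin n) (Fin n) 𝕜)
    (θ : Fin r → ℝ) (i : Fin r) : ℝ :=
  if 0 < θ i then orderedEigenvalue (perturbed X P) i
  else orderedEigenvalue (perturbed X P) (n - r + i)

end SpikedModel

end

/-! Write `X = Y²` with `Y ≥ 0`. Then `X(1 + P)` has the same characteristic polynomial as the
Hermitian matrix `H = Y(1 + P)Y = X + YPY`. Let `P = ∑ θ_k v_k v_k*` with `v` an orthonormal frame.
Everything rests on an isotropic law: almost surely, for every `f` continuous near `[a, b]`, `⟨v_k,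
f(X) v_l⟩` tends to `δ_kl ∫ f dμ`.

Proof of the isotropic law. Conjugation invariance of one matrix and independence allow `X` to be
rotated by a Haar unitary, with `P` fixed. For a traceless Hermitian `A` of norm at most `K`, the
quadratic form of `UAU*` at a unit vector has fourth moment `O(K⁴/n²)`. This comes from an
exchangeable pairs argument on the unitary group (`integral_pow_four_le`), whose moves are
reflections mixing the vector slightly with the other members of an orthonormal basis. Polarization
gives all entries, and the bound `1/n²` is summable, so Borel–Cantelli applies to the traceless
parts of the powers of `X` (`ae_tendsto_compressionEnergy`). Weierstrass approximation passes from
powers to continuous functions. The frames are never chosen measurably: the probabilistic part only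
sees the trace of `(PBP)²`, which dominates every entry because the `θ_k` are non-zero.

Location of the outlier. Fix `z` off `[a, b]` and `ε = ±1`, the sign of `θ_{i₀}`, so that `N = ε(z -
X)` is positive. Then `ε(H - z) ≥ 0` on a subspace means that `ε YPY` dominates `N` there. Since
`⟨v_k, X N⁻¹ v_l⟩` is close to `δ_kl ε T(z)`, this holds on the span of suitable vectors `N⁻¹ Y v_k`
when `θ_{i₀} T(z) > 1`, and the reverse holds on a subspace of small codimension when `θ_{i₀} T(z) <
1`. Courant–Fischer turns both into bounds on the eigenvalue. As `T` is strictly decreasing on each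
side of `[a, b]`, the eigenvalue is squeezed onto `ρ`.

Eigenvector. Off the spectrum of `X`, the equation `X(1 + P)u = l u` reads `u = X(l - X)⁻¹ P u`.
Pairing with `v_m` gives `(1 - θ_m T(ρ))⟨v_m, u⟩ → 0`, which is (b). Taking squared norms gives `∫
(t/(ρ - t))² dμ · ∑ θ_k² |⟨v_k, u⟩|² → 1`. Only the indices with `θ_k = θ_{i₀}` survive, and the
integral equals `-ρ T'(ρ) - T(ρ)`, which is (a). -/

noncomputable section

namespace SpikedModel

open scoped InnerProductSpace

/-! ### Operators diagonal in an orthonormal basis, finite rank operators, Courant–Fischer. -/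

section DiagonalOperators

variable {𝕜 : Type*} [RCLike 𝕜] {E : Type*} [NormedAddCommGroup E] [InnerProductSpace 𝕜 E]
  {ι : Type*} [Fintype ι]

/-- The operator which is diagonal in the orthonormal basis `b`, with real entries `f`. -/
def diagOp (b : OrthonormalBasis ι 𝕜 E) (f : ι → ℝ) : E →ₗ[𝕜] E where
  toFun v := ∑ i, (((f i : ℝ) : 𝕜) * ⟪b i, v⟫_𝕜) • b i
  map_add' v w := by
    simp only [inner_add_right, mul_add, add_smul, Finset.sum_add_distrib]
  map_smul' c v := by
    simp only [inner_smul_right, RingHom.id_apply, Finset.smul_sum, smul_smul]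
    exact Finset.sum_congr rfl fun i _ => by ring_nf

theorem inner_diagOp (b : OrthonormalBasis ι 𝕜 E) (f : ι → ℝ) (i : ι) (v : E) :
    ⟪b i, diagOp b f v⟫_𝕜 = ((f i : ℝ) : 𝕜) * ⟪b i, v⟫_𝕜 :=
  b.orthonormal.inner_right_fintype (fun i => ((f i : ℝ) : 𝕜) * ⟪b i, v⟫_𝕜) i

theorem ext_orthonormalBasis (b : OrthonormalBasis ι 𝕜 E) {v w : E}
    (h : ∀ i, ⟪b i, v⟫_𝕜 = ⟪b i, w⟫_𝕜) : v = w := by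
  apply b.repr.injective
  ext i
  simpa [b.repr_apply_apply] using h i

theorem diagOp_diagOp (b : OrthonormalBasis ι 𝕜 E) (f g : ι → ℝ) (v : E) :
    diagOp b f (diagOp b g v) = diagOp b (fun i => f i * g i) v :=
  ext_orthonormalBasis b fun i => by simp [inner_diagOp, mul_assoc]

theorem diagOp_apply_eq_self (b : OrthonormalBasis ι 𝕜 E) {f : ι → ℝ} (hf : ∀ i, f i = 1) (v : E) :
    diagOp b f v = v :=
  ext_orthonormalBasis b fun i => by simp [inner_diagOp, hf]

theorem diagOp_sub (b : OrthonormalBasis ι 𝕜 E) (f g : ι → ℝ) (v : E) :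
    diagOp b (fun i => f i - g i) v = diagOp b f v - diagOp b g v :=
  ext_orthonormalBasis b fun i => by simp [inner_diagOp, inner_sub_right, sub_mul]

theorem inner_diagOp_right (b : OrthonormalBasis ι 𝕜 E) (f : ι → ℝ) (v w : E) :
    ⟪v, diagOp b f w⟫_𝕜 = ∑ i, ((f i : ℝ) : 𝕜) * (⟪v, b i⟫_𝕜 * ⟪b i, w⟫_𝕜) := by
  simp only [diagOp, LinearMap.coe_mk, AddHom.coe_mk, inner_sum, inner_smul_right]
  exact Finset.sum_congr rfl fun i _ => by ring

theorem diagOp_symm (b : OrthonormalBasis ι 𝕜 E) (f : ι → ℝ) (v w : E) :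
    ⟪diagOp b f v, w⟫_𝕜 = ⟪v, diagOp b f w⟫_𝕜 := by
  rw [← inner_conj_symm, inner_diagOp_right, inner_diagOp_right, map_sum]
  refine Finset.sum_congr rfl fun i _ => ?_
  simp only [map_mul, RCLike.conj_ofReal, inner_conj_symm]
  ring

theorem inner_diagOp_self (b : OrthonormalBasis ι 𝕜 E) (f : ι → ℝ) (v : E) :
    ⟪v, diagOp b f v⟫_𝕜 = ((∑ i, f i * ‖⟪b i, v⟫_𝕜‖ ^ 2 : ℝ) : 𝕜) := by
  rw [inner_diagOp_right]
  push_cast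
  refine Finset.sum_congr rfl fun i _ => ?_
  rw [← inner_conj_symm v (b i), RCLike.conj_mul]

theorem norm_diagOp_sq (b : OrthonormalBasis ι 𝕜 E) (f : ι → ℝ) (v : E) :
    ‖diagOp b f v‖ ^ 2 = ∑ i, f i ^ 2 * ‖⟪b i, v⟫_𝕜‖ ^ 2 := by
  rw [← b.sum_sq_norm_inner_right]
  refine Finset.sum_congr rfl fun i _ => ?_
  rw [inner_diagOp, norm_mul, mul_pow]
  simp

theorem norm_diagOp_le (b : OrthonormalBasis ι 𝕜 E) {f : ι → ℝ} {K : ℝ} (hK : 0 ≤ K)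
    (hf : ∀ i, |f i| ≤ K) (v : E) : ‖diagOp b f v‖ ≤ K * ‖v‖ := by
  refine le_of_sq_le_sq ?_ (by positivity)
  rw [norm_diagOp_sq, mul_pow, ← b.sum_sq_norm_inner_right v, Finset.mul_sum]
  refine Finset.sum_le_sum fun i _ => ?_
  gcongr ?_ * _
  exact sq_le_sq' (by linarith [abs_le.1 (hf i)]) (abs_le.1 (hf i)).2

theorem norm_inner_diagOp_le (b : OrthonormalBasis ι 𝕜 E) {f : ι → ℝ} {K : ℝ} (hK : 0 ≤ K)
    (hf : ∀ i, |f i| ≤ K) (v w : E) : ‖⟪v, diagOp b f w⟫_𝕜‖ ≤ K * (‖v‖ * ‖w‖) := by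
  calc _ ≤ ‖v‖ * ‖diagOp b f w‖ := norm_inner_le_norm _ _
    _ ≤ ‖v‖ * (K * ‖w‖) := by gcongr; exact norm_diagOp_le b hK hf w
    _ = _ := by ring

/-- Courant–Fischer comparison: a quadratic form bounded below by `z` on a subspace of dimension
larger than the number of eigenvalues which may exceed `L` forces `z ≤ L`. -/
theorem le_of_le_form [FiniteDimensional 𝕜 E] (e : OrthonormalBasis ι 𝕜 E) (l : ι → ℝ)
    (S : Finset ι) (W : Submodule 𝕜 E) (hW : S.card < Module.finrank 𝕜 W) {z L : ℝ}
    (hl : ∀ i, i ∉ S → l i ≤ L)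
    (hz : ∀ w ∈ W, z * ‖w‖ ^ 2 ≤ ∑ i, l i * ‖⟪e i, w⟫_𝕜‖ ^ 2) : z ≤ L := by
  let φ : W →ₗ[𝕜] (S → 𝕜) :=
    LinearMap.pi fun i => (innerₛₗ 𝕜 (e i)).comp W.subtype
  have hφ : LinearMap.ker φ ≠ ⊥ := LinearMap.ker_ne_bot_of_finrank_lt (by simpa using hW)
  obtain ⟨w, hw, hw0⟩ := Submodule.exists_mem_ne_zero_of_ne_bot hφ
  have hwi : ∀ i ∈ S, ⟪e i, (w : E)⟫_𝕜 = 0 := fun i hi =>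
    congrFun (LinearMap.mem_ker.1 hw) ⟨i, hi⟩
  have hpos : 0 < ‖(w : E)‖ ^ 2 := by
    have : (w : E) ≠ 0 := by simpa using hw0
    positivity
  have : z * ‖(w : E)‖ ^ 2 ≤ L * ‖(w : E)‖ ^ 2 := by
    refine (hz w w.2).trans ?_
    rw [← e.sum_sq_norm_inner_right (w : E), Finset.mul_sum]
    refine Finset.sum_le_sum fun i _ => ?_
    by_cases hi : i ∈ S
    · simp [hwi i hi]
    · gcongr
      exact hl i hi
  exact le_of_mul_le_mul_right this hpos

/-- The operator of rank at most `r` with eigenvectors `v k` and eigenvalues `θ k`. -/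
def frameOp {r : ℕ} (v : Fin r → E) (θ : Fin r → ℝ) : E →ₗ[𝕜] E where
  toFun x := ∑ k, (((θ k : ℝ) : 𝕜) * ⟪v k, x⟫_𝕜) • v k
  map_add' v w := by
    simp only [inner_add_right, mul_add, add_smul, Finset.sum_add_distrib]
  map_smul' c v := by
    simp only [inner_smul_right, RingHom.id_apply, Finset.smul_sum, smul_smul]
    exact Finset.sum_congr rfl fun i _ => by ring_nf

theorem inner_frameOp_right {r : ℕ} (v : Fin r → E) (θ : Fin r → ℝ) (x y : E) :
    ⟪x, frameOp (𝕜 := 𝕜) v θ y⟫_𝕜 = ∑ k, ((θ k : ℝ) : 𝕜) * (⟪x, v k⟫_𝕜 * ⟪v k, y⟫_𝕜) := by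
  simp only [frameOp, LinearMap.coe_mk, AddHom.coe_mk, inner_sum, inner_smul_right]
  exact Finset.sum_congr rfl fun i _ => by ring

theorem inner_frameOp_self {r : ℕ} (v : Fin r → E) (θ : Fin r → ℝ) (x : E) :
    ⟪x, frameOp (𝕜 := 𝕜) v θ x⟫_𝕜 = ((∑ k, θ k * ‖⟪v k, x⟫_𝕜‖ ^ 2 : ℝ) : 𝕜) := by
  rw [inner_frameOp_right]
  push_cast
  refine Finset.sum_congr rfl fun i _ => ?_
  rw [← inner_conj_symm x (v i), RCLike.conj_mul]

theorem inner_frameOp {r : ℕ} {v : Fin r → E} (hv : Orthonormal 𝕜 v) (θ : Fin r → ℝ) (k : Fin r)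
    (x : E) : ⟪v k, frameOp (𝕜 := 𝕜) v θ x⟫_𝕜 = ((θ k : ℝ) : 𝕜) * ⟪v k, x⟫_𝕜 :=
  hv.inner_right_fintype (fun k => ((θ k : ℝ) : 𝕜) * ⟪v k, x⟫_𝕜) k

/-- Sesquilinear expansion of a form with nearly scalar Gram matrix. -/
theorem norm_sum_gram_sub_le {r : ℕ} {G : Fin r → Fin r → 𝕜} {τ η : ℝ}
    (hG : ∀ k l, ‖G k l - (if k = l then (τ : 𝕜) else 0)‖ ≤ η) (c : Fin r → 𝕜) :
    ‖(∑ k, ∑ l, (starRingEnd 𝕜) (c k) * c l * G k l) - ((τ * ∑ k, ‖c k‖ ^ 2 : ℝ) : 𝕜)‖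
      ≤ r * η * ∑ k, ‖c k‖ ^ 2 := by
  have h1 : ((τ * ∑ k, ‖c k‖ ^ 2 : ℝ) : 𝕜)
      = ∑ k, ∑ l, (starRingEnd 𝕜) (c k) * c l * (if k = l then (τ : 𝕜) else 0) := by
    simp only [mul_ite, mul_zero, Finset.sum_ite_eq, Finset.mem_univ, if_true]
    push_cast
    rw [Finset.mul_sum]
    refine Finset.sum_congr rfl fun k _ => ?_
    rw [RCLike.conj_mul]; ring
  rcases Nat.eq_zero_or_pos r with hr | hr
  · subst hr; simp
  have hη : 0 ≤ η := (norm_nonneg _).trans (hG ⟨0, hr⟩ ⟨0, hr⟩)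
  rw [h1, ← Finset.sum_sub_distrib]
  simp_rw [← Finset.sum_sub_distrib, ← mul_sub]
  calc _ ≤ ∑ k, ∑ l, ‖c k‖ * ‖c l‖ * η := by
        refine (norm_sum_le _ _).trans (Finset.sum_le_sum fun k _ => (norm_sum_le _ _).trans
          (Finset.sum_le_sum fun l _ => ?_))
        rw [norm_mul, norm_mul, RCLike.norm_conj]
        gcongr
        exact hG k l
    _ = (∑ k, ‖c k‖) ^ 2 * η := by
        rw [sq, Finset.sum_mul_sum, Finset.sum_mul]
        exact Finset.sum_congr rfl fun k _ => by rw [Finset.sum_mul]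
    _ ≤ (r * ∑ k, ‖c k‖ ^ 2) * η := by
        gcongr
        simpa using sq_sum_le_card_mul_sum_sq (s := Finset.univ) (f := fun k : Fin r => ‖c k‖)
    _ = _ := by ring

end DiagonalOperators

/-! ### Subspaces on which the perturbation dominates, or is dominated by, `N`. -/

section TestSubspaces

variable {𝕜 : Type*} [RCLike 𝕜] {E : Type*} [NormedAddCommGroup E] [InnerProductSpace 𝕜 E]
  {ι : Type*} [Fintype ι] {r : ℕ}

/-- The combinations `∑ c k • N⁻¹ x^{1/2} v k` used to test the perturbed form from below. -/
def testVector (b : OrthonormalBasis ι 𝕜 E) (x N : ι → ℝ) (v : Fin r → E) (c : Fin r → 𝕜) : E :=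
  ∑ k, c k • diagOp b (fun i => √(x i) / N i) (v k)

/-- The weight `√x / N` is chosen so that pairing `x^{1/2}` of a test vector with `v m`, and the
`N`-form of a test vector (`form_testVector`), both reduce to the one Gram matrix `⟨v k, (x / N) v
l⟩`. -/
theorem inner_diagOp_sqrt_testVector (b : OrthonormalBasis ι 𝕜 E) {x N : ι → ℝ}
    (hx : ∀ i, 0 ≤ x i) (v : Fin r → E) (c : Fin r → 𝕜) (m : Fin r) :
    ⟪v m, diagOp b (fun i => √(x i)) (testVector b x N v c)⟫_𝕜
      = ∑ l, c l * ⟪v m, diagOp b (fun i => x i / N i) (v l)⟫_𝕜 := by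
  simp only [testVector, map_sum, map_smul, inner_sum, inner_smul_right, diagOp_diagOp]
  refine Finset.sum_congr rfl fun l _ => ?_
  congr 4
  ext i
  rw [← mul_div_assoc, Real.mul_self_sqrt (hx i)]

theorem form_testVector (b : OrthonormalBasis ι 𝕜 E) {x N : ι → ℝ}
    (hx : ∀ i, 0 ≤ x i) (hN : ∀ i, 0 < N i) (v : Fin r → E) (c : Fin r → 𝕜) :
    ((∑ i, N i * ‖⟪b i, testVector b x N v c⟫_𝕜‖ ^ 2 : ℝ) : 𝕜)
      = ∑ k, ∑ l, (starRingEnd 𝕜) (c k) * c l *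
          ⟪v k, diagOp b (fun i => x i / N i) (v l)⟫_𝕜 := by
  rw [← inner_diagOp_self]
  simp only [testVector, map_sum, map_smul, inner_sum, sum_inner, inner_smul_right,
    inner_smul_left, diagOp_diagOp, diagOp_symm]
  rw [Finset.sum_comm]
  refine Finset.sum_congr rfl fun k _ => ?_
  rw [Finset.mul_sum]
  refine Finset.sum_congr rfl fun l _ => ?_
  have : (fun i => √(x i) / N i * (N i * (√(x i) / N i))) = fun i => x i / N i := by
    ext i
    have h1 := (hN i).ne'
    have h2 := Real.mul_self_sqrt (hx i)
    field_simp
    rw [sq, h2]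
  rw [this]
  ring

/-- If the Gram matrix of the frame `v` for `x / N` is close to `τ`, then the form of
`x^{1/2} (∑ p k v k v k*) x^{1/2}` dominates `N` on a subspace of dimension `#J`, provided the
`p k`, `k ∈ J`, are at least `p₀` with `p₀ * τ > 1` up to the error. -/
theorem exists_subspace_form_ge (b : OrthonormalBasis ι 𝕜 E) {x N : ι → ℝ}
    (hx : ∀ i, 0 ≤ x i) (hN : ∀ i, 0 < N i) (v : Fin r → E) (p : Fin r → ℝ) (J : Finset (Fin r))
    {p₀ C τ η : ℝ} (hp₀ : 0 < p₀) (hτ : 0 < τ) (hJ : ∀ k ∈ J, p₀ ≤ p k) (hC : ∀ k, |p k| ≤ C)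
    (hη : 0 ≤ η)
    (hG : ∀ k l, ‖⟪v k, diagOp b (fun i => x i / N i) (v l)⟫_𝕜
      - (if k = l then (τ : 𝕜) else 0)‖ ≤ η)
    (h1 : r * η < τ)
    (h2 : τ + r * η ≤ p₀ * τ ^ 2 - 2 * p₀ * τ * η * r - r ^ 2 * C * η ^ 2) :
    ∃ W : Submodule 𝕜 E, Module.finrank 𝕜 W = J.card ∧ ∀ w ∈ W,
      ∑ i, N i * ‖⟪b i, w⟫_𝕜‖ ^ 2
        ≤ ∑ k, p k * ‖⟪v k, diagOp b (fun i => √(x i)) w⟫_𝕜‖ ^ 2 := by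
  classical
  set g : Fin r → E := fun k => diagOp b (fun i => √(x i) / N i) (v k) with hg
  have key : ∀ c : Fin r → 𝕜, |∑ i, N i * ‖⟪b i, testVector b x N v c⟫_𝕜‖ ^ 2
      - τ * ∑ k, ‖c k‖ ^ 2| ≤ r * η * ∑ k, ‖c k‖ ^ 2 := by
    intro c
    have := norm_sum_gram_sub_le hG c
    rw [← form_testVector b hx hN, ← RCLike.ofReal_sub, RCLike.norm_ofReal] at this
    exact this
  have hext : ∀ c : J → 𝕜, ∃ c' : Fin r → 𝕜, (∀ k (h : k ∈ J), c' k = c ⟨k, h⟩) ∧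
      (∀ k, k ∉ J → c' k = 0) ∧ ∑ k : J, c k • g k = testVector b x N v c' := by
    intro c
    refine ⟨fun k => if h : k ∈ J then c ⟨k, h⟩ else 0, fun k h => by simp [h],
      fun k h => by simp [h], ?_⟩
    rw [testVector, ← Finset.sum_subset (Finset.subset_univ J), ← Finset.sum_coe_sort J]
    · exact Finset.sum_congr rfl fun k _ => by simp [g]
    · intro k _ hk; simp [hk]
  -- The `N`-form of a combination is at least `(τ - r η) ∑ ‖c k‖²`, so by `h1` a vanishing
  -- combination has zero coefficients. This gives the span its full dimension `#J`.
  have hli : LinearIndependent 𝕜 (fun k : J => g k) := by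
    rw [Fintype.linearIndependent_iff]
    intro c hc k
    obtain ⟨c', h1', h2', h3'⟩ := hext c
    have hk := key c'
    rw [← h3', hc] at hk
    simp only [inner_zero_right, norm_zero, ne_eq, OfNat.ofNat_ne_zero, not_false_eq_true,
      zero_pow, mul_zero, Finset.sum_const_zero, zero_sub, abs_neg] at hk
    have hs : 0 ≤ ∑ k, ‖c' k‖ ^ 2 := by positivity
    have hs0 : ∑ k, ‖c' k‖ ^ 2 = 0 := by
      by_contra hne
      have : 0 < ∑ k, ‖c' k‖ ^ 2 := lt_of_le_of_ne hs (Ne.symm hne)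
      have := (le_abs_self _).trans hk
      nlinarith
    have := (Finset.sum_eq_zero_iff_of_nonneg (fun k _ => by positivity)).1 hs0 k (by simp)
    rw [← h1' k k.2]
    simpa using this
  refine ⟨Submodule.span 𝕜 (Set.range fun k : J => g k), by simp [finrank_span_eq_card hli], ?_⟩
  intro w hw
  obtain ⟨c₀, rfl⟩ := (Submodule.mem_span_range_iff_exists_fun 𝕜).1 hw
  obtain ⟨c, -, hc0, hc⟩ := hext c₀
  rw [hc]
  set s := ∑ l, ‖c l‖ with hs
  set q := ∑ l, ‖c l‖ ^ 2 with hq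
  have hsq : s ^ 2 ≤ r * q := by
    simpa using sq_sum_le_card_mul_sum_sq (s := Finset.univ) (f := fun k : Fin r => ‖c k‖)
  have hs0 : 0 ≤ s := by positivity
  have hq0 : 0 ≤ q := by positivity
  have hα : ∀ m, ‖⟪v m, diagOp b (fun i => √(x i)) (testVector b x N v c)⟫_𝕜
      - (τ : 𝕜) * c m‖ ≤ η * s := by
    intro m
    rw [inner_diagOp_sqrt_testVector b hx]
    have : (τ : 𝕜) * c m = ∑ l, c l * (if m = l then (τ : 𝕜) else 0) := by
      simp [mul_comm]
    rw [this, ← Finset.sum_sub_distrib, hs, Finset.mul_sum]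
    refine (norm_sum_le _ _).trans (Finset.sum_le_sum fun l _ => ?_)
    rw [← mul_sub, norm_mul, mul_comm]
    gcongr
    exact hG m l
  -- For `m ∈ J` the pairing is within `η s` of `τ c m`. For `m ∉ J` the coefficient vanishes and
  -- only the leakage `η s` is left, so even a negative `p m` costs at most `C (η s)²`.
  have hterm : ∀ m, p₀ * (τ ^ 2 * ‖c m‖ ^ 2 - 2 * τ * η * s * ‖c m‖) - C * (η * s) ^ 2
      ≤ p m * ‖⟪v m, diagOp b (fun i => √(x i)) (testVector b x N v c)⟫_𝕜‖ ^ 2 := by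
    intro m
    have hm := hα m
    set α := ⟪v m, diagOp b (fun i => √(x i)) (testVector b x N v c)⟫_𝕜
    have hC0 : 0 ≤ C := (abs_nonneg _).trans (hC m)
    by_cases hmJ : m ∈ J
    · have h3 : τ * ‖c m‖ - η * s ≤ ‖α‖ := by
        have := norm_sub_norm_le ((τ : 𝕜) * c m) α
        rw [norm_sub_rev, norm_mul, RCLike.norm_ofReal, abs_of_pos hτ] at this
        linarith
      have h4 : τ ^ 2 * ‖c m‖ ^ 2 - 2 * τ * η * s * ‖c m‖ ≤ ‖α‖ ^ 2 := by
        by_cases h5 : 0 ≤ τ * ‖c m‖ - η * s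
        · have := pow_le_pow_left₀ h5 h3 2
          nlinarith [sq_nonneg (η * s)]
        · push Not at h5
          have : 0 ≤ τ * ‖c m‖ := by positivity
          nlinarith [sq_nonneg ‖α‖, mul_nonneg this (mul_nonneg hη hs0)]
      have h6 := mul_le_mul_of_nonneg_left h4 hp₀.le
      have h7 := mul_le_mul_of_nonneg_right (hJ m hmJ) (sq_nonneg ‖α‖)
      have h8 : 0 ≤ C * (η * s) ^ 2 := by positivity
      linarith
    · rw [hc0 m hmJ] at hm ⊢
      simp only [mul_zero, sub_zero] at hm
      have h3 := pow_le_pow_left₀ (norm_nonneg α) hm 2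
      have h4 := mul_le_mul_of_nonneg_left h3 hC0
      have h5 := mul_le_mul_of_nonneg_right (neg_le_of_abs_le (hC m)) (sq_nonneg ‖α‖)
      simp
      linarith
  have hsum := Finset.sum_le_sum fun m (_ : m ∈ Finset.univ) => hterm m
  refine le_trans ?_ hsum
  have hk := (abs_le.1 (key c)).2
  rw [← hq] at hk
  have hL : ∑ m, (p₀ * (τ ^ 2 * ‖c m‖ ^ 2 - 2 * τ * η * s * ‖c m‖) - C * (η * s) ^ 2)
      = p₀ * τ ^ 2 * q - 2 * p₀ * τ * η * s ^ 2 - r * C * η ^ 2 * s ^ 2 := by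
    rw [Finset.sum_sub_distrib, ← Finset.mul_sum, Finset.sum_sub_distrib, ← Finset.mul_sum,
      ← Finset.mul_sum, ← hq, ← hs]
    simp; ring
  rw [hL]
  rcases Nat.eq_zero_or_pos r with hr | hr
  · subst hr
    simp [q, s] at hk ⊢
    linarith
  have hC0 : 0 ≤ C := (abs_nonneg _).trans (hC ⟨0, hr⟩)
  have e1 : 2 * p₀ * τ * η * s ^ 2 ≤ 2 * p₀ * τ * η * (r * q) := by gcongr
  have e2 : r * C * η ^ 2 * s ^ 2 ≤ r * C * η ^ 2 * (r * q) := by gcongr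
  have e3 := mul_le_mul_of_nonneg_right h2 hq0
  nlinarith

/-- If the Gram matrix of the frame `v` for `x / N` is close to `τ`, then the form of
`x^{1/2} (∑ p k v k v k*) x^{1/2}` is dominated by `N` on a subspace of codimension at most `#J`,
provided the `p k`, `k ∉ J`, are at most `p₀` with `p₀ * τ < 1` up to the error. -/
theorem exists_subspace_form_le [FiniteDimensional 𝕜 E] (b : OrthonormalBasis ι 𝕜 E) {x N : ι → ℝ}
    (hx : ∀ i, 0 ≤ x i) (hN : ∀ i, 0 < N i) (v : Fin r → E) (p : Fin r → ℝ) (J : Finset (Fin r))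
    {p₀ τ η : ℝ} (hp₀ : 0 < p₀) (hJ : ∀ k, k ∉ J → p k ≤ p₀)
    (hG : ∀ k l, ‖⟪v k, diagOp b (fun i => x i / N i) (v l)⟫_𝕜
      - (if k = l then (τ : 𝕜) else 0)‖ ≤ η)
    (h2 : p₀ * (τ + r * η) ≤ 1) :
    ∃ W : Submodule 𝕜 E, Module.finrank 𝕜 E ≤ Module.finrank 𝕜 W + J.card ∧ ∀ w ∈ W,
      ∑ k, p k * ‖⟪v k, diagOp b (fun i => √(x i)) w⟫_𝕜‖ ^ 2
        ≤ ∑ i, N i * ‖⟪b i, w⟫_𝕜‖ ^ 2 := by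
  classical
  let φ : E →ₗ[𝕜] (J → 𝕜) :=
    LinearMap.pi fun k => (innerₛₗ 𝕜 (v k)).comp (diagOp b (fun i => √(x i)))
  refine ⟨LinearMap.ker φ, ?_, ?_⟩
  · have h := LinearMap.finrank_range_add_finrank_ker φ
    have h' := Submodule.finrank_le (LinearMap.range φ)
    simp only [Module.finrank_fintype_fun_eq_card, Fintype.card_coe] at h'
    omega
  intro w hw
  set α : Fin r → 𝕜 := fun k => ⟪v k, diagOp b (fun i => √(x i)) w⟫_𝕜 with hα
  have hα0 : ∀ k ∈ J, α k = 0 := fun k hk => congrFun (LinearMap.mem_ker.1 hw) ⟨k, hk⟩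
  set A := ∑ i, N i * ‖⟪b i, w⟫_𝕜‖ ^ 2 with hA
  set q := ∑ k, ‖α k‖ ^ 2 with hq
  have hA0 : 0 ≤ A := Finset.sum_nonneg fun i _ => mul_nonneg (hN i).le (by positivity)
  have hq0 : 0 ≤ q := by positivity
  have hpq : ∑ k, p k * ‖α k‖ ^ 2 ≤ p₀ * q := by
    rw [hq, Finset.mul_sum]
    refine Finset.sum_le_sum fun k _ => ?_
    by_cases hk : k ∈ J
    · simp [hα0 k hk]
    · gcongr
      exact hJ k hk
  refine hpq.trans ?_
  -- Duality: `q = ⟨y, x^{1/2} w⟩`, and Cauchy–Schwarz with the dual weights `x / N` and `N` gives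
  -- `q² ≤ (τ + r η) q A`, hence `q ≤ (τ + r η) A`.
  set y : E := ∑ k, α k • v k with hy
  have hyG : (((∑ i, x i / N i * ‖⟪b i, y⟫_𝕜‖ ^ 2 : ℝ)) : 𝕜)
      = ∑ k, ∑ l, (starRingEnd 𝕜) (α k) * α l *
          ⟪v k, diagOp b (fun i => x i / N i) (v l)⟫_𝕜 := by
    rw [← inner_diagOp_self, hy]
    simp only [map_sum, map_smul, inner_sum, sum_inner, inner_smul_right, inner_smul_left]
    rw [Finset.sum_comm]
    refine Finset.sum_congr rfl fun k _ => ?_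
    rw [Finset.mul_sum]
    exact Finset.sum_congr rfl fun l _ => by ring
  have hB : ∑ i, x i / N i * ‖⟪b i, y⟫_𝕜‖ ^ 2 ≤ (τ + r * η) * q := by
    have := norm_sum_gram_sub_le hG α
    rw [← hyG, ← RCLike.ofReal_sub, RCLike.norm_ofReal] at this
    have := (abs_le.1 this).2
    linarith
  have hqy : ((q : ℝ) : 𝕜) = ⟪y, diagOp b (fun i => √(x i)) w⟫_𝕜 := by
    rw [hy, sum_inner, hq]
    push_cast
    refine Finset.sum_congr rfl fun k _ => ?_
    rw [inner_smul_left, ← RCLike.conj_mul]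
  have hCS : q ^ 2 ≤ (∑ i, x i / N i * ‖⟪b i, y⟫_𝕜‖ ^ 2) * A := by
    have h1 : q ≤ ∑ i, (√(x i / N i) * ‖⟪b i, y⟫_𝕜‖) * (√(N i) * ‖⟪b i, w⟫_𝕜‖) := by
      have : q = ‖((q : ℝ) : 𝕜)‖ := by rw [RCLike.norm_ofReal, abs_of_nonneg hq0]
      rw [this, hqy, inner_diagOp_right]
      refine (norm_sum_le _ _).trans (Finset.sum_le_sum fun i _ => le_of_eq ?_)
      rw [norm_mul, norm_mul, RCLike.norm_ofReal, abs_of_nonneg (Real.sqrt_nonneg _),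
        norm_inner_symm y, Real.sqrt_div (hx i)]
      have := (Real.sqrt_pos.2 (hN i)).ne'
      field_simp
    have h2 := Finset.sum_mul_sq_le_sq_mul_sq Finset.univ
      (fun i => √(x i / N i) * ‖⟪b i, y⟫_𝕜‖) (fun i => √(N i) * ‖⟪b i, w⟫_𝕜‖)
    refine (pow_le_pow_left₀ hq0 h1 2).trans (h2.trans (le_of_eq ?_))
    congr 1
    · exact Finset.sum_congr rfl fun i _ => by
        rw [mul_pow, Real.sq_sqrt (div_nonneg (hx i) (hN i).le)]
    · exact Finset.sum_congr rfl fun i _ => by rw [mul_pow, Real.sq_sqrt (hN i).le]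
  rcases hq0.eq_or_lt with h0 | h0
  · rw [← h0]; simpa using hA0
  have h3 : q * q ≤ ((τ + r * η) * A) * q := by
    have := mul_le_mul_of_nonneg_right hB hA0
    nlinarith
  have h4 := le_of_mul_le_mul_right h3 h0
  calc p₀ * q ≤ p₀ * ((τ + r * η) * A) := by gcongr
    _ = (p₀ * (τ + r * η)) * A := by ring
    _ ≤ 1 * A := by gcongr
    _ = A := one_mul A

end TestSubspaces

/-! ### Spectral decompositions of `X`, `P` and `X (1 + P)`; projections onto eigenspaces. -/

section MatrixStructure

variable {𝕜 : Type*} [RCLike 𝕜] {n r : ℕ}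

theorem toEuclideanLin_mul_apply (A B : Matrix (Fin n) (Fin n) 𝕜) (v : EuclideanSpace 𝕜 (Fin n)) :
    Matrix.toEuclideanLin (A * B) v = Matrix.toEuclideanLin A (Matrix.toEuclideanLin B v) := by
  rw [Matrix.toEuclideanLin, Matrix.toLpLin_mul_same]; rfl

theorem toEuclideanLin_one_apply (v : EuclideanSpace 𝕜 (Fin n)) :
    Matrix.toEuclideanLin (1 : Matrix (Fin n) (Fin n) 𝕜) v = v := by
  rw [Matrix.toEuclideanLin, Matrix.toLpLin_one]; rfl

theorem orderedEigenvalue_antitone {A : Matrix (Fin n) (Fin n) 𝕜} (hA : A.IsHermitian) :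
    Antitone fun i : Fin n => orderedEigenvalue A i := by
  intro i j hij
  have hc : Fintype.card (Fin n) = n := Fintype.card_fin n
  have h1 := orderedEigenvalue_eq hA (Fin.cast hc.symm i)
  have h2 := orderedEigenvalue_eq hA (Fin.cast hc.symm j)
  simp only [Fin.val_cast] at h1 h2
  simp only [h1, h2]
  exact hA.eigenvalues₀_antitone (by simpa using hij)

theorem exists_equiv_eigenvalues_eq {A : Matrix (Fin n) (Fin n) 𝕜} (hA : A.IsHermitian) :
    ∃ σ : Fin n ≃ Fin n, ∀ i, hA.eigenvalues i = orderedEigenvalue A (σ i) := by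
  have hc : Fintype.card (Fin n) = n := Fintype.card_fin n
  let σ : Fin n ≃ Fin n :=
    (Fintype.equivOfCardEq (Fintype.card_fin (Fintype.card (Fin n)))).symm.trans (finCongr hc)
  refine ⟨σ, fun i => ?_⟩
  have := orderedEigenvalue_eq hA (Fin.cast hc.symm (σ i))
  simp only [Fin.val_cast] at this
  rw [this]
  rfl

/-- Spectral theorem, with the eigenvalues listed in decreasing order. -/
theorem exists_eigenbasis {A : Matrix (Fin n) (Fin n) 𝕜} (hA : A.IsHermitian) :
    ∃ e : OrthonormalBasis (Fin n) 𝕜 (EuclideanSpace 𝕜 (Fin n)),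
      Matrix.toEuclideanLin A = diagOp e fun i => orderedEigenvalue A i := by
  obtain ⟨σ, hσ⟩ := exists_equiv_eigenvalues_eq hA
  refine ⟨hA.eigenvectorBasis.reindex σ, ?_⟩
  refine (hA.eigenvectorBasis.reindex σ).toBasis.ext fun j => ?_
  apply ext_orthonormalBasis (hA.eigenvectorBasis.reindex σ)
  intro i
  rw [inner_diagOp]
  have h : Matrix.toEuclideanLin A (hA.eigenvectorBasis (σ.symm j))
      = ((orderedEigenvalue A j : ℝ) : 𝕜) • hA.eigenvectorBasis (σ.symm j) := by
    ext k
    have := congrFun (hA.mulVec_eigenvectorBasis (σ.symm j)) k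
    rw [hσ, σ.apply_symm_apply] at this
    simpa [Matrix.toLpLin_apply, RCLike.real_smul_eq_coe_mul] using this
  have hij := orthonormal_iff_ite.1 hA.eigenvectorBasis.orthonormal (σ.symm i) (σ.symm j)
  simp only [OrthonormalBasis.coe_toBasis, OrthonormalBasis.reindex_apply, h, inner_smul_right, hij]
  by_cases hij' : i = j <;> simp [hij']

theorem roots_charpoly_eq_map_orderedEigenvalue {A : Matrix (Fin n) (Fin n) 𝕜}
    (hA : A.IsHermitian) :
    A.charpoly.roots = (Finset.univ : Finset (Fin n)).val.map
      fun i : Fin n => ((orderedEigenvalue A i : ℝ) : 𝕜) := by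
  obtain ⟨σ, hσ⟩ := exists_equiv_eigenvalues_eq hA
  rw [hA.roots_charpoly_eq_eigenvalues]
  have : (RCLike.ofReal ∘ hA.eigenvalues : Fin n → 𝕜)
      = (fun i : Fin n => ((orderedEigenvalue A i : ℝ) : 𝕜)) ∘ σ := by
    ext i; simp [hσ]
  rw [this, ← Multiset.map_map]
  congr 1
  simp

/-- A Hermitian matrix with prescribed non-zero spectrum is diagonal in an orthonormal frame. -/
theorem HasNonzeroSpectrum.exists_frame {P : Matrix (Fin n) (Fin n) 𝕜} {θ : Fin r → ℝ}
    (hP : HasNonzeroSpectrum P θ) :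
    ∃ v : Fin r → EuclideanSpace 𝕜 (Fin n), Orthonormal 𝕜 v ∧
      Matrix.toEuclideanLin P = frameOp v θ := by
  classical
  obtain ⟨hH, hχ⟩ := hP
  obtain ⟨e, he⟩ := exists_eigenbasis hH
  set p : Fin n → ℝ := fun i => orderedEigenvalue P i with hp
  let g : Fin (n - r) ⊕ Fin r → ℝ := Sum.elim (fun _ => 0) θ
  have hroots : (Finset.univ : Finset (Fin n)).val.map p
      = (Finset.univ : Finset (Fin (n - r) ⊕ Fin r)).val.map g := by
    apply Multiset.map_injective (RCLike.ofReal_injective (K := 𝕜))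
    rw [Multiset.map_map, Multiset.map_map]
    have h1 := roots_charpoly_eq_map_orderedEigenvalue hH
    have : (Polynomial.X ^ (n - r) *
      ∏ i : Fin r, (Polynomial.X - Polynomial.C ((θ i : ℝ) : 𝕜)))
       = ((Finset.univ.val.map (fun i => ((g i : ℝ) : 𝕜))).map
          fun a => Polynomial.X - Polynomial.C a).prod := by
      rw [Multiset.map_map]
      change _ = ∏ i : Fin (n - r) ⊕ Fin r, (Polynomial.X - Polynomial.C ((g i : ℝ) : 𝕜))
      rw [Fintype.prod_sum_type]
      simp [g]
    rw [hχ, this, Polynomial.roots_multiset_prod_X_sub_C] at h1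
    exact h1.symm
  -- Equality of the two multisets makes the fibres of `g` and `p` over each value equinumerous.
  -- Gluing bijections of fibres gives a relabelling `F` of the eigenbasis with `p ∘ F = g`; the
  -- frame is its part indexed by `Fin r`.
  have hcard : ∀ c, Nonempty ({a // g a = c} ≃ {b // p b = c}) := by
    intro c
    have h := congrArg (Multiset.count c) hroots
    rw [Multiset.count_map, Multiset.count_map] at h
    refine ⟨Fintype.equivOfCardEq ?_⟩
    rw [Fintype.card_subtype, Fintype.card_subtype]
    simp only [eq_comm (a := c)] at h
    exact h.symm
  let F : (Fin (n - r) ⊕ Fin r) ≃ Fin n := Equiv.ofFiberEquiv fun c => (hcard c).some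
  have hF : ∀ a, p (F a) = g a := fun a => Equiv.ofFiberEquiv_map _ a
  refine ⟨fun k => e (F (Sum.inr k)),
    e.orthonormal.comp _ (F.injective.comp Sum.inr_injective), ?_⟩
  rw [he]
  ext1 w
  simp only [diagOp, frameOp, LinearMap.coe_mk, AddHom.coe_mk]
  rw [← F.sum_comp, Fintype.sum_sum_type]
  simp [hF, g]

/-- The squared Hilbert–Schmidt norm of `P B P`. -/
def compressionEnergy (P B : Matrix (Fin n) (Fin n) 𝕜) : ℝ :=
  RCLike.re (Matrix.trace (P * B * P * (P * B * P)))

theorem inner_toEuclideanLin_symm {B : Matrix (Fin n) (Fin n) 𝕜} (hB : B.IsHermitian)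
    (v w : EuclideanSpace 𝕜 (Fin n)) :
    ⟪Matrix.toEuclideanLin B v, w⟫_𝕜 = ⟪v, Matrix.toEuclideanLin B w⟫_𝕜 :=
  Matrix.isSymmetric_toEuclideanLin_iff.2 hB v w

theorem frameOp_symm {v : Fin r → EuclideanSpace 𝕜 (Fin n)} {θ : Fin r → ℝ}
    (x y : EuclideanSpace 𝕜 (Fin n)) :
    ⟪frameOp (𝕜 := 𝕜) v θ x, y⟫_𝕜 = ⟪x, frameOp (𝕜 := 𝕜) v θ y⟫_𝕜 := by
  rw [← inner_conj_symm, inner_frameOp_right, inner_frameOp_right, map_sum]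
  refine Finset.sum_congr rfl fun k _ => ?_
  simp only [map_mul, RCLike.conj_ofReal, inner_conj_symm]
  ring

theorem norm_frameOp_sq {v : Fin r → EuclideanSpace 𝕜 (Fin n)} (hv : Orthonormal 𝕜 v)
    (θ : Fin r → ℝ) (x : EuclideanSpace 𝕜 (Fin n)) :
    ‖frameOp (𝕜 := 𝕜) v θ x‖ ^ 2 = ∑ k, θ k ^ 2 * ‖⟪v k, x⟫_𝕜‖ ^ 2 := by
  have h : ⟪frameOp (𝕜 := 𝕜) v θ x, frameOp (𝕜 := 𝕜) v θ x⟫_𝕜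
      = ((∑ k, θ k ^ 2 * ‖⟪v k, x⟫_𝕜‖ ^ 2 : ℝ) : 𝕜) := by
    rw [frameOp_symm, inner_frameOp_right]
    push_cast
    refine Finset.sum_congr rfl fun k _ => ?_
    rw [inner_frameOp hv, ← inner_conj_symm x (v k), ← RCLike.conj_mul]
    ring
  rw [inner_self_eq_norm_sq_to_K] at h
  exact_mod_cast h

/-- The left side is continuous in `P` and `B` and mentions no frame, so it can be integrated over
the probability space. The right side shows that, when no `θ k` vanishes, it controls every entry of
`B` in whatever frame is picked. -/
theorem compressionEnergy_eq {P B : Matrix (Fin n) (Fin n) 𝕜} {v : Fin r → EuclideanSpace 𝕜 (Fin n)}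
    {θ : Fin r → ℝ} (hv : Orthonormal 𝕜 v) (hP : Matrix.toEuclideanLin P = frameOp v θ)
    (hB : B.IsHermitian) :
    compressionEnergy P B = ∑ k, ∑ l, θ k ^ 2 * θ l ^ 2 *
      ‖⟪v k, Matrix.toEuclideanLin B (v l)⟫_𝕜‖ ^ 2 := by
  have hPs : P.IsHermitian := by
    rw [← Matrix.isSymmetric_toEuclideanLin_iff, hP]
    exact frameOp_symm
  let e := EuclideanSpace.basisFun (Fin n) 𝕜
  set M := P * B * P with hM
  have hMs : M.IsHermitian := by
    rw [Matrix.IsHermitian, hM, Matrix.conjTranspose_mul, Matrix.conjTranspose_mul, hPs.eq, hB.eq,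
      Matrix.mul_assoc]
  have htr : Matrix.trace (M * M) = ((∑ i, ‖Matrix.toEuclideanLin M (e i)‖ ^ 2 : ℝ) : 𝕜) := by
    have h1 : Matrix.trace (M * M)
        = ∑ i, ⟪e i, Matrix.toEuclideanLin (M * M) (e i)⟫_𝕜 := by
      simp only [Matrix.trace, Matrix.diag]
      refine Finset.sum_congr rfl fun i _ => ?_
      simp [e, EuclideanSpace.inner_single_left, Matrix.toLpLin_apply, Matrix.mul_apply,
        Matrix.mulVec, dotProduct, Matrix.col_apply]
    rw [h1]
    push_cast
    refine Finset.sum_congr rfl fun i _ => ?_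
    rw [toEuclideanLin_mul_apply, ← inner_toEuclideanLin_symm hMs, inner_self_eq_norm_sq_to_K]
  have hterm : ∀ x, ‖Matrix.toEuclideanLin M x‖ ^ 2 = ∑ k, θ k ^ 2 *
      ‖⟪Matrix.toEuclideanLin P (Matrix.toEuclideanLin B (v k)), x⟫_𝕜‖ ^ 2 := by
    intro x
    rw [hM, toEuclideanLin_mul_apply, toEuclideanLin_mul_apply, hP, norm_frameOp_sq hv]
    refine Finset.sum_congr rfl fun k _ => ?_
    rw [← inner_toEuclideanLin_symm hB, ← frameOp_symm]
  rw [compressionEnergy, htr, RCLike.ofReal_re]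
  simp only [hterm]
  rw [Finset.sum_comm]
  refine Finset.sum_congr rfl fun k _ => ?_
  rw [← Finset.mul_sum, e.sum_sq_norm_inner_left, hP, norm_frameOp_sq hv, Finset.mul_sum]
  refine Finset.sum_congr rfl fun l _ => ?_
  rw [← inner_toEuclideanLin_symm hB, norm_inner_symm, ← mul_assoc, norm_inner_symm]

/-- Orthogonal projection onto the span of part of an orthonormal frame. -/
theorem projNorm_sq_span {v : Fin r → EuclideanSpace 𝕜 (Fin n)} (hv : Orthonormal 𝕜 v)
    (s : Finset (Fin r)) (u : EuclideanSpace 𝕜 (Fin n)) :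
    projNorm u (Submodule.span 𝕜 (v '' s)) ^ 2 = ∑ k ∈ s, ‖⟪v k, u⟫_𝕜‖ ^ 2 := by
  classical
  have h : (Submodule.span 𝕜 (v '' s)).starProjection u = ∑ k ∈ s, ⟪v k, u⟫_𝕜 • v k := by
    apply Submodule.eq_starProjection_of_mem_of_inner_eq_zero
    · exact Submodule.sum_mem _ fun k hk => Submodule.smul_mem _ _
        (Submodule.subset_span ⟨k, hk, rfl⟩)
    · intro w hw
      induction hw using Submodule.span_induction with
      | mem w hw =>
        obtain ⟨m, hm, rfl⟩ := hw
        rw [← inner_conj_symm, inner_sub_right, hv.inner_right_sum _ hm, sub_self, map_zero]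
      | zero => simp
      | add x y _ _ hx hy => rw [inner_add_right, hx, hy, add_zero]
      | smul c x _ hx => rw [inner_smul_right, hx, mul_zero]
  have h2 : ⟪∑ k ∈ s, ⟪v k, u⟫_𝕜 • v k, ∑ k ∈ s, ⟪v k, u⟫_𝕜 • v k⟫_𝕜
      = ((∑ k ∈ s, ‖⟪v k, u⟫_𝕜‖ ^ 2 : ℝ) : 𝕜) := by
    rw [sum_inner]
    push_cast
    refine Finset.sum_congr rfl fun k hk => ?_
    rw [inner_smul_left, hv.inner_right_sum _ hk, RCLike.conj_mul]
  rw [inner_self_eq_norm_sq_to_K] at h2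
  rw [projNorm, h]
  exact_mod_cast h2

theorem kerSub_eq_span {P : Matrix (Fin n) (Fin n) 𝕜} {v : Fin r → EuclideanSpace 𝕜 (Fin n)}
    {θ : Fin r → ℝ} (hv : Orthonormal 𝕜 v) (hP : Matrix.toEuclideanLin P = frameOp v θ)
    {t : ℝ} (ht : t ≠ 0) :
    kerSub P t = Submodule.span 𝕜 (v '' (Finset.univ.filter fun k => θ k = t : Finset (Fin r))) := by
  have hmem : ∀ x, x ∈ kerSub P t ↔ frameOp (𝕜 := 𝕜) v θ x = (t : 𝕜) • x := by
    intro x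
    rw [kerSub, LinearMap.mem_ker, map_sub, LinearMap.sub_apply, map_smul, LinearMap.smul_apply,
      toEuclideanLin_one_apply, hP, sub_eq_zero, eq_comm]
  have ht' : (t : 𝕜) ≠ 0 := by exact_mod_cast ht
  apply le_antisymm
  · intro x hx
    rw [hmem] at hx
    have hx2 : x = (t : 𝕜)⁻¹ • frameOp (𝕜 := 𝕜) v θ x := by
      rw [hx, smul_smul, inv_mul_cancel₀ ht', one_smul]
    rw [hx2]
    refine Submodule.smul_mem _ _ ?_
    simp only [frameOp, LinearMap.coe_mk, AddHom.coe_mk]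
    refine Submodule.sum_mem _ fun k _ => ?_
    by_cases hk : θ k = t
    · exact Submodule.smul_mem _ _ (Submodule.subset_span ⟨k, by simp [hk], rfl⟩)
    · have h1 := inner_frameOp hv θ k x
      rw [hx, inner_smul_right] at h1
      have h2 : ⟪v k, x⟫_𝕜 = 0 := by
        have h3 : ((θ k : 𝕜) - t) * ⟪v k, x⟫_𝕜 = 0 := by rw [sub_mul, h1, sub_self]
        refine (mul_eq_zero.1 h3).resolve_left ?_
        rw [sub_eq_zero]
        exact_mod_cast hk
      simp [h2]
  · rw [Submodule.span_le]
    rintro _ ⟨k, hk, rfl⟩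
    have hk' : θ k = t := by simpa using hk
    change v k ∈ kerSub P t
    rw [hmem]
    have h1 := orthonormal_iff_ite.1 hv
    simp [frameOp, h1, hk']

theorem iSup_kerSub_eq_span {P : Matrix (Fin n) (Fin n) 𝕜} {v : Fin r → EuclideanSpace 𝕜 (Fin n)}
    {θ : Fin r → ℝ} (hv : Orthonormal 𝕜 v) (hP : Matrix.toEuclideanLin P = frameOp v θ)
    (hθ : ∀ i, θ i ≠ 0) (t : ℝ) :
    ⨆ j : {j : Fin r // θ j ≠ t}, kerSub P (θ j)
      = Submodule.span 𝕜 (v '' (Finset.univ.filter fun k => θ k ≠ t : Finset (Fin r))) := by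
  simp only [kerSub_eq_span hv hP (hθ _)]
  rw [← Submodule.span_iUnion]
  congr 1
  ext x
  simp only [Set.mem_iUnion, Set.mem_image, Finset.coe_filter, Finset.mem_univ, true_and,
    Set.mem_ofPred_eq]
  constructor
  · rintro ⟨⟨j, hj⟩, k, hk, rfl⟩
    exact ⟨k, by rw [hk]; exact hj, rfl⟩
  · rintro ⟨k, hk, rfl⟩
    exact ⟨⟨k, hk⟩, k, rfl, rfl⟩

/-- The quadratic form of the Hermitian matrix `X^{1/2} (1 + P) X^{1/2}`, which has the same
spectrum as `X (1 + P)`. -/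
theorem exists_eigenbasis_perturbed {X P : Matrix (Fin n) (Fin n) 𝕜}
    {b : OrthonormalBasis (Fin n) 𝕜 (EuclideanSpace 𝕜 (Fin n))} {x : Fin n → ℝ}
    (hx : ∀ i, 0 ≤ x i) (hX : Matrix.toEuclideanLin X = diagOp b x)
    {v : Fin r → EuclideanSpace 𝕜 (Fin n)} {θ : Fin r → ℝ}
    (hP : Matrix.toEuclideanLin P = frameOp v θ) :
    (Antitone fun i : Fin n => orderedEigenvalue (perturbed X P) i) ∧
    ∃ e : OrthonormalBasis (Fin n) 𝕜 (EuclideanSpace 𝕜 (Fin n)), ∀ w,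
      ∑ i : Fin n, orderedEigenvalue (perturbed X P) i * ‖⟪e i, w⟫_𝕜‖ ^ 2
        = ∑ i, x i * ‖⟪b i, w⟫_𝕜‖ ^ 2
          + ∑ k, θ k * ‖⟪v k, diagOp b (fun i => √(x i)) w⟫_𝕜‖ ^ 2 := by
  set Y : Matrix (Fin n) (Fin n) 𝕜 := Matrix.toEuclideanLin.symm (diagOp b fun i => √(x i)) with hY
  have hYa : Matrix.toEuclideanLin Y = diagOp b fun i => √(x i) := by
    rw [hY, LinearEquiv.apply_symm_apply]
  have hYY : Y * Y = X := by
    apply Matrix.toEuclideanLin.injective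
    ext1 w
    rw [toEuclideanLin_mul_apply, hYa, diagOp_diagOp, hX]
    simp only [Real.mul_self_sqrt (hx _)]
  have hYs : Y.IsHermitian := by
    rw [← Matrix.isSymmetric_toEuclideanLin_iff, hYa]
    exact diagOp_symm b _
  have hPs : P.IsHermitian := by
    rw [← Matrix.isSymmetric_toEuclideanLin_iff, hP]
    exact frameOp_symm
  set H := Y * (1 + P) * Y with hH
  have hHs : H.IsHermitian := by
    rw [Matrix.IsHermitian, hH, Matrix.conjTranspose_mul, Matrix.conjTranspose_mul,
      Matrix.conjTranspose_add, hPs.eq, hYs.eq, Matrix.conjTranspose_one, Matrix.mul_assoc]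
  -- Cyclic invariance: `X (1 + P) = Y * (Y (1 + P))` and `H = (Y (1 + P)) * Y`.
  have hχ : (perturbed X P).charpoly = H.charpoly := by
    rw [perturbed, hH, ← hYY, Matrix.mul_assoc, Matrix.charpoly_mul_comm]
  have hoe : ∀ k, orderedEigenvalue (perturbed X P) k = orderedEigenvalue H k := fun k => by
    rw [orderedEigenvalue, orderedEigenvalue, hχ]
  simp only [hoe]
  refine ⟨orderedEigenvalue_antitone hHs, ?_⟩
  obtain ⟨e, he⟩ := exists_eigenbasis hHs
  refine ⟨e, fun w => ?_⟩
  have h1 := inner_diagOp_self e (fun i : Fin n => orderedEigenvalue H i) w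
  rw [← he, hH, toEuclideanLin_mul_apply, toEuclideanLin_mul_apply, hYa, ← diagOp_symm, map_add,
    LinearMap.add_apply, toEuclideanLin_one_apply, inner_add_right, hP, inner_frameOp_self,
    inner_self_eq_norm_sq_to_K] at h1
  have h2 : ‖diagOp b (fun i => √(x i)) w‖ ^ 2 = ∑ i, x i * ‖⟪b i, w⟫_𝕜‖ ^ 2 := by
    rw [norm_diagOp_sq]
    simp only [Real.sq_sqrt (hx _)]
  rw [← h2]
  exact_mod_cast h1.symm

/-! ### Deterministic bounds on the outlier in terms of the Gram matrix at `z`. -/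

section OutlierBounds

variable {X P : Matrix (Fin n) (Fin n) 𝕜}
    {b : OrthonormalBasis (Fin n) 𝕜 (EuclideanSpace 𝕜 (Fin n))} {x : Fin n → ℝ}
    {v : Fin r → EuclideanSpace 𝕜 (Fin n)} {θ : Fin r → ℝ}

/-- Used with `N = ε (z - x)`: comparing `N` with `ε x^{1/2} P x^{1/2}` on `w` becomes comparing `ε
z ‖w‖²` with `ε` times the form of the perturbed matrix. -/
theorem form_shift_eq (x : Fin n → ℝ) (ε z : ℝ) (w : EuclideanSpace 𝕜 (Fin n)) :
    ∑ i, ε * (z - x i) * ‖⟪b i, w⟫_𝕜‖ ^ 2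
      = ε * (z * ‖w‖ ^ 2) - ε * ∑ i, x i * ‖⟪b i, w⟫_𝕜‖ ^ 2 := by
  rw [← b.sum_sq_norm_inner_right w, Finset.mul_sum, Finset.mul_sum, Finset.mul_sum,
    ← Finset.sum_sub_distrib]
  exact Finset.sum_congr rfl fun i _ => by ring

/-- Lower bound (away from the bulk) for the outlier. Here `ε = ±1` is the sign of `θ i₀`. -/
theorem mul_le_mul_outlierEigenvalue (hr : r ≤ n)
    (hx : ∀ i, 0 ≤ x i) (hX : Matrix.toEuclideanLin X = diagOp b x)
    (hθ : Antitone θ) (hP : Matrix.toEuclideanLin P = frameOp v θ) (i₀ : Fin r)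
    {ε z C τ η : ℝ} (hε : ε = 1 ∨ ε = -1) (hp₀ : 0 < ε * θ i₀) (hτ : 0 < τ)
    (hN : ∀ i, 0 < ε * (z - x i)) (hC : ∀ k, |ε * θ k| ≤ C) (hη : 0 ≤ η)
    (hG : ∀ k l, ‖⟪v k, diagOp b (fun i => x i / (ε * (z - x i))) (v l)⟫_𝕜
      - (if k = l then (τ : 𝕜) else 0)‖ ≤ η)
    (h1 : r * η < τ)
    (h2 : τ + r * η ≤ ε * θ i₀ * τ ^ 2 - 2 * (ε * θ i₀) * τ * η * r - r ^ 2 * C * η ^ 2) :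
    ε * z ≤ ε * outlierEigenvalue X P θ i₀ := by
  obtain ⟨hanti, e, he⟩ := exists_eigenbasis_perturbed hx hX hP
  set l : Fin n → ℝ := fun i => orderedEigenvalue (perturbed X P) i with hl
  have main : ∀ J : Finset (Fin r), (∀ k ∈ J, ε * θ i₀ ≤ ε * θ k) →
      ∃ W : Submodule 𝕜 (EuclideanSpace 𝕜 (Fin n)), Module.finrank 𝕜 W = J.card ∧ ∀ w ∈ W,
        ε * z * ‖w‖ ^ 2 ≤ ∑ i, ε * l i * ‖⟪e i, w⟫_𝕜‖ ^ 2 := by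
    intro J hJ
    obtain ⟨W, hW, hform⟩ := exists_subspace_form_ge b hx hN v (fun k => ε * θ k) J hp₀ hτ hJ hC hη
      hG h1 h2
    refine ⟨W, hW, fun w hw => ?_⟩
    have := hform w hw
    simp only [mul_assoc, ← Finset.mul_sum] at this ⊢
    rw [he w]
    have h3 := form_shift_eq (b := b) x ε z w
    simp only [mul_assoc, ← Finset.mul_sum] at h3
    rw [h3] at this
    linarith
  have hi := i₀.2
  rcases hε with rfl | rfl
  · have hpos : 0 < θ i₀ := by simpa using hp₀
    -- The dimension is `i₀ + 1`, one more than the number of eigenvalues listed strictly before the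
    -- zero-based index `i₀`.
    obtain ⟨W, hW, hform⟩ := main (Finset.univ.filter (· ≤ i₀)) (by
      intro k hk; simp at hk ⊢; exact hθ hk)
    rw [outlierEigenvalue, if_pos hpos]
    have hcard : (Finset.univ.filter (· ≤ i₀)).card = (i₀ : ℕ) + 1 := by
      have : (Finset.univ.filter (· ≤ i₀)) = Finset.Iic i₀ := by ext; simp
      rw [this, Fin.card_Iic]
    refine le_of_le_form e (fun i => 1 * l i) (Finset.Iio ⟨i₀, by omega⟩) W ?_ ?_ hform
    · rw [hW, hcard, Fin.card_Iio]; simp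
    · intro i hi'
      simp only [one_mul]
      exact hanti (by simpa using hi' : (⟨i₀, _⟩ : Fin n) ≤ i)
  · have hneg : ¬ 0 < θ i₀ := by linarith
    -- The dimension is `r - i₀`, one more than the number of eigenvalues listed strictly after the
    -- index `n - r + i₀`.
    obtain ⟨W, hW, hform⟩ := main (Finset.univ.filter (i₀ ≤ ·)) (by
      intro k hk; simp at hk ⊢; exact hθ hk)
    rw [outlierEigenvalue, if_neg hneg]
    have hcard : (Finset.univ.filter (i₀ ≤ ·)).card = r - i₀ := by
      have : (Finset.univ.filter (i₀ ≤ ·)) = Finset.Ici i₀ := by ext; simp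
      rw [this, Fin.card_Ici]
    refine le_of_le_form e (fun i => -1 * l i) (Finset.Ioi ⟨n - r + i₀, by omega⟩) W ?_ ?_ hform
    · rw [hW, hcard, Fin.card_Ioi]; dsimp only; omega
    · intro i hi'
      have := hanti (by simpa using hi' : i ≤ (⟨n - r + i₀, _⟩ : Fin n))
      simp only [hl] at this ⊢
      linarith

/-- Upper bound (away from the bulk) for the outlier. Here `ε = ±1` is the sign of `θ i₀`. -/
theorem mul_outlierEigenvalue_le_mul (hr : r ≤ n)
    (hx : ∀ i, 0 ≤ x i) (hX : Matrix.toEuclideanLin X = diagOp b x)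
    (hθ : Antitone θ) (hP : Matrix.toEuclideanLin P = frameOp v θ) (i₀ : Fin r)
    {ε z τ η : ℝ} (hε : ε = 1 ∨ ε = -1) (hp₀ : 0 < ε * θ i₀)
    (hN : ∀ i, 0 < ε * (z - x i))
    (hG : ∀ k l, ‖⟪v k, diagOp b (fun i => x i / (ε * (z - x i))) (v l)⟫_𝕜
      - (if k = l then (τ : 𝕜) else 0)‖ ≤ η)
    (h2 : ε * θ i₀ * (τ + r * η) ≤ 1) :
    ε * outlierEigenvalue X P θ i₀ ≤ ε * z := by
  obtain ⟨hanti, e, he⟩ := exists_eigenbasis_perturbed hx hX hP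
  set l : Fin n → ℝ := fun i => orderedEigenvalue (perturbed X P) i with hl
  have main : ∀ J : Finset (Fin r), (∀ k, k ∉ J → ε * θ k ≤ ε * θ i₀) →
      ∃ W : Submodule 𝕜 (EuclideanSpace 𝕜 (Fin n)), n ≤ Module.finrank 𝕜 W + J.card ∧ ∀ w ∈ W,
        -(ε * z) * ‖w‖ ^ 2 ≤ ∑ i, -(ε * l i) * ‖⟪e i, w⟫_𝕜‖ ^ 2 := by
    intro J hJ
    obtain ⟨W, hW, hform⟩ := exists_subspace_form_le b hx hN v (fun k => ε * θ k) J hp₀ hJ hG h2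
    refine ⟨W, by simpa using hW, fun w hw => ?_⟩
    have := hform w hw
    simp only [neg_mul, Finset.sum_neg_distrib, neg_le_neg_iff]
    simp only [mul_assoc, ← Finset.mul_sum] at this ⊢
    rw [he w]
    have h3 := form_shift_eq (b := b) x ε z w
    simp only [mul_assoc, ← Finset.mul_sum] at h3
    rw [h3] at this
    linarith
  have hi := i₀.2
  rw [← neg_le_neg_iff]
  rcases hε with rfl | rfl
  · have hpos : 0 < θ i₀ := by simpa using hp₀
    -- The codimension is at most `i₀`, so the dimension is at least `n - i₀`, while only `n - 1 -
    -- i₀` indices lie after `i₀`.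
    obtain ⟨W, hW, hform⟩ := main (Finset.Iio i₀) (by
      intro k hk; simp at hk ⊢; exact hθ hk)
    rw [outlierEigenvalue, if_pos hpos]
    rw [Fin.card_Iio] at hW
    refine le_of_le_form e (fun i => -(1 * l i)) (Finset.Ioi ⟨i₀, by omega⟩) W ?_ ?_ hform
    · rw [Fin.card_Ioi]; dsimp only; omega
    · intro i hi'
      have := hanti (by simpa using hi' : i ≤ (⟨i₀, _⟩ : Fin n))
      simp only [hl] at this ⊢
      linarith
  · have hneg : ¬ 0 < θ i₀ := by linarith
    -- The codimension is at most `r - 1 - i₀`, so the dimension exceeds the `n - r + i₀` indices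
    -- lying before `n - r + i₀`.
    obtain ⟨W, hW, hform⟩ := main (Finset.Ioi i₀) (by
      intro k hk; simp at hk ⊢; exact hθ hk)
    rw [outlierEigenvalue, if_neg hneg]
    rw [Fin.card_Ioi] at hW
    refine le_of_le_form e (fun i => -(-1 * l i)) (Finset.Iio ⟨n - r + i₀, by omega⟩) W ?_ ?_ hform
    · rw [Fin.card_Iio]; dsimp only; omega
    · intro i hi'
      have := hanti (by simpa using hi' : (⟨n - r + i₀, _⟩ : Fin n) ≤ i)
      simp only [hl] at this ⊢
      linarith

end OutlierBounds

end MatrixStructure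

/-! ### The `T`-transform off the convex hull of the support. -/

section TTransform

theorem ae_mem_Icc {μ : Measure ℝ} {a b : ℝ} (ha : IsGLB μ.support a) (hb : IsLUB μ.support b) :
    ∀ᵐ t ∂μ, t ∈ Set.Icc a b := by
  filter_upwards [Measure.support_mem_ae (μ := μ)] with t ht
  exact ⟨ha.1 ht, hb.1 ht⟩

variable {μ : Measure ℝ} [IsProbabilityMeasure μ] {a b : ℝ}

theorem le_of_support (ha : IsGLB μ.support a) (hb : IsLUB μ.support b) : a ≤ b := by
  obtain ⟨t, ht⟩ := Measure.nonempty_support (IsProbabilityMeasure.ne_zero μ)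
  exact (ha.1 ht).trans (hb.1 ht)

/-- A point off `[a, b]` is at positive distance from `[a, b]`. -/
theorem exists_dist_pos {z : ℝ} (hz : z ∉ Set.Icc a b) :
    ∃ d > 0, ∀ t ∈ Set.Icc a b, d ≤ |z - t| := by
  by_cases h : z < a
  · refine ⟨a - z, by linarith, fun t ht => ?_⟩
    rw [abs_sub_comm]
    exact le_trans (by linarith [ht.1]) (le_abs_self _)
  · have h' : b < z := by
      by_contra h2
      exact hz ⟨by linarith, by linarith⟩
    exact ⟨z - b, by linarith, fun t ht => le_trans (by linarith [ht.2]) (le_abs_self _)⟩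

theorem integrable_of_continuousOn {f : ℝ → ℝ} (hμ : ∀ᵐ t ∂μ, t ∈ Set.Icc a b)
    (hf : ContinuousOn f (Set.Icc a b)) : Integrable f μ := by
  have h : μ.restrict (Set.Icc a b) = μ := Measure.restrict_eq_self_of_ae_mem hμ
  rw [← h]
  exact hf.integrableOn_compact isCompact_Icc

theorem sub_ne_zero_of_notMem {z t : ℝ} (hz : z ∉ Set.Icc a b) (ht : t ∈ Set.Icc a b) :
    z - t ≠ 0 := fun h => hz (by rwa [sub_eq_zero.1 h])

theorem continuousOn_div_sub {z : ℝ} (hz : z ∉ Set.Icc a b) :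
    ContinuousOn (fun t => t / (z - t)) (Set.Icc a b) :=
  continuousOn_id.div (continuousOn_const.sub continuousOn_id) fun _ ht =>
    sub_ne_zero_of_notMem hz ht

theorem continuousOn_div_sub_sq {z : ℝ} (hz : z ∉ Set.Icc a b) :
    ContinuousOn (fun t => t / (z - t) ^ 2) (Set.Icc a b) :=
  continuousOn_id.div ((continuousOn_const.sub continuousOn_id).pow 2) fun _ ht =>
    pow_ne_zero 2 (sub_ne_zero_of_notMem hz ht)

theorem hasDerivAt_tTransform (hμ : ∀ᵐ t ∂μ, t ∈ Set.Icc a b) {z : ℝ} (hz : z ∉ Set.Icc a b) :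
    HasDerivAt (tTransform μ) (-∫ t, t / (z - t) ^ 2 ∂μ) z := by
  obtain ⟨d, hd, hdist⟩ := exists_dist_pos hz
  have hball : ∀ w ∈ Metric.ball z (d / 2), ∀ t ∈ Set.Icc a b, d / 2 ≤ |w - t| := by
    intro w hw t ht
    have h1 := hdist t ht
    have h2 : |z - w| < d / 2 := by rw [abs_sub_comm]; exact hw
    have h3 : |z - t| ≤ |z - w| + |w - t| := abs_sub_le z w t
    linarith
  have hout : ∀ w ∈ Metric.ball z (d / 2), w ∉ Set.Icc a b := by
    intro w hw hwI
    have := hball w hw w hwI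
    simp at this; linarith
  have hs : Metric.ball z (d / 2) ∈ 𝓝 z := Metric.ball_mem_nhds z (by positivity)
  rw [← integral_neg]
  refine (hasDerivAt_integral_of_dominated_loc_of_deriv_le (μ := μ)
    (F := fun z t => t / (z - t)) (F' := fun z t => -(t / (z - t) ^ 2)) (s := Metric.ball z (d / 2))
    (bound := fun t => |t| / (d / 2) ^ 2) hs ?_ ?_ ?_ ?_ ?_ ?_).2
  · filter_upwards [hs] with w hw
    exact (integrable_of_continuousOn hμ (continuousOn_div_sub (hout w hw))).aestronglyMeasurable
  · exact integrable_of_continuousOn hμ (continuousOn_div_sub hz)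
  · exact (integrable_of_continuousOn hμ (continuousOn_div_sub_sq hz).neg).aestronglyMeasurable
  · filter_upwards [hμ] with t ht w hw
    rw [norm_neg, Real.norm_eq_abs, abs_div, abs_pow]
    have := hball w hw t ht
    gcongr
  · exact integrable_of_continuousOn hμ (by fun_prop)
  · filter_upwards [hμ] with t ht w hw
    have hne := sub_ne_zero_of_notMem (hout w hw) ht
    have := ((hasDerivAt_const w t).div ((hasDerivAt_id w).sub_const t) hne)
    refine this.congr_deriv ?_
    simp; ring

/-- A zero integral would force `t = 0` almost everywhere. The identity would then agree almost
everywhere with a constant, and pushing `μ` forward by both gives `μ = δ₀`. -/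
theorem integral_pos_of_ne_dirac (hμ0 : μ ≠ Measure.dirac 0) {f : ℝ → ℝ} (hf : Integrable f μ)
    (hnn : ∀ᵐ t ∂μ, 0 ≤ f t) (h0 : ∀ᵐ t ∂μ, f t = 0 → t = 0) : 0 < ∫ t, f t ∂μ := by
  refine lt_of_le_of_ne (integral_nonneg_of_ae hnn) fun h => hμ0 ?_
  have h1 := (integral_eq_zero_iff_of_nonneg_ae hnn hf).1 h.symm
  have h2 : (fun t : ℝ => t) =ᵐ[μ] fun _ => 0 := by
    filter_upwards [h1, h0] with t ht ht0 using ht0 ht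
  have h3 := Measure.map_congr (mβ := Real.measurableSpace) h2
  rwa [Measure.map_id', Measure.map_const, measure_univ, one_smul] at h3

theorem integral_div_sub_sq_pos (hμ : ∀ᵐ t ∂μ, t ∈ Set.Icc a b) (ha0 : 0 ≤ a)
    (hμ0 : μ ≠ Measure.dirac 0) {z : ℝ} (hz : z ∉ Set.Icc a b) :
    0 < ∫ t, t / (z - t) ^ 2 ∂μ := by
  refine integral_pos_of_ne_dirac hμ0 (integrable_of_continuousOn hμ (continuousOn_div_sub_sq hz))
    ?_ ?_
  · filter_upwards [hμ] with t ht
    have := ha0.trans ht.1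
    positivity
  · filter_upwards [hμ] with t ht h
    have := sub_ne_zero_of_notMem hz ht
    simpa [this] using h

/-- The derivative `-∫ t / (z - t)² dμ` is negative because `μ` lives on `[0, ∞)` and is not `δ₀`.
Convexity of `s` confines the claim to one side of `[a, b]`; across the interval monotonicity fails.
-/
theorem strictAntiOn_tTransform (hμ : ∀ᵐ t ∂μ, t ∈ Set.Icc a b) (ha0 : 0 ≤ a)
    (hμ0 : μ ≠ Measure.dirac 0) {s : Set ℝ} (hs : Convex ℝ s) (hso : IsOpen s)
    (hsd : ∀ z ∈ s, z ∉ Set.Icc a b) : StrictAntiOn (tTransform μ) s := by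
  refine strictAntiOn_of_deriv_neg hs
    (fun z hz => (hasDerivAt_tTransform hμ (hsd z hz)).continuousAt.continuousWithinAt) ?_
  intro z hz
  rw [hso.interior_eq] at hz
  rw [(hasDerivAt_tTransform hμ (hsd z hz)).deriv, neg_lt_zero]
  exact integral_div_sub_sq_pos hμ ha0 hμ0 (hsd z hz)

theorem tTransform_le (hμ : ∀ᵐ t ∂μ, t ∈ Set.Icc a b) {z : ℝ} (hz : z ∉ Set.Icc a b) {C : ℝ}
    (h : ∀ t ∈ Set.Icc a b, t / (z - t) ≤ C) : tTransform μ z ≤ C := by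
  have := integral_mono_ae (integrable_of_continuousOn hμ (continuousOn_div_sub hz))
    (integrable_const C) (hμ.mono h)
  simpa [tTransform] using this

theorem le_tTransform (hμ : ∀ᵐ t ∂μ, t ∈ Set.Icc a b) {z : ℝ} (hz : z ∉ Set.Icc a b) {C : ℝ}
    (h : ∀ t ∈ Set.Icc a b, C ≤ t / (z - t)) : C ≤ tTransform μ z := by
  have := integral_mono_ae (integrable_const C)
    (integrable_of_continuousOn hμ (continuousOn_div_sub hz)) (hμ.mono h)
  simpa [tTransform] using this

theorem tTransform_nonneg (hμ : ∀ᵐ t ∂μ, t ∈ Set.Icc a b) (ha0 : 0 ≤ a) {z : ℝ} (hz : b < z) :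
    0 ≤ tTransform μ z :=
  le_tTransform hμ (fun h => absurd h.2 (by linarith)) fun t ht =>
    div_nonneg (ha0.trans ht.1) (by linarith [ht.2])

theorem tTransform_nonpos (hμ : ∀ᵐ t ∂μ, t ∈ Set.Icc a b) (ha0 : 0 ≤ a) {z : ℝ} (hz : z < a) :
    tTransform μ z ≤ 0 :=
  tTransform_le hμ (fun h => absurd h.1 (by linarith)) fun t ht =>
    div_nonpos_of_nonneg_of_nonpos (ha0.trans ht.1) (by linarith [ht.1])

theorem strictAntiOn_tTransform_Ioi (hμ : ∀ᵐ t ∂μ, t ∈ Set.Icc a b) (ha0 : 0 ≤ a)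
    (hμ0 : μ ≠ Measure.dirac 0) : StrictAntiOn (tTransform μ) (Set.Ioi b) :=
  strictAntiOn_tTransform hμ ha0 hμ0 (convex_Ioi b) isOpen_Ioi
    fun _ hz h => absurd h.2 (not_le.2 hz)

theorem strictAntiOn_tTransform_Iio (hμ : ∀ᵐ t ∂μ, t ∈ Set.Icc a b) (ha0 : 0 ≤ a)
    (hμ0 : μ ≠ Measure.dirac 0) : StrictAntiOn (tTransform μ) (Set.Iio a) :=
  strictAntiOn_tTransform hμ ha0 hμ0 (convex_Iio a) isOpen_Iio
    fun _ hz h => absurd h.1 (not_le.2 hz)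

/-- Monotonicity is what makes the one-sided limit exist in `EReal`; without it `rightLim` would
fall back on the value at the point. The order dual serves to apply the monotone limit theorem to an
antitone function. -/
theorem exists_lt_tTransform (hμ : ∀ᵐ t ∂μ, t ∈ Set.Icc a b) (ha0 : 0 ≤ a)
    (hμ0 : μ ≠ Measure.dirac 0) {c : ℝ} (hup : (c : EReal) < tTransformRight μ b) :
    ∃ z, b < z ∧ c < tTransform μ z := by
  have hanti : AntitoneOn (fun z => (tTransform μ z : EReal)) (Set.Ioi b) := fun x hx y hy hxy =>
    EReal.coe_le_coe_iff.2 ((strictAntiOn_tTransform_Ioi hμ ha0 hμ0).antitoneOn hx hy hxy)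
  have hlim := MonotoneOn.tendsto_nhdsGT (β := ERealᵒᵈ) hanti.dual_right (OrderBot.bddBelow _)
  have h2 := tendsto_rightLim_of_tendsto (f := fun z => (tTransform μ z : EReal)) (a := b)
    ⟨_, hlim⟩
  obtain ⟨z, hz, hzb⟩ := ((h2.eventually (lt_mem_nhds hup)).and self_mem_nhdsWithin).exists
  exact ⟨z, hzb, EReal.coe_lt_coe_iff.1 hz⟩

theorem exists_tTransform_lt (hμ : ∀ᵐ t ∂μ, t ∈ Set.Icc a b) (ha0 : 0 ≤ a)
    (hμ0 : μ ≠ Measure.dirac 0) {c : ℝ} (hlow : tTransformLeft μ a < (c : EReal)) :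
    ∃ z, z < a ∧ tTransform μ z < c := by
  have hanti : AntitoneOn (fun z => (tTransform μ z : EReal)) (Set.Iio a) := fun x hx y hy hxy =>
    EReal.coe_le_coe_iff.2 ((strictAntiOn_tTransform_Iio hμ ha0 hμ0).antitoneOn hx hy hxy)
  have hlim := MonotoneOn.tendsto_nhdsLT (β := ERealᵒᵈ) hanti.dual_right (OrderTop.bddAbove _)
  have h2 := tendsto_leftLim_of_tendsto (f := fun z => (tTransform μ z : EReal)) (a := a)
    ⟨_, hlim⟩
  obtain ⟨z, hz, hzb⟩ := ((h2.eventually (gt_mem_nhds hlow)).and self_mem_nhdsWithin).exists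
  exact ⟨z, hzb, EReal.coe_lt_coe_iff.1 hz⟩

/-- Supercritical values of the `T`-transform are attained off the convex hull of the support. -/
theorem exists_tTransform_eq (hμ : ∀ᵐ t ∂μ, t ∈ Set.Icc a b) (ha0 : 0 ≤ a) (hab : a ≤ b)
    (hμ0 : μ ≠ Measure.dirac 0) {c : ℝ} (hc : c ≠ 0) (hlow : tTransformLeft μ a < (c : EReal))
    (hup : (c : EReal) < tTransformRight μ b) :
    ∃ ρ, tTransform μ ρ = c ∧ ((0 < c ∧ b < ρ) ∨ (c < 0 ∧ ρ < a)) := by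
  have hb0 : 0 ≤ b := ha0.trans hab
  rcases hc.lt_or_gt with hc | hc
  · obtain ⟨z₀, hz₀, hTz₀⟩ := exists_tTransform_lt hμ ha0 hμ0 hlow
    -- At distance at least `b / |c| + 1` from `[a, b]`, every `t ∈ [0, b]` has `|t / (z₁ - t)| ≤
    -- |c|`. This gives the far endpoint for the intermediate value theorem, standing in for the
    -- decay of `T` at infinity.
    set z₁ := a - (b / (-c) + 1) with hz₁
    have hq : 0 ≤ b / (-c) := div_nonneg hb0 (by linarith)
    have h1 : z₁ < a := by linarith
    have hTz₁ : c ≤ tTransform μ z₁ := by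
      refine le_tTransform hμ (fun h => absurd h.1 (by linarith)) fun t ht => ?_
      have h2 : z₁ - t ≤ -(b / (-c)) - 1 := by linarith [ht.1]
      rw [le_div_iff_of_neg (by linarith)]
      have h3 : b / (-c) * (-c) = b := div_mul_cancel₀ b (by linarith)
      nlinarith [ht.2]
    have hle : z₁ ≤ z₀ := by
      by_contra hlt
      have := (strictAntiOn_tTransform_Iio hμ ha0 hμ0) hz₀ h1 (not_le.1 hlt)
      linarith
    have hcont : ContinuousOn (tTransform μ) (Set.Icc z₁ z₀) := fun z hz =>
      (hasDerivAt_tTransform hμ (fun h => absurd h.1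
        (by linarith [hz.2]))).continuousAt.continuousWithinAt
    obtain ⟨ρ, hρ, hTρ⟩ := intermediate_value_Icc' hle hcont ⟨hTz₀.le, hTz₁⟩
    exact ⟨ρ, hTρ, Or.inr ⟨hc, lt_of_le_of_lt hρ.2 hz₀⟩⟩
  · obtain ⟨z₀, hz₀, hTz₀⟩ := exists_lt_tTransform hμ ha0 hμ0 hup
    set z₁ := b + (b / c + 1) with hz₁
    have hq : 0 ≤ b / c := div_nonneg hb0 hc.le
    have h1 : b < z₁ := by linarith
    have hTz₁ : tTransform μ z₁ ≤ c := by
      refine tTransform_le hμ (fun h => absurd h.2 (by linarith)) fun t ht => ?_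
      have h2 : b / c + 1 ≤ z₁ - t := by linarith [ht.2]
      rw [div_le_iff₀ (by linarith)]
      have h3 : b / c * c = b := div_mul_cancel₀ b hc.ne'
      nlinarith [ht.2]
    have hle : z₀ ≤ z₁ := by
      by_contra hlt
      have := (strictAntiOn_tTransform_Ioi hμ ha0 hμ0) h1 hz₀ (not_le.1 hlt)
      linarith
    have hcont : ContinuousOn (tTransform μ) (Set.Icc z₀ z₁) := fun z hz =>
      (hasDerivAt_tTransform hμ (fun h => absurd h.2
        (by linarith [hz.1]))).continuousAt.continuousWithinAt
    obtain ⟨ρ, hρ, hTρ⟩ := intermediate_value_Icc' hle hcont ⟨hTz₁, hTz₀.le⟩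
    exact ⟨ρ, hTρ, Or.inl ⟨hc, lt_of_lt_of_le hz₀ hρ.1⟩⟩

/-- The sign of `c` selects the side of `[a, b]`, since `T ≥ 0` to the right and `T ≤ 0` to the
left. Strict monotonicity decides within that side. -/
theorem eq_of_tTransform_eq (hμ : ∀ᵐ t ∂μ, t ∈ Set.Icc a b) (ha0 : 0 ≤ a)
    (hμ0 : μ ≠ Measure.dirac 0) {c ρ z : ℝ} (hρ : (0 < c ∧ b < ρ) ∨ (c < 0 ∧ ρ < a))
    (hTρ : tTransform μ ρ = c) (hz : z ∉ Set.Icc a b) (hTz : tTransform μ z = c) : z = ρ := by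
  have hz' : z < a ∨ b < z := by
    by_contra! h
    exact hz h
  rcases hρ with ⟨hc, hρ⟩ | ⟨hc, hρ⟩
  · rcases hz' with hz' | hz'
    · linarith [tTransform_nonpos hμ ha0 hz']
    · exact (strictAntiOn_tTransform_Ioi hμ ha0 hμ0).injOn hz' hρ (hTz.trans hTρ.symm)
  · rcases hz' with hz' | hz'
    · exact (strictAntiOn_tTransform_Iio hμ ha0 hμ0).injOn hz' hρ (hTz.trans hTρ.symm)
    · linarith [tTransform_nonneg hμ ha0 hz']

/-- Integrates the pointwise identity `(t/(z-t))² = z t/(z-t)² - t/(z-t)`. This is where `ρ T'(ρ)`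
enters the limit of the projection. -/
theorem integral_sq_div_sub_sq (hμ : ∀ᵐ t ∂μ, t ∈ Set.Icc a b) {z : ℝ} (hz : z ∉ Set.Icc a b) :
    ∫ t, (t / (z - t)) ^ 2 ∂μ = -(z * deriv (tTransform μ) z) - tTransform μ z := by
  rw [(hasDerivAt_tTransform hμ hz).deriv, tTransform, mul_neg, neg_neg, ← integral_const_mul,
    ← integral_sub ((integrable_of_continuousOn hμ (continuousOn_div_sub_sq hz)).const_mul z)
      (integrable_of_continuousOn hμ (continuousOn_div_sub hz))]
  refine integral_congr_ae ?_
  filter_upwards [hμ] with t ht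
  have := sub_ne_zero_of_notMem hz ht
  field_simp
  ring

end TTransform

/-! ### From moments to the isotropic law for continuous functions. -/

section SpectralLimits

variable {𝕜 : Type*} [RCLike 𝕜] {r : ℕ}

/-- Along the sequence of eigenbases `e n` with eigenvalues `x n`, the eigenvalues concentrate on
`[a, b]` with limiting distribution `μ`, and the frames `v n` are asymptotically isotropic. -/
structure IsotropicLimit (μ : Measure ℝ) (a b : ℝ)
    (e : ∀ n, OrthonormalBasis (Fin n) 𝕜 (EuclideanSpace 𝕜 (Fin n))) (x : ∀ n, Fin n → ℝ)
    (v : ∀ n, Fin r → EuclideanSpace 𝕜 (Fin n)) : Prop where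
  orthonormal : ∀ᶠ n in atTop, Orthonormal 𝕜 (v n)
  mem_Icc : ∀ δ > 0, ∀ᶠ n in atTop, ∀ i, x n i ∈ Set.Icc (a - δ) (b + δ)
  weak : ∀ f : ℝ →ᵇ ℝ, Tendsto (fun n : ℕ => (n : ℝ)⁻¹ * ∑ i, f (x n i)) atTop (𝓝 (∫ t, f t ∂μ))
  moment : ∀ (m : ℕ) (k l : Fin r), Tendsto (fun n : ℕ =>
    ⟪v n k, diagOp (e n) (fun i => x n i ^ m) (v n l)⟫_𝕜
      - if k = l then (((n : ℝ)⁻¹ * ∑ i, x n i ^ m : ℝ) : 𝕜) else 0) atTop (𝓝 0)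

variable {μ : Measure ℝ} {a b : ℝ}
    {e : ∀ n, OrthonormalBasis (Fin n) 𝕜 (EuclideanSpace 𝕜 (Fin n))} {x : ∀ n, Fin n → ℝ}
    {v : ∀ n, Fin r → EuclideanSpace 𝕜 (Fin n)}

theorem diagOp_add {ι E : Type*} [Fintype ι] [NormedAddCommGroup E] [InnerProductSpace 𝕜 E]
    (b : OrthonormalBasis ι 𝕜 E) (f g : ι → ℝ) (v : E) :
    diagOp b (fun i => f i + g i) v = diagOp b f v + diagOp b g v :=
  ext_orthonormalBasis b fun i => by simp [inner_diagOp, inner_add_right, add_mul]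

theorem diagOp_const_mul {ι E : Type*} [Fintype ι] [NormedAddCommGroup E] [InnerProductSpace 𝕜 E]
    (b : OrthonormalBasis ι 𝕜 E) (c : ℝ) (f : ι → ℝ) (v : E) :
    diagOp b (fun i => c * f i) v = (c : 𝕜) • diagOp b f v :=
  ext_orthonormalBasis b fun i => by simp [inner_diagOp, inner_smul_right, mul_assoc]

theorem IsotropicLimit.polynomial (h : IsotropicLimit μ a b e x v) (p : Polynomial ℝ)
    (k l : Fin r) : Tendsto (fun n : ℕ =>
      ⟪v n k, diagOp (e n) (fun i => p.eval (x n i)) (v n l)⟫_𝕜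
        - if k = l then (((n : ℝ)⁻¹ * ∑ i, p.eval (x n i) : ℝ) : 𝕜) else 0) atTop (𝓝 0) := by
  induction p using Polynomial.induction_on' with
  | add p q hp hq =>
    have := hp.add hq
    rw [add_zero] at this
    refine this.congr fun n => ?_
    simp only [Polynomial.eval_add, diagOp_add, inner_add_right, Finset.sum_add_distrib, mul_add]
    by_cases hkl : k = l
    · simp only [hkl, if_true]; push_cast; ring
    · simp [hkl]
  | monomial m c =>
    have := (h.moment m k l).const_mul (c : 𝕜)
    rw [mul_zero] at this
    refine this.congr fun n => ?_
    simp only [Polynomial.eval_monomial, diagOp_const_mul, inner_smul_right, ← Finset.mul_sum]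
    by_cases hkl : k = l
    · simp only [hkl, if_true]; push_cast; ring
    · simp [hkl]

theorem abs_average_le {n : ℕ} {f : Fin n → ℝ} {K : ℝ} (hK : 0 ≤ K) (hf : ∀ i, |f i| ≤ K) :
    |(n : ℝ)⁻¹ * ∑ i, f i| ≤ K := by
  rcases Nat.eq_zero_or_pos n with hn | hn
  · subst hn; simpa using hK
  have hn' : (0 : ℝ) < n := by exact_mod_cast hn
  have h1 : |∑ i, f i| ≤ n * K := by
    refine (Finset.abs_sum_le_sum_abs _ _).trans ?_
    simpa using Finset.sum_le_sum fun i (_ : i ∈ Finset.univ) => hf i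
  rw [abs_mul, abs_of_pos (inv_pos.2 hn'), inv_mul_le_iff₀ hn']
  exact h1

theorem IsotropicLimit.eventually_mem (h : IsotropicLimit μ a b e x v) {c d : ℝ} (hc : c < a)
    (hd : b < d) : ∀ᶠ n in atTop, ∀ i, x n i ∈ Set.Icc c d := by
  filter_upwards [h.mem_Icc (min (a - c) (d - b)) (by simp [hc, hd])] with n hn i
  have h1 := min_le_left (a - c) (d - b)
  have h2 := min_le_right (a - c) (d - b)
  exact ⟨by linarith [(hn i).1], by linarith [(hn i).2]⟩

/-- Weierstrass approximation on `[c, d]`, which eventually contains all eigenvalues: replacing `f`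
by a polynomial moves both the form and the average by at most `ε / 3`. Hence the countably many
moment conditions suffice, and one null set serves all `f`. -/
theorem IsotropicLimit.sub_average (h : IsotropicLimit μ a b e x v) {c d : ℝ} (hc : c < a)
    (hd : b < d) {f : ℝ → ℝ} (hf : ContinuousOn f (Set.Icc c d)) (k l : Fin r) :
    Tendsto (fun n : ℕ => ⟪v n k, diagOp (e n) (fun i => f (x n i)) (v n l)⟫_𝕜
        - if k = l then (((n : ℝ)⁻¹ * ∑ i, f (x n i) : ℝ) : 𝕜) else 0) atTop (𝓝 0) := by
  rw [Metric.tendsto_atTop']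
  intro ε hε
  obtain ⟨p, hp⟩ := exists_polynomial_near_of_continuousOn c d f hf (ε / 3) (by positivity)
  have h1 := (Metric.tendsto_nhds.1 (h.polynomial p k l)) (ε / 3) (by positivity)
  have h2 := (h.eventually_mem hc hd).and (h1.and h.orthonormal)
  rw [eventually_atTop] at h2
  obtain ⟨N, hN⟩ := h2
  refine ⟨N, fun n hn => ?_⟩
  obtain ⟨hx, h3, hv⟩ := hN n hn.le
  rw [dist_zero_right] at h3 ⊢
  have hfp : ∀ i, |f (x n i) - p.eval (x n i)| ≤ ε / 3 := fun i => by
    rw [abs_sub_comm]; exact (hp _ (hx i)).le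
  have h4 := norm_inner_diagOp_le (e n) (f := fun i => f (x n i) - p.eval (x n i))
    (by positivity) hfp (v n k) (v n l)
  rw [hv.1 k, hv.1 l, mul_one, mul_one, diagOp_sub, inner_sub_right] at h4
  have h5 := abs_average_le (by positivity) hfp
  rw [Finset.sum_sub_distrib, mul_sub] at h5
  have h6 : ‖(if k = l then (((n : ℝ)⁻¹ * ∑ i, f (x n i) : ℝ) : 𝕜) else 0)
      - (if k = l then (((n : ℝ)⁻¹ * ∑ i, p.eval (x n i) : ℝ) : 𝕜) else 0)‖ ≤ ε / 3 := by
    by_cases hkl : k = l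
    · simp only [hkl, if_true]
      rw [← RCLike.ofReal_sub, RCLike.norm_ofReal]
      exact h5
    · simp [hkl]; positivity
  generalize ⟪v n k, diagOp (e n) (fun i => f (x n i)) (v n l)⟫_𝕜 = A at *
  generalize ⟪v n k, diagOp (e n) (fun i => p.eval (x n i)) (v n l)⟫_𝕜 = B at *
  generalize (if k = l then (((n : ℝ)⁻¹ * ∑ i, f (x n i) : ℝ) : 𝕜) else 0) = C at *
  generalize (if k = l then (((n : ℝ)⁻¹ * ∑ i, p.eval (x n i) : ℝ) : 𝕜) else 0) = D at *
  calc ‖A - C‖ = ‖(A - B) + (B - D) - (C - D)‖ := by congr 1; ring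
    _ ≤ ‖A - B‖ + ‖B - D‖ + ‖C - D‖ :=
        (norm_sub_le _ _).trans (add_le_add_left (norm_add_le _ _) _)
    _ < ε := by linarith

/-- Isotropic law for a function which is continuous near `[a, b]`. -/
theorem IsotropicLimit.tendsto (h : IsotropicLimit μ a b e x v)
    (hμ : ∀ᵐ t ∂μ, t ∈ Set.Icc a b) (hab : a ≤ b) {c d : ℝ} (hc : c < a)
    (hd : b < d) {f : ℝ → ℝ} (hf : ContinuousOn f (Set.Icc c d)) (k l : Fin r) :
    Tendsto (fun n : ℕ => ⟪v n k, diagOp (e n) (fun i => f (x n i)) (v n l)⟫_𝕜) atTop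
      (𝓝 (if k = l then ((∫ t, f t ∂μ : ℝ) : 𝕜) else 0)) := by
  have hcd : c ≤ d := by linarith
  let g : C(Set.Icc c d, ℝ) := ⟨fun t => f t, continuousOn_iff_continuous_domRestrict.mp hf⟩
  -- Weak convergence tests bounded continuous functions on all of `ℝ`, so `f` is extended by its
  -- boundary values outside `[c, d]`.
  let F : ℝ →ᵇ ℝ := (BoundedContinuousFunction.mkOfCompact g).compContinuous
    ⟨Set.projIcc c d hcd, continuous_projIcc⟩
  have hF : ∀ t ∈ Set.Icc c d, F t = f t := by
    intro t ht
    change f (Set.projIcc c d hcd t) = f t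
    rw [Set.projIcc_of_mem hcd ht]
  have hfint : ∫ t, F t ∂μ = ∫ t, f t ∂μ := by
    refine integral_congr_ae ?_
    filter_upwards [hμ] with t ht
    exact hF t ⟨by linarith [ht.1], by linarith [ht.2]⟩
  have hav : Tendsto (fun n : ℕ => (n : ℝ)⁻¹ * ∑ i, f (x n i)) atTop (𝓝 (∫ t, f t ∂μ)) := by
    rw [← hfint]
    refine (h.weak F).congr' ?_
    filter_upwards [h.eventually_mem hc hd] with n hn
    simp only [hF _ (hn _)]
  have h2 : Tendsto (fun n : ℕ => if k = l then (((n : ℝ)⁻¹ * ∑ i, f (x n i) : ℝ) : 𝕜) else 0)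
      atTop (𝓝 (if k = l then ((∫ t, f t ∂μ : ℝ) : 𝕜) else 0)) := by
    by_cases hkl : k = l
    · simp only [hkl, if_true]
      exact (RCLike.continuous_ofReal.tendsto _).comp hav
    · simp [hkl]
  have := (h.sub_average hc hd hf k l).add h2
  simpa using this

/-- Isotropic law for a uniformly convergent sequence of functions. -/
theorem IsotropicLimit.tendsto_of_uniform (h : IsotropicLimit μ a b e x v)
    (hμ : ∀ᵐ t ∂μ, t ∈ Set.Icc a b) (hab : a ≤ b) {c d : ℝ} (hc : c < a)
    (hd : b < d) {f : ℝ → ℝ} (hf : ContinuousOn f (Set.Icc c d)) {g : ℕ → ℝ → ℝ}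
    (hg : TendstoUniformlyOn g f atTop (Set.Icc c d)) (k l : Fin r) :
    Tendsto (fun n : ℕ => ⟪v n k, diagOp (e n) (fun i => g n (x n i)) (v n l)⟫_𝕜) atTop
      (𝓝 (if k = l then ((∫ t, f t ∂μ : ℝ) : 𝕜) else 0)) := by
  refine (h.tendsto hμ hab hc hd hf k l).congr_dist ?_
  rw [Metric.tendsto_nhds]
  intro ε hε
  filter_upwards [Metric.tendstoUniformlyOn_iff.1 hg (ε / 2) (by positivity),
    h.eventually_mem hc hd, h.orthonormal] with n hn hx hv
  have hfp : ∀ i, |f (x n i) - g n (x n i)| ≤ ε / 2 := fun i => (hn _ (hx i)).le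
  have h4 := norm_inner_diagOp_le (e n) (f := fun i => f (x n i) - g n (x n i))
    (by positivity) hfp (v n k) (v n l)
  rw [hv.1 k, hv.1 l, mul_one, mul_one, diagOp_sub, inner_sub_right] at h4
  rw [Real.dist_eq, sub_zero, abs_of_nonneg dist_nonneg, dist_eq_norm]
  linarith

theorem continuousOn_div_sub_smul {ε z c d : ℝ} (h : ∀ t ∈ Set.Icc c d, 0 < ε * (z - t)) :
    ContinuousOn (fun t => t / (ε * (z - t))) (Set.Icc c d) :=
  continuousOn_id.div (continuousOn_const.mul (continuousOn_const.sub continuousOn_id))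
    fun t ht => (h t ht).ne'

theorem exists_margin {ε z : ℝ} (hε : ε = 1 ∨ ε = -1) (hab : a ≤ b)
    (h : ∀ t ∈ Set.Icc a b, 0 < ε * (z - t)) :
    ∃ c d, c < a ∧ b < d ∧ ∀ t ∈ Set.Icc c d, 0 < ε * (z - t) := by
  have h1 := h a ⟨le_rfl, hab⟩
  have h2 := h b ⟨hab, le_rfl⟩
  rcases hε with rfl | rfl
  · exact ⟨a - 1, (b + z) / 2, by linarith, by linarith, fun t ht => by linarith [ht.2]⟩
  · exact ⟨(a + z) / 2, b + 1, by linarith, by linarith, fun t ht => by linarith [ht.1]⟩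

theorem integral_div_smul {ε z : ℝ} (hε : ε = 1 ∨ ε = -1) :
    ∫ t, t / (ε * (z - t)) ∂μ = ε * tTransform μ z := by
  rw [tTransform, ← integral_const_mul]
  refine integral_congr_ae (.of_forall fun t => ?_)
  rcases hε with rfl | rfl
  · simp
  · simp only [neg_mul, one_mul, div_neg]

/-! ### Convergence of the outlier eigenvalue. -/

section Outliers

variable {X P : ∀ n, Matrix (Fin n) (Fin n) 𝕜} {θ : Fin r → ℝ}

theorem IsotropicLimit.eventually_gram_le (h : IsotropicLimit μ a b e x v)
    (hμ : ∀ᵐ t ∂μ, t ∈ Set.Icc a b) (hab : a ≤ b) {ε z c d : ℝ} (hε : ε = 1 ∨ ε = -1)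
    (hc : c < a) (hd : b < d) (hcd : ∀ t ∈ Set.Icc c d, 0 < ε * (z - t)) {η : ℝ} (hη : 0 < η) :
    ∀ᶠ n in atTop, ∀ k l,
      ‖⟪v n k, diagOp (e n) (fun i => x n i / (ε * (z - x n i))) (v n l)⟫_𝕜
        - (if k = l then ((ε * tTransform μ z : ℝ) : 𝕜) else 0)‖ ≤ η := by
  rw [eventually_all]; intro k
  rw [eventually_all]; intro l
  have := h.tendsto hμ hab hc hd (continuousOn_div_sub_smul hcd) k l
  rw [integral_div_smul hε] at this
  filter_upwards [Metric.tendsto_nhds.1 this η hη] with n hn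
  rw [dist_eq_norm] at hn
  exact hn.le

theorem IsotropicLimit.eventually_mul_le_outlier (h : IsotropicLimit μ a b e x v)
    (hμ : ∀ᵐ t ∂μ, t ∈ Set.Icc a b) (hab : a ≤ b) (hx : ∀ n i, 0 ≤ x n i)
    (hX : ∀ n, Matrix.toEuclideanLin (X n) = diagOp (e n) (x n)) (hθ : Antitone θ)
    (hP : ∀ n, r ≤ n → Matrix.toEuclideanLin (P n) = frameOp (v n) θ) (i₀ : Fin r) {ε z : ℝ}
    (hε : ε = 1 ∨ ε = -1) (hp₀ : 0 < ε * θ i₀) (hz : ∀ t ∈ Set.Icc a b, 0 < ε * (z - t))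
    (hT : 1 < tTransform μ z * θ i₀) :
    ∀ᶠ n in atTop, ε * z ≤ ε * outlierEigenvalue (X n) (P n) θ i₀ := by
  obtain ⟨c, d, hc, hd, hcd⟩ := exists_margin hε hab hz
  have hεε : ε * ε = 1 := by rcases hε with rfl | rfl <;> norm_num
  set τ := ε * tTransform μ z with hτ
  have hpτ : 1 < ε * θ i₀ * τ := by
    have : ε * θ i₀ * τ = ε * ε * (tTransform μ z * θ i₀) := by rw [hτ]; ring
    rwa [this, hεε, one_mul]
  have hτ0 : 0 < τ := by
    by_contra hneg
    nlinarith [not_lt.1 hneg]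
  set C := ∑ k, |ε * θ k| with hC
  have hCk : ∀ k, |ε * θ k| ≤ C := fun k =>
    Finset.single_le_sum (f := fun k => |ε * θ k|) (fun _ _ => abs_nonneg _) (Finset.mem_univ k)
  -- At `η = 0` the conditions are `0 < τ` and `τ < ε θ_{i₀} τ²`, which hold strictly because `ε
  -- θ_{i₀} τ = θ_{i₀} T(z) > 1`. Continuity leaves room for some `η > 0`.
  obtain ⟨η, hη, h1, h2⟩ : ∃ η > 0, r * η < τ ∧
      τ + r * η < ε * θ i₀ * τ ^ 2 - 2 * (ε * θ i₀) * τ * η * r - r ^ 2 * C * η ^ 2 := by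
    have c1 : Continuous fun η : ℝ => r * η := by fun_prop
    have c2 : Continuous fun η : ℝ => ε * θ i₀ * τ ^ 2 - 2 * (ε * θ i₀) * τ * η * r
      - r ^ 2 * C * η ^ 2 - (τ + r * η) := by fun_prop
    have e1 : ∀ᶠ η in 𝓝 (0 : ℝ), r * η < τ :=
      c1.tendsto 0 |>.eventually (gt_mem_nhds (by simpa using hτ0))
    have e2 : ∀ᶠ η in 𝓝 (0 : ℝ), 0 < ε * θ i₀ * τ ^ 2 - 2 * (ε * θ i₀) * τ * η * r
      - r ^ 2 * C * η ^ 2 - (τ + r * η) :=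
      c2.tendsto 0 |>.eventually (lt_mem_nhds (by simp; nlinarith))
    have e3 := (e1.and e2).filter_mono (nhdsWithin_le_nhds (s := Set.Ioi (0 : ℝ)))
    obtain ⟨η, ⟨g1, g2⟩, g3⟩ := (e3.and self_mem_nhdsWithin).exists
    exact ⟨η, g3, g1, by linarith⟩
  filter_upwards [h.eventually_gram_le hμ hab hε hc hd hcd hη, h.eventually_mem hc hd,
    eventually_ge_atTop r] with n hG hmem hr
  exact mul_le_mul_outlierEigenvalue hr (hx n) (hX n) hθ (hP n hr) i₀ hε hp₀ hτ0
    (fun i => hcd _ (hmem i)) hCk hη.le hG h1 h2.le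

theorem IsotropicLimit.eventually_outlier_le_mul (h : IsotropicLimit μ a b e x v)
    (hμ : ∀ᵐ t ∂μ, t ∈ Set.Icc a b) (hab : a ≤ b) (hx : ∀ n i, 0 ≤ x n i)
    (hX : ∀ n, Matrix.toEuclideanLin (X n) = diagOp (e n) (x n)) (hθ : Antitone θ)
    (hP : ∀ n, r ≤ n → Matrix.toEuclideanLin (P n) = frameOp (v n) θ) (i₀ : Fin r) {ε z : ℝ}
    (hε : ε = 1 ∨ ε = -1) (hp₀ : 0 < ε * θ i₀) (hz : ∀ t ∈ Set.Icc a b, 0 < ε * (z - t))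
    (hT : tTransform μ z * θ i₀ < 1) :
    ∀ᶠ n in atTop, ε * outlierEigenvalue (X n) (P n) θ i₀ ≤ ε * z := by
  obtain ⟨c, d, hc, hd, hcd⟩ := exists_margin hε hab hz
  have hεε : ε * ε = 1 := by rcases hε with rfl | rfl <;> norm_num
  set τ := ε * tTransform μ z with hτ
  have hpτ : ε * θ i₀ * τ < 1 := by
    have : ε * θ i₀ * τ = ε * ε * (tTransform μ z * θ i₀) := by rw [hτ]; ring
    rwa [this, hεε, one_mul]
  obtain ⟨η, hη, h2⟩ : ∃ η > 0, ε * θ i₀ * (τ + r * η) < 1 := by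
    have c1 : Continuous fun η : ℝ => ε * θ i₀ * (τ + r * η) := by fun_prop
    have e1 : ∀ᶠ η in 𝓝 (0 : ℝ), ε * θ i₀ * (τ + r * η) < 1 :=
      c1.tendsto 0 |>.eventually (gt_mem_nhds (by simpa using hpτ))
    have e3 := e1.filter_mono (nhdsWithin_le_nhds (s := Set.Ioi (0 : ℝ)))
    obtain ⟨η, g1, g3⟩ := (e3.and self_mem_nhdsWithin).exists
    exact ⟨η, g3, g1⟩
  filter_upwards [h.eventually_gram_le hμ hab hε hc hd hcd hη, h.eventually_mem hc hd,
    eventually_ge_atTop r] with n hG hmem hr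
  exact mul_outlierEigenvalue_le_mul hr (hx n) (hX n) hθ (hP n hr) i₀ hε hp₀
    (fun i => hcd _ (hmem i)) hG h2.le

/-- The outlier converges to the preimage of `1 / θ i₀` under the `T`-transform. -/
theorem IsotropicLimit.tendsto_outlier [IsProbabilityMeasure μ] (h : IsotropicLimit μ a b e x v)
    (hμ : ∀ᵐ t ∂μ, t ∈ Set.Icc a b) (ha0 : 0 ≤ a) (hab : a ≤ b) (hμ0 : μ ≠ Measure.dirac 0)
    (hx : ∀ n i, 0 ≤ x n i)
    (hX : ∀ n, Matrix.toEuclideanLin (X n) = diagOp (e n) (x n)) (hθ : Antitone θ)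
    (hP : ∀ n, r ≤ n → Matrix.toEuclideanLin (P n) = frameOp (v n) θ) (i₀ : Fin r)
    {ρ : ℝ} (hTρ : tTransform μ ρ = 1 / θ i₀)
    (hρ : (0 < 1 / θ i₀ ∧ b < ρ) ∨ (1 / θ i₀ < 0 ∧ ρ < a)) :
    Tendsto (fun n => outlierEigenvalue (X n) (P n) θ i₀) atTop (𝓝 ρ) := by
  rcases hρ with ⟨hθi, hρ⟩ | ⟨hθi, hρ⟩
  · have hpos : 0 < θ i₀ := one_div_pos.1 hθi
    have hanti := strictAntiOn_tTransform_Ioi hμ ha0 hμ0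
    have hinv : 1 / θ i₀ * θ i₀ = 1 := one_div_mul_cancel hpos.ne'
    rw [tendsto_order]
    constructor
    · intro w hw
      -- The comparison point must stay to the right of `b` as well as of `w`. Since `T` decreases,
      -- `z < ρ` gives `T(z) θ_{i₀} > 1`.
      obtain ⟨z, hz1, hz2⟩ := exists_between (max_lt hw hρ)
      have hbz := (le_max_right w b).trans_lt hz1
      have hT := hanti hbz hρ hz2
      filter_upwards [h.eventually_mul_le_outlier hμ hab hx hX hθ hP i₀ (z := z) (Or.inl rfl)
        (by simpa using hpos) (fun t ht => by linarith [ht.2])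
        (by rw [hTρ] at hT; nlinarith)] with n hn
      have := (le_max_left w b).trans_lt hz1
      linarith
    · intro w hw
      obtain ⟨z, hz1, hz2⟩ := exists_between hw
      have hbz := hρ.trans hz1
      have hT := hanti hρ hbz hz1
      filter_upwards [h.eventually_outlier_le_mul hμ hab hx hX hθ hP i₀ (z := z) (Or.inl rfl)
        (by simpa using hpos) (fun t ht => by linarith [ht.2])
        (by rw [hTρ] at hT; nlinarith)] with n hn
      linarith
  · have hneg : θ i₀ < 0 := one_div_neg.1 hθi
    have hanti := strictAntiOn_tTransform_Iio hμ ha0 hμ0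
    have hinv : 1 / θ i₀ * θ i₀ = 1 := one_div_mul_cancel hneg.ne
    rw [tendsto_order]
    constructor
    · intro w hw
      -- Now `θ_{i₀} < 0`: from `z < ρ` one gets `T(z) > 1 / θ_{i₀}`, hence `T(z) θ_{i₀} < 1`. The
      -- upper comparison with `ε = -1` is then a lower bound for the outlier.
      obtain ⟨z, hz1, hz2⟩ := exists_between hw
      have hbz := hz2.trans hρ
      have hT := hanti hbz hρ hz2
      filter_upwards [h.eventually_outlier_le_mul hμ hab hx hX hθ hP i₀ (z := z) (Or.inr rfl)
        (by linarith) (fun t ht => by linarith [ht.1])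
        (by rw [hTρ] at hT; nlinarith)] with n hn
      linarith
    · intro w hw
      obtain ⟨z, hz1, hz2⟩ := exists_between (lt_min hw hρ)
      have hbz := hz2.trans_le (min_le_right w a)
      have hT := hanti hρ hbz hz1
      filter_upwards [h.eventually_mul_le_outlier hμ hab hx hX hθ hP i₀ (z := z) (Or.inr rfl)
        (by linarith) (fun t ht => by linarith [ht.1])
        (by rw [hTρ] at hT; nlinarith)] with n hn
      have := hz2.trans_le (min_le_left w a)
      linarith

end Outliers

end SpectralLimits

/-! ### Asymptotics of the components of the eigenvector along the frame. -/

section Eigenvectors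

variable {𝕜 : Type*} [RCLike 𝕜] {r : ℕ} {μ : Measure ℝ} {a b : ℝ}
    {e : ∀ n, OrthonormalBasis (Fin n) 𝕜 (EuclideanSpace 𝕜 (Fin n))} {x : ∀ n, Fin n → ℝ}
    {v : ∀ n, Fin r → EuclideanSpace 𝕜 (Fin n)}

theorem exists_margin_of_notMem {z : ℝ} (hz : z ∉ Set.Icc a b) :
    ∃ c d, c < a ∧ b < d ∧ z ∉ Set.Icc c d := by
  by_cases h : z < a
  · exact ⟨(a + z) / 2, b + 1, by linarith, by linarith, fun ht => by linarith [ht.1]⟩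
  · have h' : b < z := by
      by_contra h2
      exact hz ⟨by linarith, by linarith⟩
    exact ⟨a - 1, (b + z) / 2, by linarith, by linarith, fun ht => by linarith [ht.2]⟩

/-- Needed because the resolvent is evaluated at the eigenvalue `l n`, which moves with `n`, while
the isotropic law is stated for a fixed function. -/
theorem tendstoUniformlyOn_div_sub {c d ρ : ℝ} (hρ : ρ ∉ Set.Icc c d) {l : ℕ → ℝ}
    (hl : Tendsto l atTop (𝓝 ρ)) :
    TendstoUniformlyOn (fun n t => t / (l n - t)) (fun t => t / (ρ - t)) atTop (Set.Icc c d) := by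
  obtain ⟨δ, hδ, hdist⟩ := exists_dist_pos hρ
  set M := max |c| |d| with hM
  rw [Metric.tendstoUniformlyOn_iff]
  intro ε hε
  have h1 := Metric.tendsto_nhds.1 hl (min (δ / 2) (ε * δ ^ 2 / (2 * (M + 1)))) (by positivity)
  filter_upwards [h1] with n hn t ht
  have h2 : |l n - ρ| < δ / 2 := (lt_min_iff.1 hn).1
  have h3 : |l n - ρ| < ε * δ ^ 2 / (2 * (M + 1)) := (lt_min_iff.1 hn).2
  have h4 := hdist t ht
  have h5 : δ / 2 ≤ |l n - t| := by
    have := abs_sub_le ρ (l n) t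
    rw [abs_sub_comm ρ (l n)] at this
    linarith
  have hM0 : 0 ≤ M := by positivity
  have h6 : |t| ≤ M := abs_le_max_abs_abs ht.1 ht.2
  have n1 : ρ - t ≠ 0 := fun h => by rw [h] at h4; simp at h4; linarith
  have n2 : l n - t ≠ 0 := fun h => by rw [h] at h5; simp at h5; linarith
  have h7 : t / (ρ - t) - t / (l n - t) = t * (l n - ρ) / ((ρ - t) * (l n - t)) := by
    field_simp; ring
  rw [Real.dist_eq, h7, abs_div, abs_mul, abs_mul, div_lt_iff₀ (by positivity)]
  have h8 : δ * (δ / 2) ≤ |ρ - t| * |l n - t| := by gcongr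
  rw [lt_div_iff₀ (by positivity)] at h3
  have h9 : |t| * |l n - ρ| ≤ M * |l n - ρ| := by gcongr
  have h10 : 0 ≤ |l n - ρ| := abs_nonneg _
  have h11 : ε * (δ * (δ / 2)) ≤ ε * (|ρ - t| * |l n - t|) := by gcongr
  nlinarith

theorem tendstoUniformlyOn_div_sub_sq {c d ρ : ℝ} (hρ : ρ ∉ Set.Icc c d) {l : ℕ → ℝ}
    (hl : Tendsto l atTop (𝓝 ρ)) :
    TendstoUniformlyOn (fun n t => (t / (l n - t)) ^ 2) (fun t => (t / (ρ - t)) ^ 2) atTop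
      (Set.Icc c d) := by
  obtain ⟨M, hM⟩ := isCompact_Icc.exists_bound_of_continuousOn (continuousOn_div_sub hρ)
  have h := Metric.tendstoUniformlyOn_iff.1 (tendstoUniformlyOn_div_sub hρ hl)
  rw [Metric.tendstoUniformlyOn_iff]
  intro ε hε
  filter_upwards [h (min 1 (ε / (2 * |M| + 2))) (by positivity)] with n hn t ht
  have h1 := hn t ht
  have h2 := hM t ht
  rw [Real.dist_eq] at h1 ⊢
  rw [Real.norm_eq_abs] at h2
  set A := t / (ρ - t)
  set B := t / (l n - t)
  have h3 := (lt_min_iff.1 h1).1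
  have h4 := (lt_min_iff.1 h1).2
  rw [lt_div_iff₀ (by positivity)] at h4
  have h5 : |A + B| ≤ 2 * |M| + 1 := by
    have : A + B = 2 * A - (A - B) := by ring
    rw [this]
    refine (abs_sub _ _).trans ?_
    rw [abs_mul, abs_two]
    have := le_abs_self M
    linarith
  have h6 : A ^ 2 - B ^ 2 = (A - B) * (A + B) := by ring
  rw [h6, abs_mul]
  have h7 : |A - B| * |A + B| ≤ |A - B| * (2 * |M| + 1) := by gcongr
  have h8 := abs_nonneg (A - B)
  linarith

variable {X P : ∀ n, Matrix (Fin n) (Fin n) 𝕜} {θ : Fin r → ℝ}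

/-- An eigenvector of `X (1 + P)` off the spectrum of `X` is recovered from its image by `P`. -/
theorem eigenvector_eq_resolvent {n : ℕ} {X P : Matrix (Fin n) (Fin n) 𝕜}
    {e : OrthonormalBasis (Fin n) 𝕜 (EuclideanSpace 𝕜 (Fin n))} {x : Fin n → ℝ}
    (hX : Matrix.toEuclideanLin X = diagOp e x) {l : ℝ} (hl : ∀ i, l - x i ≠ 0)
    {u : EuclideanSpace 𝕜 (Fin n)} (hu : IsUnitEigenvector (perturbed X P) l u) :
    u = diagOp e (fun i => x i / (l - x i)) (Matrix.toEuclideanLin P u) := by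
  have h := hu.2
  rw [perturbed, toEuclideanLin_mul_apply, map_add, LinearMap.add_apply,
    toEuclideanLin_one_apply, hX] at h
  refine ext_orthonormalBasis e fun i => ?_
  have h1 := congrArg (fun w => ⟪e i, w⟫_𝕜) h
  simp only [inner_diagOp, inner_add_right, inner_smul_right] at h1
  rw [inner_diagOp]
  have h2 : (l : 𝕜) - (x i : 𝕜) ≠ 0 := by
    rw [← RCLike.ofReal_sub]; exact_mod_cast hl i
  push_cast
  rw [div_mul_eq_mul_div, eq_div_iff h2]
  linear_combination -h1

/-- Pairing `u = X (l - X)⁻¹ P u` with `v m` gives `⟨v_m, u⟩ = ∑ θ_k ⟨v_k, u⟩ G_mk`, where `G_mk →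
δ_mk T(ρ)`. So `(1 - T(ρ) θ_m) ⟨v_m, u⟩ → 0`, and the factor is non-zero by `hm`. -/
theorem IsotropicLimit.tendsto_inner_eigenvector (h : IsotropicLimit μ a b e x v)
    (hμ : ∀ᵐ t ∂μ, t ∈ Set.Icc a b) (hab : a ≤ b)
    (hX : ∀ n, Matrix.toEuclideanLin (X n) = diagOp (e n) (x n))
    (hP : ∀ n, r ≤ n → Matrix.toEuclideanLin (P n) = frameOp (v n) θ)
    {ρ : ℝ} (hρ : ρ ∉ Set.Icc a b) {l : ℕ → ℝ} (hl : Tendsto l atTop (𝓝 ρ))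
    {u : ∀ n, EuclideanSpace 𝕜 (Fin n)}
    (hu : ∀ n, r ≤ n → IsUnitEigenvector (perturbed (X n) (P n)) (l n) (u n)) (m : Fin r)
    (hm : tTransform μ ρ * θ m ≠ 1) :
    Tendsto (fun n => ‖⟪v n m, u n⟫_𝕜‖ ^ 2) atTop (𝓝 0) := by
  obtain ⟨c, d, hc, hd, hcd⟩ := exists_margin_of_notMem hρ
  have hG := fun k => h.tendsto_of_uniform hμ hab hc hd (continuousOn_div_sub hcd)
    (tendstoUniformlyOn_div_sub hcd hl) m k
  have hlcd : ∀ᶠ n in atTop, l n ∉ Set.Icc c d :=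
    hl.eventually (isClosed_Icc.isOpen_compl.mem_nhds hcd)
  have hbound : Tendsto (fun n => ∑ k, |θ k| *
      ‖⟪v n m, diagOp (e n) (fun i => x n i / (l n - x n i)) (v n k)⟫_𝕜
        - (if m = k then ((∫ t, t / (ρ - t) ∂μ : ℝ) : 𝕜) else 0)‖) atTop (𝓝 0) := by
    have : (0 : ℝ) = ∑ k : Fin r, |θ k| * 0 := by simp
    rw [this]
    refine tendsto_finsetSum _ fun k _ => Tendsto.const_mul _ ?_
    have := ((hG k).sub_const (if m = k then ((∫ t, t / (ρ - t) ∂μ : ℝ) : 𝕜) else 0)).norm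
    simpa using this
  have hbound2 : Tendsto (fun n => ‖⟪v n m, u n⟫_𝕜‖) atTop (𝓝 0) := by
    have hq : 0 < |1 - tTransform μ ρ * θ m| := abs_pos.2 (sub_ne_zero.2 (Ne.symm hm))
    have h0 := hbound.div_const |1 - tTransform μ ρ * θ m|
    rw [zero_div] at h0
    refine squeeze_zero' (.of_forall fun n => norm_nonneg _) ?_ h0
    filter_upwards [h.orthonormal, h.eventually_mem hc hd, hlcd, eventually_ge_atTop r]
      with n hv hmem hln hr
    have hres := eigenvector_eq_resolvent (hX n) (fun i h0 => hln (by
      rw [sub_eq_zero.1 h0]; exact hmem i)) (hu n hr)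
    have hcu : ∀ k, ‖⟪v n k, u n⟫_𝕜‖ ≤ 1 := fun k =>
      (norm_inner_le_norm _ _).trans (by rw [hv.1 k, (hu n hr).1, one_mul])
    rw [le_div_iff₀ hq]
    have h1 : ⟪v n m, u n⟫_𝕜 = ∑ k, ((θ k : 𝕜) * ⟪v n k, u n⟫_𝕜) *
        ⟪v n m, diagOp (e n) (fun i => x n i / (l n - x n i)) (v n k)⟫_𝕜 := by
      conv_lhs => rw [hres, hP n hr]
      simp only [frameOp, LinearMap.coe_mk, AddHom.coe_mk, map_sum, map_smul, inner_sum,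
        inner_smul_right]
    have h2 : ((1 - tTransform μ ρ * θ m : ℝ) : 𝕜) * ⟪v n m, u n⟫_𝕜
        = ∑ k, ((θ k : 𝕜) * ⟪v n k, u n⟫_𝕜) *
        (⟪v n m, diagOp (e n) (fun i => x n i / (l n - x n i)) (v n k)⟫_𝕜
          - (if m = k then ((∫ t, t / (ρ - t) ∂μ : ℝ) : 𝕜) else 0)) := by
      simp only [mul_sub, Finset.sum_sub_distrib, ← h1, mul_ite, mul_zero, Finset.sum_ite_eq,
        Finset.mem_univ, if_true]
      rw [tTransform]
      push_cast
      ring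
    have h3 := congrArg norm h2
    rw [norm_mul, RCLike.norm_ofReal] at h3
    rw [mul_comm, h3]
    refine (norm_sum_le _ _).trans (Finset.sum_le_sum fun k _ => ?_)
    rw [norm_mul, norm_mul, RCLike.norm_ofReal]
    gcongr
    exact mul_le_of_le_one_right (abs_nonneg _) (hcu k)
  simpa using hbound2.pow 2

/-- The squared norm of `u = X (l - X)⁻¹ P u` is `1`, and expands into a sesquilinear form in `θ_k
⟨v_k, u⟩` whose matrix `⟨v_m, (X (l - X)⁻¹)² v_k⟩` tends to a scalar. -/
theorem IsotropicLimit.tendsto_sum_sq_eigenvector (h : IsotropicLimit μ a b e x v)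
    (hμ : ∀ᵐ t ∂μ, t ∈ Set.Icc a b) (hab : a ≤ b)
    (hX : ∀ n, Matrix.toEuclideanLin (X n) = diagOp (e n) (x n))
    (hP : ∀ n, r ≤ n → Matrix.toEuclideanLin (P n) = frameOp (v n) θ)
    {ρ : ℝ} (hρ : ρ ∉ Set.Icc a b) {l : ℕ → ℝ} (hl : Tendsto l atTop (𝓝 ρ))
    {u : ∀ n, EuclideanSpace 𝕜 (Fin n)}
    (hu : ∀ n, r ≤ n → IsUnitEigenvector (perturbed (X n) (P n)) (l n) (u n)) :
    Tendsto (fun n => (∫ t, (t / (ρ - t)) ^ 2 ∂μ) * ∑ k, θ k ^ 2 * ‖⟪v n k, u n⟫_𝕜‖ ^ 2) atTop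
      (𝓝 1) := by
  obtain ⟨c, d, hc, hd, hcd⟩ := exists_margin_of_notMem hρ
  set I := ∫ t, (t / (ρ - t)) ^ 2 ∂μ with hI
  have hG := fun m k => h.tendsto_of_uniform (f := fun t => (t / (ρ - t)) ^ 2) hμ hab hc hd
    ((continuousOn_div_sub hcd).pow 2)
    (tendstoUniformlyOn_div_sub_sq hcd hl) m k
  have hlcd : ∀ᶠ n in atTop, l n ∉ Set.Icc c d :=
    hl.eventually (isClosed_Icc.isOpen_compl.mem_nhds hcd)
  set η : ℕ → ℝ := fun n => ∑ m, ∑ k,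
      ‖⟪v n m, diagOp (e n) (fun i => (x n i / (l n - x n i)) ^ 2) (v n k)⟫_𝕜
        - (if m = k then (I : 𝕜) else 0)‖ with hη
  have hη0 : Tendsto η atTop (𝓝 0) := by
    have : (0 : ℝ) = ∑ m : Fin r, ∑ k : Fin r, 0 := by simp
    rw [this]
    refine tendsto_finsetSum _ fun m _ => tendsto_finsetSum _ fun k _ => ?_
    have := ((hG m k).sub_const (if m = k then (I : 𝕜) else 0)).norm
    rw [← hI, sub_self, norm_zero] at this
    exact this
  have hb0 : Tendsto (fun n => r * η n * ∑ k, θ k ^ 2) atTop (𝓝 0) := by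
    simpa using (hη0.const_mul (r : ℝ)).mul_const (∑ k, θ k ^ 2)
  rw [tendsto_iff_dist_tendsto_zero]
  refine squeeze_zero' (.of_forall fun n => dist_nonneg) ?_ hb0
  filter_upwards [h.orthonormal, h.eventually_mem hc hd, hlcd, eventually_ge_atTop r]
      with n hv hmem hln hr
  have hres := eigenvector_eq_resolvent (hX n) (fun i h0 => hln (by
      rw [sub_eq_zero.1 h0]; exact hmem i)) (hu n hr)
  have hcu : ∀ k, ‖⟪v n k, u n⟫_𝕜‖ ≤ 1 := fun k =>
      (norm_inner_le_norm _ _).trans (by rw [hv.1 k, (hu n hr).1, one_mul])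
  have hGη : ∀ m k, ‖⟪v n m, diagOp (e n) (fun i => (x n i / (l n - x n i)) ^ 2) (v n k)⟫_𝕜
        - (if m = k then (I : 𝕜) else 0)‖ ≤ η n := by
    intro m k
    refine le_trans ?_ (Finset.single_le_sum (f := fun m => ∑ k,
      ‖⟪v n m, diagOp (e n) (fun i => (x n i / (l n - x n i)) ^ 2) (v n k)⟫_𝕜
        - (if m = k then (I : 𝕜) else 0)‖) (fun m _ => by positivity) (Finset.mem_univ m))
    exact Finset.single_le_sum (f := fun k =>
      ‖⟪v n m, diagOp (e n) (fun i => (x n i / (l n - x n i)) ^ 2) (v n k)⟫_𝕜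
        - (if m = k then (I : 𝕜) else 0)‖) (fun m _ => by positivity) (Finset.mem_univ k)
  have h1 := norm_sum_gram_sub_le hGη (fun k => (θ k : 𝕜) * ⟪v n k, u n⟫_𝕜)
  have h2 : ∑ m, ∑ k, (starRingEnd 𝕜) ((θ m : 𝕜) * ⟪v n m, u n⟫_𝕜) *
      ((θ k : 𝕜) * ⟪v n k, u n⟫_𝕜) *
      ⟪v n m, diagOp (e n) (fun i => (x n i / (l n - x n i)) ^ 2) (v n k)⟫_𝕜 = ((1 : ℝ) : 𝕜) := by
    have h3 : ⟪u n, u n⟫_𝕜 = ((1 : ℝ) : 𝕜) := by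
      rw [inner_self_eq_norm_sq_to_K, (hu n hr).1]; norm_num
    rw [← h3]
    conv_rhs => rw [hres, diagOp_symm, diagOp_diagOp, hP n hr]
    simp only [frameOp, LinearMap.coe_mk, AddHom.coe_mk, map_sum, map_smul, inner_sum, sum_inner,
        inner_smul_right, inner_smul_left, sq]
    rw [Finset.sum_comm]
    refine Finset.sum_congr rfl fun k _ => ?_
    rw [Finset.mul_sum]
    exact Finset.sum_congr rfl fun m _ => by ring
  have h4 : ∀ k, ‖(θ k : 𝕜) * ⟪v n k, u n⟫_𝕜‖ ^ 2 = θ k ^ 2 * ‖⟪v n k, u n⟫_𝕜‖ ^ 2 := fun k => by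
    rw [norm_mul, mul_pow, RCLike.norm_ofReal, sq_abs]
  rw [h2, ← RCLike.ofReal_sub, RCLike.norm_ofReal] at h1
  simp only [h4] at h1
  rw [Real.dist_eq, abs_sub_comm]
  refine h1.trans ?_
  have hη0' : 0 ≤ η n := by positivity
  gcongr with k
  exact mul_le_of_le_one_right (sq_nonneg _) (pow_le_one₀ (norm_nonneg _) (hcu k))

end Eigenvectors

/-! ### A fourth moment inequality from measure preserving involutions. -/

section ExchangeablePairs

/-- Fourth moment bound by exchangeable pairs: `T s` are measure preserving involutions along which
the increments of `Q` have drift proportional to `Q` and bounded quadratic variation. -/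
theorem integral_pow_four_le {G S : Type*} [TopologicalSpace G] [CompactSpace G]
    [MeasurableSpace G] [BorelSpace G] (ν : Measure G) [IsProbabilityMeasure ν] [Fintype S]
    (T : S → G → G) (hTc : ∀ s, Continuous (T s)) (hT : ∀ s, MeasurePreserving (T s) ν ν)
    (hTT : ∀ s g, T s (T s g) = g) (Q : G → ℝ) (hQ : Continuous Q) {L D : ℝ} (hL : 0 < L)
    (hdrift : ∀ g, ∑ s, (Q g - Q (T s g)) = L * Q g)
    (hvar : ∀ g, ∑ s, (Q g - Q (T s g)) ^ 2 ≤ D) :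
    ∫ g, Q g ^ 4 ∂ν ≤ 3 * D ^ 2 / (4 * L ^ 2) := by
  have hfint : ∀ f : G → ℝ, Continuous f → Integrable f ν := fun f hf => by
    rw [← integrableOn_univ]
    exact hf.continuousOn.integrableOn_compact' isCompact_univ MeasurableSet.univ
  have hswap : ∀ (s : S) (f : ℝ → ℝ → ℝ), Continuous (fun p : ℝ × ℝ => f p.1 p.2) →
      ∫ g, f (Q g) (Q (T s g)) ∂ν = ∫ g, f (Q (T s g)) (Q g) ∂ν := by
    intro s f hf
    have hm : AEStronglyMeasurable (fun g => f (Q (T s g)) (Q g)) (ν.map (T s)) := by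
      rw [(hT s).map_eq]
      exact (hfint _ (hf.comp ((hQ.comp (hTc s)).prodMk hQ))).aestronglyMeasurable
    have := integral_map (hT s).measurable.aemeasurable hm
    rw [(hT s).map_eq] at this
    rw [this]
    simp only [hTT]
  have hD : 0 ≤ D := by
    obtain ⟨g⟩ := nonempty_of_isProbabilityMeasure ν
    exact (Finset.sum_nonneg fun s _ => sq_nonneg _).trans (hvar g)
  have hcs : ∀ s, Continuous fun g => Q (T s g) := fun s => hQ.comp (hTc s)
  have d1 : ∀ s, Integrable (fun g => Q g * (Q g - Q (T s g))) ν := fun s =>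
    hfint _ (hQ.mul (hQ.sub (hcs s)))
  have d1' : ∀ s, Integrable (fun g => Q (T s g) * (Q (T s g) - Q g)) ν := fun s =>
    hfint _ ((hcs s).mul ((hcs s).sub hQ))
  have d2 : ∀ s, Integrable (fun g => (Q g - Q (T s g)) ^ 2) ν := fun s =>
    hfint _ ((hQ.sub (hcs s)).pow 2)
  have d3 : ∀ s, Integrable (fun g => Q g ^ 3 * (Q g - Q (T s g))) ν := fun s =>
    hfint _ ((hQ.pow 3).mul (hQ.sub (hcs s)))
  have d3' : ∀ s, Integrable (fun g => Q (T s g) ^ 3 * (Q (T s g) - Q g)) ν := fun s =>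
    hfint _ (((hcs s).pow 3).mul ((hcs s).sub hQ))
  have d4 : ∀ s, Integrable (fun g => Q g ^ 2 * (Q g - Q (T s g)) ^ 2) ν := fun s =>
    hfint _ ((hQ.pow 2).mul ((hQ.sub (hcs s)).pow 2))
  have d4' : ∀ s, Integrable (fun g => Q (T s g) ^ 2 * (Q (T s g) - Q g) ^ 2) ν := fun s =>
    hfint _ (((hcs s).pow 2).mul (((hcs s).sub hQ).pow 2))
  have h2 : L * ∫ g, Q g ^ 2 ∂ν ≤ D / 2 := by
    have e1 : L * ∫ g, Q g ^ 2 ∂ν = ∑ s, ∫ g, Q g * (Q g - Q (T s g)) ∂ν := by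
      rw [← integral_finsetSum _ fun s _ => d1 s, ← integral_const_mul]
      refine integral_congr_ae (.of_forall fun g => ?_)
      simp only [← Finset.mul_sum, hdrift g]
      ring
    -- Symmetrization: swapping `Q` with `Q ∘ T s` preserves the integral, so `Q (Q - Q')` may be
    -- averaged with `Q' (Q' - Q)`, whose sum with it is `(Q - Q')²`.
    have e2 : ∀ s, ∫ g, Q g * (Q g - Q (T s g)) ∂ν = (∫ g, (Q g - Q (T s g)) ^ 2 ∂ν) / 2 := by
      intro s
      have h := hswap s (fun p q => p * (p - q)) (by fun_prop)
      have h' : ∫ g, (Q g - Q (T s g)) ^ 2 ∂ν = ∫ g, Q g * (Q g - Q (T s g)) ∂ν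
          + ∫ g, Q (T s g) * (Q (T s g) - Q g) ∂ν := by
        rw [← integral_add (d1 s) (d1' s)]
        exact integral_congr_ae (.of_forall fun g => by ring)
      rw [h', ← h]; ring
    rw [e1]
    simp only [e2]
    rw [← Finset.sum_div, ← integral_finsetSum _ fun s _ => d2 s]
    have : ∫ g, ∑ s, (Q g - Q (T s g)) ^ 2 ∂ν ≤ ∫ _, D ∂ν :=
      integral_mono (integrable_finsetSum _ fun s _ => d2 s) (integrable_const D) hvar
    simp only [integral_const, probReal_univ, one_smul] at this
    linarith
  have h4 : L * ∫ g, Q g ^ 4 ∂ν ≤ 3 / 2 * (D * ∫ g, Q g ^ 2 ∂ν) := by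
    have e1 : L * ∫ g, Q g ^ 4 ∂ν = ∑ s, ∫ g, Q g ^ 3 * (Q g - Q (T s g)) ∂ν := by
      rw [← integral_finsetSum _ fun s _ => d3 s, ← integral_const_mul]
      refine integral_congr_ae (.of_forall fun g => ?_)
      simp only [← Finset.mul_sum, hdrift g]
      ring
    -- The same symmetrization with `(p³ - q³)(p - q) ≤ (3/2)(p² + q²)(p - q)²`, where the
    -- difference of the two sides is `(p - q)⁴ / 2`.
    have e2 : ∀ s, ∫ g, Q g ^ 3 * (Q g - Q (T s g)) ∂ν
        ≤ 3 / 2 * ∫ g, Q g ^ 2 * (Q g - Q (T s g)) ^ 2 ∂ν := by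
      intro s
      have h := hswap s (fun p q => p ^ 3 * (p - q)) (by fun_prop)
      have h' := hswap s (fun p q => p ^ 2 * (p - q) ^ 2) (by fun_prop)
      have := integral_mono ((d3 s).add (d3' s)) (((d4 s).add (d4' s)).const_mul (3 / 2))
        fun g => by
          simp only [Pi.add_apply]
          nlinarith [mul_nonneg (sq_nonneg (Q g - Q (T s g))) (sq_nonneg (Q g - Q (T s g)))]
      rw [integral_add' (d3 s) (d3' s), integral_const_mul, integral_add' (d4 s) (d4' s)] at this
      linarith
    rw [e1]
    refine (Finset.sum_le_sum fun s _ => e2 s).trans ?_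
    rw [← Finset.mul_sum, ← integral_finsetSum _ fun s _ => d4 s, ← integral_const_mul D]
    gcongr 3 / 2 * ?_
    refine integral_mono (integrable_finsetSum _ fun s _ => d4 s)
      ((hfint _ (hQ.pow 2)).const_mul D) fun g => ?_
    simp only [← Finset.mul_sum]
    rw [mul_comm D]
    gcongr
    exact hvar g
  have h2' : ∫ g, Q g ^ 2 ∂ν ≤ D / 2 / L := by
    rw [le_div_iff₀ hL]; linarith
  have h4' : ∫ g, Q g ^ 4 ∂ν ≤ 3 / 2 * (D * (D / 2 / L)) / L := by
    rw [le_div_iff₀ hL, mul_comm]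
    refine h4.trans ?_
    gcongr
  refine h4'.trans (le_of_eq ?_)
  field_simp
  ring

end ExchangeablePairs

/-! ### Haar measure on the unitary group, and reflections. -/

section UnitaryGroup

variable {𝕜 : Type*} [RCLike 𝕜] {n : ℕ}

instance matrixBorelSpace : BorelSpace (Matrix (Fin n) (Fin n) 𝕜) :=
  inferInstanceAs (BorelSpace (Fin n → Fin n → 𝕜))

instance matrixSecondCountable : SecondCountableTopology (Matrix (Fin n) (Fin n) 𝕜) :=
  inferInstanceAs (SecondCountableTopology (Fin n → Fin n → 𝕜))

instance unitaryGroupCompactSpace : CompactSpace (Matrix.unitaryGroup (Fin n) 𝕜) := by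
  have hc : IsCompact ((Matrix.unitaryGroup (Fin n) 𝕜 : Submonoid _) :
      Set (Matrix (Fin n) (Fin n) 𝕜)) := by
    have h1 : IsCompact (Set.pi Set.univ fun _ => Set.pi Set.univ fun _ => Metric.closedBall 0 1 :
        Set (Fin n → Fin n → 𝕜)) :=
      isCompact_univ_pi fun _ => isCompact_univ_pi fun _ => isCompact_closedBall 0 1
    refine h1.of_isClosed_subset (isClosed_unitary (R := Matrix (Fin n) (Fin n) 𝕜)) ?_
    intro U hU i _ j _
    simpa using entry_norm_bound_of_unitary hU i j
  exact isCompact_iff_compactSpace.1 hc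

/-- The normalized Haar measure of the unitary group. -/
def unitaryHaar (𝕜 : Type*) [RCLike 𝕜] (n : ℕ) : Measure (Matrix.unitaryGroup (Fin n) 𝕜) :=
  Measure.haarMeasure ⊤

instance : IsProbabilityMeasure (unitaryHaar 𝕜 n) :=
  ⟨by
    have := Measure.haarMeasure_self (K₀ := (⊤ : TopologicalSpace.PositiveCompacts
      (Matrix.unitaryGroup (Fin n) 𝕜)))
    simpa [unitaryHaar] using this⟩

instance : (unitaryHaar 𝕜 n).IsMulLeftInvariant := by
  unfold unitaryHaar; infer_instance

/-- Two unit vectors with real inner product are exchanged by a Hermitian unitary matrix. -/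
theorem exists_reflection {w w' : EuclideanSpace 𝕜 (Fin n)} (hw : ‖w‖ = 1) (hw' : ‖w'‖ = 1)
    (h : ⟪w, w'⟫_𝕜 = ⟪w', w⟫_𝕜) :
    ∃ R : Matrix.unitaryGroup (Fin n) 𝕜, star R = R ∧
      Matrix.toEuclideanLin (R : Matrix (Fin n) (Fin n) 𝕜) w = w' := by
  let K : Submodule 𝕜 (EuclideanSpace 𝕜 (Fin n)) := (Submodule.span 𝕜 {w - w'})ᗮ
  let ρ := K.reflection
  let R : Matrix (Fin n) (Fin n) 𝕜 := Matrix.toEuclideanLin.symm ρ.toLinearEquiv.toLinearMap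
  have hR : ∀ y, Matrix.toEuclideanLin R y = ρ y := fun y => by
    simp only [R, LinearEquiv.apply_symm_apply]; rfl
  have hRR : R * R = 1 := by
    apply Matrix.toEuclideanLin.injective
    ext1 y
    rw [toEuclideanLin_mul_apply, hR, hR, toEuclideanLin_one_apply]
    exact K.reflection_reflection y
  have hRs : R.IsHermitian := by
    rw [← Matrix.isSymmetric_toEuclideanLin_iff]
    intro y z
    rw [hR, hR, ← ρ.inner_map_map, K.reflection_reflection]
  have hRu : R ∈ Matrix.unitaryGroup (Fin n) 𝕜 := by
    rw [Matrix.mem_unitaryGroup_iff, Matrix.star_eq_conjTranspose, hRs.eq, hRR]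
  refine ⟨⟨R, hRu⟩, Subtype.ext hRs.eq, ?_⟩
  change Matrix.toEuclideanLin R w = w'
  rw [hR]
  -- Orthogonality of `w + w'` and `w - w'` uses the equal norms and the symmetry of the inner
  -- product `h`. The reflection then fixes the sum and negates the difference.
  have h1 : w + w' ∈ K := by
    rw [Submodule.mem_orthogonal_singleton_iff_inner_right, inner_sub_left, inner_add_right,
      inner_add_right, inner_self_eq_norm_sq_to_K, inner_self_eq_norm_sq_to_K, hw, hw', h]
    ring
  have h2 : w - w' ∈ Kᗮ := by
    rw [Submodule.orthogonal_orthogonal]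
    exact Submodule.mem_span_singleton_self _
  have h3 : w = (2⁻¹ : 𝕜) • (w + w') + (2⁻¹ : 𝕜) • (w - w') := by
    rw [← smul_add, show w + w' + (w - w') = (2 : 𝕜) • w by rw [two_smul]; abel, smul_smul,
      inv_mul_cancel₀ two_ne_zero, one_smul]
  have h4 : ρ (w + w') = w + w' := Submodule.reflection_mem_subspace_eq_self h1
  have h5 : ρ (w - w') = -(w - w') := Submodule.reflection_mem_subspace_orthogonalComplement_eq_neg h2
  conv_lhs => rw [h3]
  rw [map_add, map_smul, map_smul, h4, h5, ← smul_add,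
    show w + w' + -(w - w') = (2 : 𝕜) • w' by rw [two_smul]; abel, smul_smul,
      inv_mul_cancel₀ two_ne_zero, one_smul]

end UnitaryGroup

/-! ### Fourth moments of quadratic forms under random conjugation. -/

section QuadraticForms

variable {𝕜 : Type*} [RCLike 𝕜] {n : ℕ}

/-- `U A U*` for a unitary matrix `U`. -/
def conjugate (U : Matrix.unitaryGroup (Fin n) 𝕜) (A : Matrix (Fin n) (Fin n) 𝕜) :
    Matrix (Fin n) (Fin n) 𝕜 :=
  (U : Matrix (Fin n) (Fin n) 𝕜) * A * star (U : Matrix (Fin n) (Fin n) 𝕜)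

theorem star_mul_coe (U : Matrix.unitaryGroup (Fin n) 𝕜) :
    star (U : Matrix (Fin n) (Fin n) 𝕜) * (U : Matrix (Fin n) (Fin n) 𝕜) = 1 :=
  Matrix.UnitaryGroup.star_mul_self U

theorem coe_mul_star (U : Matrix.unitaryGroup (Fin n) 𝕜) :
    (U : Matrix (Fin n) (Fin n) 𝕜) * star (U : Matrix (Fin n) (Fin n) 𝕜) = 1 :=
  Matrix.mem_unitaryGroup_iff.1 U.2

theorem conjugate_isHermitian (U : Matrix.unitaryGroup (Fin n) 𝕜) {A : Matrix (Fin n) (Fin n) 𝕜}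
    (hA : A.IsHermitian) : (conjugate U A).IsHermitian := by
  rw [Matrix.IsHermitian, conjugate, Matrix.conjTranspose_mul, Matrix.conjTranspose_mul, hA.eq,
    Matrix.star_eq_conjTranspose, Matrix.conjTranspose_conjTranspose, Matrix.mul_assoc]

theorem trace_conjugate (U : Matrix.unitaryGroup (Fin n) 𝕜) (A : Matrix (Fin n) (Fin n) 𝕜) :
    (conjugate U A).trace = A.trace := by
  rw [conjugate, Matrix.trace_mul_comm, ← Matrix.mul_assoc, star_mul_coe, Matrix.one_mul]

theorem conjugate_mul (U : Matrix.unitaryGroup (Fin n) 𝕜) (A B : Matrix (Fin n) (Fin n) 𝕜) :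
    conjugate U (A * B) = conjugate U A * conjugate U B := by
  have := star_mul_coe U
  simp only [conjugate, Matrix.mul_assoc]
  rw [← Matrix.mul_assoc (star (U : Matrix (Fin n) (Fin n) 𝕜)) (U : Matrix (Fin n) (Fin n) 𝕜),
    this, Matrix.one_mul]

theorem conjugate_mul_left (R U : Matrix.unitaryGroup (Fin n) 𝕜) (A : Matrix (Fin n) (Fin n) 𝕜) :
    conjugate (R * U) A = conjugate R (conjugate U A) := by
  simp [conjugate, Matrix.mul_assoc]

theorem norm_unitary_apply (U : Matrix.unitaryGroup (Fin n) 𝕜) (y : EuclideanSpace 𝕜 (Fin n)) :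
    ‖Matrix.toEuclideanLin (U : Matrix (Fin n) (Fin n) 𝕜) y‖ = ‖y‖ := by
  have h : ⟪Matrix.toEuclideanLin (U : Matrix (Fin n) (Fin n) 𝕜) y,
      Matrix.toEuclideanLin (U : Matrix (Fin n) (Fin n) 𝕜) y⟫_𝕜 = ⟪y, y⟫_𝕜 := by
    rw [← LinearMap.adjoint_inner_right, ← Matrix.toEuclideanLin_conjTranspose_eq_adjoint,
      ← toEuclideanLin_mul_apply, ← Matrix.star_eq_conjTranspose, star_mul_coe,
      toEuclideanLin_one_apply]
  rw [inner_self_eq_norm_sq_to_K, inner_self_eq_norm_sq_to_K] at h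
  have h' : ‖Matrix.toEuclideanLin (U : Matrix (Fin n) (Fin n) 𝕜) y‖ ^ 2 = ‖y‖ ^ 2 := by
    exact_mod_cast h
  exact (sq_eq_sq₀ (norm_nonneg _) (norm_nonneg _)).1 h'

theorem norm_conjugate_apply_le (U : Matrix.unitaryGroup (Fin n) 𝕜)
    {A : Matrix (Fin n) (Fin n) 𝕜} {K : ℝ} (hA : ∀ y, ‖Matrix.toEuclideanLin A y‖ ≤ K * ‖y‖)
    (y : EuclideanSpace 𝕜 (Fin n)) : ‖Matrix.toEuclideanLin (conjugate U A) y‖ ≤ K * ‖y‖ := by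
  rw [conjugate, toEuclideanLin_mul_apply, toEuclideanLin_mul_apply, norm_unitary_apply]
  refine (hA _).trans (le_of_eq ?_)
  congr 1
  exact norm_unitary_apply (star U) y

theorem sum_inner_toEuclideanLin (A : Matrix (Fin n) (Fin n) 𝕜)
    (e : OrthonormalBasis (Fin n) 𝕜 (EuclideanSpace 𝕜 (Fin n))) :
    ∑ i, ⟪e i, Matrix.toEuclideanLin A (e i)⟫_𝕜 = A.trace := by
  rw [← LinearMap.trace_eq_sum_inner,
    LinearMap.trace_eq_sum_inner _ (EuclideanSpace.basisFun (Fin n) 𝕜)]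
  simp only [Matrix.trace, Matrix.diag]
  refine Finset.sum_congr rfl fun i _ => ?_
  simp [EuclideanSpace.inner_single_left, Matrix.toLpLin_apply, Matrix.col_apply]

/-- The real part of the quadratic form of `U A U*` at `w`. -/
def conjForm (A : Matrix (Fin n) (Fin n) 𝕜) (w : EuclideanSpace 𝕜 (Fin n))
    (U : Matrix.unitaryGroup (Fin n) 𝕜) : ℝ :=
  RCLike.re ⟪w, Matrix.toEuclideanLin (conjugate U A) w⟫_𝕜

theorem continuous_conjugate (A : Matrix (Fin n) (Fin n) 𝕜) :
    Continuous fun U : Matrix.unitaryGroup (Fin n) 𝕜 => conjugate U A := by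
  unfold conjugate
  fun_prop

theorem continuous_inner_toEuclideanLin (v w : EuclideanSpace 𝕜 (Fin n)) :
    Continuous fun A : Matrix (Fin n) (Fin n) 𝕜 => ⟪v, Matrix.toEuclideanLin A w⟫_𝕜 := by
  refine continuous_const.inner ?_
  have := LinearMap.continuous_of_finiteDimensional
    ((LinearMap.applyₗ w).comp (Matrix.toEuclideanLin (𝕜 := 𝕜) (m := Fin n) (n := Fin n)).toLinearMap)
  exact this

theorem continuous_conjForm (A : Matrix (Fin n) (Fin n) 𝕜) (w : EuclideanSpace 𝕜 (Fin n)) :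
    Continuous (conjForm A w) :=
  RCLike.continuous_re.comp ((continuous_inner_toEuclideanLin w w).comp (continuous_conjugate A))

/-- Fourth moment bound for the quadratic form of a traceless matrix at a Haar distributed unit
vector. -/
theorem integral_conjForm_pow_four_le {A : Matrix (Fin n) (Fin n) 𝕜} (hA : A.IsHermitian)
    (htr : A.trace = 0) {K : ℝ} (hK : ∀ y, ‖Matrix.toEuclideanLin A y‖ ≤ K * ‖y‖)
    {w : EuclideanSpace 𝕜 (Fin n)} (hw : ‖w‖ = 1) :
    ∫ U, conjForm A w U ^ 4 ∂(unitaryHaar 𝕜 n) ≤ 48 * K ^ 4 / n ^ 2 := by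
  classical
  have hn : 0 < n := by
    rcases Nat.eq_zero_or_pos n with h | h
    · subst h
      rw [Subsingleton.elim w 0, norm_zero] at hw
      exact absurd hw zero_ne_one
    · exact h
  have hn' : (0 : ℝ) < n := by exact_mod_cast hn
  let i₁ : Fin n := ⟨0, hn⟩
  obtain ⟨b, hb⟩ := Orthonormal.exists_orthonormalBasis_extension_of_card_eq (𝕜 := 𝕜)
    (E := EuclideanSpace 𝕜 (Fin n)) (ι := Fin n) (by simp) (v := fun _ => w) (s := {i₁})
    (by
      rw [orthonormal_iff_ite]
      rintro ⟨i, hi⟩ ⟨j, hj⟩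
      simp only [Set.mem_singleton_iff] at hi hj
      subst hi; subst hj
      simp [inner_self_eq_norm_sq_to_K, hw])
  have hb1 : b i₁ = w := hb i₁ rfl
  have hbb := orthonormal_iff_ite.1 b.orthonormal
  -- The move replaces `w` by `c w ± s b_j`. Its drift is `2 n s² Q` and its quadratic variation is
  -- at most `8 K² (n s⁴ + s²)`; `s² = 1 / n` makes the drift constant `2` and the variation of
  -- order `1 / n`.
  set s : ℝ := √(1 / n) with hs
  set c : ℝ := √(1 - 1 / n) with hc
  have hs2 : s ^ 2 = 1 / n := Real.sq_sqrt (by positivity)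
  have hc2 : c ^ 2 = 1 - 1 / n := Real.sq_sqrt (by
    rw [sub_nonneg, div_le_one hn']; exact_mod_cast hn)
  have hcs : c ^ 2 + s ^ 2 = 1 := by rw [hs2, hc2]; ring
  let σ : Bool → ℝ := fun t => if t then 1 else -1
  have hσ : ∀ t, σ t ^ 2 = 1 := fun t => by cases t <;> simp [σ]
  -- Each move is left multiplication by a self-adjoint unitary, hence a Haar preserving involution.
  -- The index `i₁`, where `b i₁ = w`, contributes the identity.
  have hR : ∀ p : Fin n × Bool, ∃ R : Matrix.unitaryGroup (Fin n) 𝕜, star R = R ∧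
      Matrix.toEuclideanLin (R : Matrix (Fin n) (Fin n) 𝕜) w =
        if p.1 = i₁ then w else (c : 𝕜) • w + ((σ p.2 * s : ℝ) : 𝕜) • b p.1 := by
    rintro ⟨j, t⟩
    by_cases hj : j = i₁
    · exact ⟨1, star_one _, by simp [hj]⟩
    · have hwj : ⟪w, b j⟫_𝕜 = 0 := by rw [← hb1, hbb, if_neg (Ne.symm hj)]
      have hjw : ⟪b j, w⟫_𝕜 = 0 := by rw [← hb1, hbb, if_neg hj]
      have hww : ⟪w, w⟫_𝕜 = 1 := by rw [inner_self_eq_norm_sq_to_K, hw]; norm_num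
      simp only [hj, if_false]
      apply exists_reflection hw
      · have h1 : ‖(c : 𝕜) • w + ((σ t * s : ℝ) : 𝕜) • b j‖ ^ 2 = 1 := by
          rw [norm_add_sq (𝕜 := 𝕜), inner_smul_left, inner_smul_right, hwj, norm_smul, norm_smul, hw,
            b.norm_eq_one, RCLike.norm_ofReal, RCLike.norm_ofReal, mul_one, mul_one, sq_abs, sq_abs,
            mul_pow, hσ]
          simp [hcs]
        rw [← Real.sqrt_sq (norm_nonneg _), h1, Real.sqrt_one]
      · simp only [inner_add_right, inner_add_left, inner_smul_left, inner_smul_right, hwj, hjw,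
          mul_zero, add_zero, RCLike.conj_ofReal]
  choose R hRs hRw using hR
  set Q := conjForm A w with hQ
  let B : Matrix.unitaryGroup (Fin n) 𝕜 → EuclideanSpace 𝕜 (Fin n) →ₗ[𝕜] EuclideanSpace 𝕜 (Fin n) :=
    fun U => Matrix.toEuclideanLin (conjugate U A)
  have hB : ∀ U y z, ⟪B U y, z⟫_𝕜 = ⟪y, B U z⟫_𝕜 := fun U y z =>
    inner_toEuclideanLin_symm (conjugate_isHermitian U hA) y z
  have hBK : ∀ U y, ‖B U y‖ ≤ K * ‖y‖ := fun U y => norm_conjugate_apply_le U hK y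
  have hK0 : 0 ≤ K := by
    have := (norm_nonneg _).trans (hK w)
    rwa [hw, mul_one] at this
  let d : Matrix.unitaryGroup (Fin n) 𝕜 → Fin n → ℝ := fun U j => RCLike.re ⟪b j, B U (b j)⟫_𝕜
  let f : Matrix.unitaryGroup (Fin n) 𝕜 → Fin n → ℝ := fun U j => RCLike.re ⟪w, B U (b j)⟫_𝕜
  have hQR : ∀ U (p : Fin n × Bool), Q U - Q (R p * U)
      = if p.1 = i₁ then 0 else s ^ 2 * (Q U - d U p.1) - 2 * c * s * σ p.2 * f U p.1 := by
    intro U p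
    have h1 : Q (R p * U) = RCLike.re ⟪Matrix.toEuclideanLin (R p : Matrix (Fin n) (Fin n) 𝕜) w,
        B U (Matrix.toEuclideanLin (R p : Matrix (Fin n) (Fin n) 𝕜) w)⟫_𝕜 := by
      have hst : star (R p : Matrix (Fin n) (Fin n) 𝕜) = R p := congrArg Subtype.val (hRs p)
      have hRh : (R p : Matrix (Fin n) (Fin n) 𝕜).IsHermitian := hst
      rw [hQ, conjForm, conjugate_mul_left, conjugate, toEuclideanLin_mul_apply,
        toEuclideanLin_mul_apply, hst, inner_toEuclideanLin_symm hRh]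
    rw [h1, hRw]
    have h2 : Q U = RCLike.re ⟪w, B U w⟫_𝕜 := rfl
    by_cases hj : p.1 = i₁
    · simp only [hj, if_true, h2, sub_self]
    · simp only [hj, if_false]
      have h3 : RCLike.re ⟪b p.1, B U w⟫_𝕜 = f U p.1 := by
        rw [← hB, ← inner_conj_symm, RCLike.conj_re]
      have h4 : RCLike.re ⟪(c : 𝕜) • w + ((σ p.2 * s : ℝ) : 𝕜) • b p.1,
          B U ((c : 𝕜) • w + ((σ p.2 * s : ℝ) : 𝕜) • b p.1)⟫_𝕜
          = c ^ 2 * Q U + (σ p.2) ^ 2 * s ^ 2 * d U p.1 + 2 * c * s * σ p.2 * f U p.1 := by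
        rw [map_add, map_smul, map_smul]
        simp only [inner_add_left, inner_add_right, inner_smul_left, inner_smul_right,
          RCLike.conj_ofReal, map_add, RCLike.re_ofReal_mul, h3]
        simp only [d, f, ← h2]
        ring
      rw [h4, hσ]
      have : c ^ 2 = 1 - s ^ 2 := by linarith
      rw [this]; ring
  have hsum : ∀ U, ∑ j, d U j = 0 := by
    intro U
    have h := sum_inner_toEuclideanLin (conjugate U A) b
    rw [trace_conjugate, htr] at h
    have h2 := congrArg RCLike.re h
    rw [map_sum, map_zero] at h2
    exact h2
  have hd1 : ∀ U, d U i₁ = Q U := fun U => by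
    simp only [d, hb1]; rfl
  have hQb : ∀ U, |Q U| ≤ K := fun U => by
    refine (RCLike.abs_re_le_norm _).trans ((norm_inner_le_norm _ _).trans ?_)
    have := hBK U w
    rw [hw, mul_one] at this
    rw [hw, one_mul]; exact this
  have hdb : ∀ U j, |d U j| ≤ K := fun U j => by
    refine (RCLike.abs_re_le_norm _).trans ((norm_inner_le_norm _ _).trans ?_)
    have := hBK U (b j)
    rw [b.norm_eq_one, mul_one] at this
    rw [b.norm_eq_one, one_mul]; exact this
  -- Parseval for `B U w` bounds the whole sum by `K²`; termwise bounds would lose a factor `n`.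
  have hfb : ∀ U, ∑ j, f U j ^ 2 ≤ K ^ 2 := fun U => by
    have h1 : ∀ j, f U j ^ 2 ≤ ‖⟪B U w, b j⟫_𝕜‖ ^ 2 := fun j => by
      rw [hB, ← sq_abs]
      exact pow_le_pow_left₀ (abs_nonneg _) (RCLike.abs_re_le_norm _) 2
    refine (Finset.sum_le_sum fun j _ => h1 j).trans ?_
    rw [b.sum_sq_norm_inner_left]
    have := hBK U w
    rw [hw, mul_one] at this
    exact pow_le_pow_left₀ (norm_nonneg _) this 2
  -- The two signs cancel the cross terms, and `∑ d U j` is the trace, which is zero; what remains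
  -- is `2 n s² Q U = 2 Q U`.
  have hdrift : ∀ U, ∑ p : Fin n × Bool, (Q U - Q (R p * U)) = 2 * Q U := by
    intro U
    simp only [hQR]
    rw [Fintype.sum_prod_type]
    have h1 : ∀ j, ∑ t : Bool, (if j = i₁ then 0
        else s ^ 2 * (Q U - d U j) - 2 * c * s * σ t * f U j) = 2 * s ^ 2 * (Q U - d U j) := by
      intro j
      by_cases hj : j = i₁
      · simp [hj, hd1]
      · simp [hj, σ]; ring
    simp only [h1]
    rw [← Finset.mul_sum, Finset.sum_sub_distrib, hsum, hs2]
    simp only [Finset.sum_const, Finset.card_univ, Fintype.card_fin, nsmul_eq_mul, sub_zero]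
    field_simp
  have hvar : ∀ U, ∑ p : Fin n × Bool, (Q U - Q (R p * U)) ^ 2 ≤ 16 * K ^ 2 / n := by
    intro U
    simp only [hQR]
    rw [Fintype.sum_prod_type]
    have h1 : ∀ j, ∑ t : Bool, (if j = i₁ then 0
        else s ^ 2 * (Q U - d U j) - 2 * c * s * σ t * f U j) ^ 2
          ≤ 8 * K ^ 2 * (s ^ 2) ^ 2 + 8 * s ^ 2 * f U j ^ 2 := by
      intro j
      by_cases hj : j = i₁
      · simp only [hj, if_true]
        simp; positivity
      · have e1 : |Q U - d U j| ≤ 2 * K := by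
          refine (abs_sub _ _).trans ?_
          linarith [hQb U, hdb U j]
        have e2 : (Q U - d U j) ^ 2 ≤ (2 * K) ^ 2 := by
          rw [← sq_abs]; exact pow_le_pow_left₀ (abs_nonneg _) e1 2
        have e3 : c ^ 2 ≤ 1 := by nlinarith [sq_nonneg s]
        simp only [hj, if_false, Fintype.sum_bool, σ, if_true, Bool.false_eq_true]
        have e4 : (s ^ 2) ^ 2 * (Q U - d U j) ^ 2 ≤ (s ^ 2) ^ 2 * (2 * K) ^ 2 := by gcongr
        have e5 : c ^ 2 * (s ^ 2 * f U j ^ 2) ≤ 1 * (s ^ 2 * f U j ^ 2) := by gcongr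
        nlinarith
    refine (Finset.sum_le_sum fun j _ => h1 j).trans ?_
    rw [Finset.sum_add_distrib, ← Finset.mul_sum Finset.univ (fun j => f U j ^ 2), hs2]
    simp only [Finset.sum_const, Finset.card_univ, Fintype.card_fin, nsmul_eq_mul]
    have e6 : 8 * (1 / (n : ℝ)) * ∑ j, f U j ^ 2 ≤ 8 * (1 / (n : ℝ)) * K ^ 2 := by
      gcongr; exact hfb U
    refine (add_le_add_right e6 _).trans (le_of_eq ?_)
    field_simp
    ring
  have hfin := integral_pow_four_le (unitaryHaar 𝕜 n) (fun p U => R p * U)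
    (fun p => continuous_const.mul continuous_id)
    (fun p => measurePreserving_mul_left _ (R p))
    (fun p U => by
      have : R p * R p = 1 := by
        have h := Unitary.star_mul_self (R p)
        rwa [hRs p] at h
      rw [← mul_assoc, this, one_mul]) Q (continuous_conjForm A w) two_pos hdrift hvar
  refine hfin.trans (le_of_eq ?_)
  field_simp
  ring

end QuadraticForms

/-! ### Moments of the energy of a rotated traceless matrix compressed by `P`. -/

section Compressions

variable {𝕜 : Type*} [RCLike 𝕜] {n r : ℕ}

theorem integrable_of_continuous_unitary {f : Matrix.unitaryGroup (Fin n) 𝕜 → ℝ}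
    (hf : Continuous f) : Integrable f (unitaryHaar 𝕜 n) := by
  rw [← integrableOn_univ]
  exact hf.continuousOn.integrableOn_compact' isCompact_univ MeasurableSet.univ

theorem continuous_inner_conjugate (A : Matrix (Fin n) (Fin n) 𝕜)
    (y z : EuclideanSpace 𝕜 (Fin n)) :
    Continuous fun U : Matrix.unitaryGroup (Fin n) 𝕜 =>
      ⟪y, Matrix.toEuclideanLin (conjugate U A) z⟫_𝕜 :=
  (continuous_inner_toEuclideanLin y z).comp (continuous_conjugate A)

variable {A : Matrix (Fin n) (Fin n) 𝕜} {K : ℝ}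

/-- Polarization: with `p`, `q` the forms at the unit vectors `(y ± z)/√2`, the real part equals `(p
- q)/2`, and `((p - q)/2)⁴ ≤ (p⁴ + q⁴)/2`. -/
theorem integral_re_inner_pow_four_le (hA : A.IsHermitian) (htr : A.trace = 0)
    (hK : ∀ y, ‖Matrix.toEuclideanLin A y‖ ≤ K * ‖y‖)
    {y z : EuclideanSpace 𝕜 (Fin n)} (hy : ‖y‖ = 1) (hz : ‖z‖ = 1) (hyz : ⟪y, z⟫_𝕜 = 0) :
    ∫ U, (RCLike.re ⟪y, Matrix.toEuclideanLin (conjugate U A) z⟫_𝕜) ^ 4 ∂(unitaryHaar 𝕜 n)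
      ≤ 48 * K ^ 4 / n ^ 2 := by
  set s : ℝ := √(1 / 2) with hs
  have hs2 : s ^ 2 = 1 / 2 := Real.sq_sqrt (by positivity)
  let w : ℝ → EuclideanSpace 𝕜 (Fin n) := fun t => ((s : ℝ) : 𝕜) • (y + ((t : ℝ) : 𝕜) • z)
  have hw : ∀ t : ℝ, t ^ 2 = 1 → ‖w t‖ = 1 := by
    intro t ht
    have h1 : ‖w t‖ ^ 2 = 1 := by
      simp only [w]
      rw [norm_smul, mul_pow, norm_add_sq (𝕜 := 𝕜), inner_smul_right, hyz, norm_smul, hy, hz,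
        RCLike.norm_ofReal, RCLike.norm_ofReal, mul_one, sq_abs, sq_abs, ht, hs2]
      simp; norm_num
    rw [← Real.sqrt_sq (norm_nonneg _), h1, Real.sqrt_one]
  have hform : ∀ (t : ℝ) U, conjForm A (w t) U = 1 / 2 *
      (conjForm A y U + t ^ 2 * conjForm A z U
        + 2 * t * RCLike.re ⟪y, Matrix.toEuclideanLin (conjugate U A) z⟫_𝕜) := by
    intro t U
    have h3 : RCLike.re ⟪z, Matrix.toEuclideanLin (conjugate U A) y⟫_𝕜
        = RCLike.re ⟪y, Matrix.toEuclideanLin (conjugate U A) z⟫_𝕜 := by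
      rw [← inner_toEuclideanLin_symm (conjugate_isHermitian U hA), ← inner_conj_symm,
        RCLike.conj_re]
    simp only [conjForm, w]
    rw [map_smul, map_add, map_smul]
    simp only [inner_add_left, inner_add_right, inner_smul_left, inner_smul_right,
      RCLike.conj_ofReal, map_add, RCLike.re_ofReal_mul, h3]
    linear_combination (RCLike.re ⟪y, Matrix.toEuclideanLin (conjugate U A) y⟫_𝕜
      + t ^ 2 * RCLike.re ⟪z, Matrix.toEuclideanLin (conjugate U A) z⟫_𝕜
      + 2 * t * RCLike.re ⟪y, Matrix.toEuclideanLin (conjugate U A) z⟫_𝕜) * hs2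
  have h1 := integral_conjForm_pow_four_le hA htr hK (hw 1 (by norm_num))
  have h2 := integral_conjForm_pow_four_le hA htr hK (hw (-1) (by norm_num))
  have hi : ∀ t, Integrable (fun U => conjForm A (w t) U ^ 4) (unitaryHaar 𝕜 n) := fun t =>
    integrable_of_continuous_unitary ((continuous_conjForm A (w t)).pow 4)
  have hle : ∫ U, (RCLike.re ⟪y, Matrix.toEuclideanLin (conjugate U A) z⟫_𝕜) ^ 4
      ∂(unitaryHaar 𝕜 n) ≤ ∫ U, 1 / 2 * (conjForm A (w 1) U ^ 4 + conjForm A (w (-1)) U ^ 4)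
      ∂(unitaryHaar 𝕜 n) := by
    refine integral_mono (integrable_of_continuous_unitary
      ((RCLike.continuous_re.comp (continuous_inner_conjugate A y z)).pow 4))
      (((hi 1).add (hi (-1))).const_mul (1 / 2)) fun U => ?_
    have e1 := hform 1 U
    have e2 := hform (-1) U
    set p := conjForm A (w 1) U
    set q := conjForm A (w (-1)) U
    have e3 : RCLike.re ⟪y, Matrix.toEuclideanLin (conjugate U A) z⟫_𝕜 = (p - q) / 2 := by
      rw [e1, e2]; ring
    simp only [e3]
    have e4 : (p - q) ^ 2 ≤ 2 * (p ^ 2 + q ^ 2) := by nlinarith [sq_nonneg (p + q)]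
    have e5 := pow_le_pow_left₀ (sq_nonneg (p - q)) e4 2
    nlinarith [sq_nonneg (p ^ 2 - q ^ 2)]
  rw [integral_const_mul, integral_add (hi 1) (hi (-1))] at hle
  linarith

/-- Real and imaginary parts each have fourth moment at most `48 K⁴ / n²`, and `|w|⁴ ≤ 2 (Re⁴ +
Im⁴)`, whence `192`. -/
theorem integral_norm_inner_pow_four_le (hA : A.IsHermitian) (htr : A.trace = 0)
    (hK : ∀ y, ‖Matrix.toEuclideanLin A y‖ ≤ K * ‖y‖)
    {v : Fin r → EuclideanSpace 𝕜 (Fin n)} (hv : Orthonormal 𝕜 v) (k l : Fin r) :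
    ∫ U, ‖⟪v k, Matrix.toEuclideanLin (conjugate U A) (v l)⟫_𝕜‖ ^ 4 ∂(unitaryHaar 𝕜 n)
      ≤ 192 * K ^ 4 / n ^ 2 := by
  have hbound : 0 ≤ K ^ 4 / (n : ℝ) ^ 2 := by positivity
  have c1 : ∀ y z : EuclideanSpace 𝕜 (Fin n), Integrable (fun U =>
      (RCLike.re ⟪y, Matrix.toEuclideanLin (conjugate U A) z⟫_𝕜) ^ 4) (unitaryHaar 𝕜 n) :=
    fun y z => integrable_of_continuous_unitary
      ((RCLike.continuous_re.comp (continuous_inner_conjugate A y z)).pow 4)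
  have c2 : ∀ y z : EuclideanSpace 𝕜 (Fin n), Integrable (fun U =>
      (RCLike.im ⟪y, Matrix.toEuclideanLin (conjugate U A) z⟫_𝕜) ^ 4) (unitaryHaar 𝕜 n) :=
    fun y z => integrable_of_continuous_unitary
      ((RCLike.continuous_im.comp (continuous_inner_conjugate A y z)).pow 4)
  have hre : ∫ U, (RCLike.re ⟪v k, Matrix.toEuclideanLin (conjugate U A) (v l)⟫_𝕜) ^ 4
      ∂(unitaryHaar 𝕜 n) ≤ 48 * K ^ 4 / n ^ 2 := by
    by_cases hkl : k = l
    · subst hkl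
      exact integral_conjForm_pow_four_le hA htr hK (hv.1 k)
    · exact integral_re_inner_pow_four_le hA htr hK (hv.1 k) (hv.1 l) (hv.2 hkl)
  have him : ∫ U, (RCLike.im ⟪v k, Matrix.toEuclideanLin (conjugate U A) (v l)⟫_𝕜) ^ 4
      ∂(unitaryHaar 𝕜 n) ≤ 48 * K ^ 4 / n ^ 2 := by
    have hzero : (∀ U, RCLike.im ⟪v k, Matrix.toEuclideanLin (conjugate U A) (v l)⟫_𝕜 = 0) →
        ∫ U, (RCLike.im ⟪v k, Matrix.toEuclideanLin (conjugate U A) (v l)⟫_𝕜) ^ 4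
          ∂(unitaryHaar 𝕜 n) ≤ 48 * K ^ 4 / n ^ 2 := by
      intro h
      simp only [h]
      simp only [ne_eq, OfNat.ofNat_ne_zero, not_false_eq_true, zero_pow, integral_zero]
      positivity
    by_cases hkl : k = l
    · subst hkl
      refine hzero fun U => ?_
      rw [← RCLike.conj_eq_iff_im, inner_conj_symm,
        inner_toEuclideanLin_symm (conjugate_isHermitian U hA)]
    -- In the real case `I = 0` and the imaginary part vanishes. Otherwise replacing `v l` by `I • v
    -- l` turns it, up to sign, into a real part.
    by_cases hI : (RCLike.I : 𝕜) = 0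
    · refine hzero fun U => ?_
      have := RCLike.I_mul_re ⟪v k, Matrix.toEuclideanLin (conjugate U A) (v l)⟫_𝕜
      rw [hI, zero_mul, map_zero] at this
      linarith
    · have h1 := integral_re_inner_pow_four_le hA htr hK (hv.1 k)
        (z := (RCLike.I : 𝕜) • v l) (by rw [norm_smul, RCLike.norm_I_of_ne_zero hI, hv.1 l, one_mul])
        (by rw [inner_smul_right, hv.2 hkl, mul_zero])
      refine le_trans (le_of_eq ?_) h1
      refine integral_congr_ae (.of_forall fun U => ?_)
      simp only [map_smul, inner_smul_right, RCLike.I_mul_re]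
      ring
  have hle : ∫ U, ‖⟪v k, Matrix.toEuclideanLin (conjugate U A) (v l)⟫_𝕜‖ ^ 4 ∂(unitaryHaar 𝕜 n)
      ≤ ∫ U, 2 * ((RCLike.re ⟪v k, Matrix.toEuclideanLin (conjugate U A) (v l)⟫_𝕜) ^ 4
        + (RCLike.im ⟪v k, Matrix.toEuclideanLin (conjugate U A) (v l)⟫_𝕜) ^ 4)
          ∂(unitaryHaar 𝕜 n) := by
    refine integral_mono (integrable_of_continuous_unitary
      ((continuous_inner_conjugate A _ _).norm.pow 4))
      (((c1 _ _).add (c2 _ _)).const_mul 2) fun U => ?_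
    simp only
    have : ‖⟪v k, Matrix.toEuclideanLin (conjugate U A) (v l)⟫_𝕜‖ ^ 4
        = (‖⟪v k, Matrix.toEuclideanLin (conjugate U A) (v l)⟫_𝕜‖ ^ 2) ^ 2 := by ring
    rw [this, RCLike.norm_sq_eq_def]
    nlinarith [sq_nonneg ((RCLike.re ⟪v k, Matrix.toEuclideanLin (conjugate U A) (v l)⟫_𝕜) ^ 2
      - (RCLike.im ⟪v k, Matrix.toEuclideanLin (conjugate U A) (v l)⟫_𝕜) ^ 2)]
  rw [integral_const_mul, integral_add (c1 _ _) (c2 _ _)] at hle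
  have : 192 * K ^ 4 / (n : ℝ) ^ 2 = 2 * (48 * K ^ 4 / n ^ 2 + 48 * K ^ 4 / n ^ 2) := by ring
  rw [this]
  linarith

/-- Second moment of the energy of a randomly rotated traceless matrix compressed by `P`. -/
theorem integral_compressionEnergy_sq_le (hA : A.IsHermitian) (htr : A.trace = 0)
    (hK : ∀ y, ‖Matrix.toEuclideanLin A y‖ ≤ K * ‖y‖)
    {P : Matrix (Fin n) (Fin n) 𝕜} {v : Fin r → EuclideanSpace 𝕜 (Fin n)} {θ : Fin r → ℝ}
    (hv : Orthonormal 𝕜 v) (hP : Matrix.toEuclideanLin P = frameOp v θ) :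
    ∫ U, compressionEnergy P (conjugate U A) ^ 2 ∂(unitaryHaar 𝕜 n)
      ≤ r ^ 2 * (∑ k, ∑ l, (θ k ^ 2 * θ l ^ 2) ^ 2) * (192 * K ^ 4 / n ^ 2) := by
  have hen : ∀ U : Matrix.unitaryGroup (Fin n) 𝕜, compressionEnergy P (conjugate U A)
      = ∑ p : Fin r × Fin r, θ p.1 ^ 2 * θ p.2 ^ 2 *
        ‖⟪v p.1, Matrix.toEuclideanLin (conjugate U A) (v p.2)⟫_𝕜‖ ^ 2 := fun U => by
    rw [compressionEnergy_eq hv hP (conjugate_isHermitian U hA), Fintype.sum_prod_type]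
  have hfint : ∀ p : Fin r × Fin r, Integrable (fun U => (θ p.1 ^ 2 * θ p.2 ^ 2) ^ 2 *
        ‖⟪v p.1, Matrix.toEuclideanLin (conjugate U A) (v p.2)⟫_𝕜‖ ^ 4) (unitaryHaar 𝕜 n) :=
    fun p => (integrable_of_continuous_unitary
      ((continuous_inner_conjugate A _ _).norm.pow 4)).const_mul _
  have hcont : Continuous fun U : Matrix.unitaryGroup (Fin n) 𝕜 =>
      compressionEnergy P (conjugate U A) := by
    simp only [hen]
    exact continuous_finsetSum _ fun p _ =>
      continuous_const.mul ((continuous_inner_conjugate A _ _).norm.pow 2)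
  calc _ ≤ ∫ U, (r ^ 2 : ℝ) * ∑ p : Fin r × Fin r, (θ p.1 ^ 2 * θ p.2 ^ 2) ^ 2 *
        ‖⟪v p.1, Matrix.toEuclideanLin (conjugate U A) (v p.2)⟫_𝕜‖ ^ 4 ∂(unitaryHaar 𝕜 n) := by
        refine integral_mono (integrable_of_continuous_unitary (hcont.pow 2))
          ((integrable_finsetSum _ fun p _ => hfint p).const_mul _) fun U => ?_
        simp only [hen]
        refine sq_sum_le_card_mul_sum_sq.trans (le_of_eq ?_)
        simp only [Finset.card_univ, Fintype.card_prod, Fintype.card_fin]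
        push_cast
        rw [← sq]
        congr 1
        exact Finset.sum_congr rfl fun p _ => by ring
    _ = (r ^ 2 : ℝ) * ∑ p : Fin r × Fin r, (θ p.1 ^ 2 * θ p.2 ^ 2) ^ 2 *
        ∫ U, ‖⟪v p.1, Matrix.toEuclideanLin (conjugate U A) (v p.2)⟫_𝕜‖ ^ 4
          ∂(unitaryHaar 𝕜 n) := by
        rw [integral_const_mul, integral_finsetSum _ fun p _ => hfint p]
        simp only [integral_const_mul]
    _ ≤ (r ^ 2 : ℝ) * ∑ p : Fin r × Fin r, (θ p.1 ^ 2 * θ p.2 ^ 2) ^ 2 *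
        (192 * K ^ 4 / n ^ 2) := by
        gcongr with p
        exact integral_norm_inner_pow_four_le hA htr hK hv p.1 p.2
    _ = _ := by
        rw [← Finset.sum_mul, Fintype.sum_prod_type, mul_assoc]

/-- The traceless part of `X ^ k`. -/
def centeredPow (X : Matrix (Fin n) (Fin n) 𝕜) (k : ℕ) : Matrix (Fin n) (Fin n) 𝕜 :=
  X ^ k - ((n : 𝕜)⁻¹ * (X ^ k).trace) • (1 : Matrix (Fin n) (Fin n) 𝕜)

theorem conjugate_one (U : Matrix.unitaryGroup (Fin n) 𝕜) :
    conjugate U (1 : Matrix (Fin n) (Fin n) 𝕜) = 1 := by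
  rw [conjugate, Matrix.mul_one, coe_mul_star]

theorem conjugate_pow (U : Matrix.unitaryGroup (Fin n) 𝕜) (X : Matrix (Fin n) (Fin n) 𝕜) (k : ℕ) :
    conjugate U X ^ k = conjugate U (X ^ k) := by
  induction k with
  | zero => simp [conjugate_one]
  | succ k ih => rw [pow_succ, pow_succ, ih, conjugate_mul]

theorem centeredPow_conjugate (U : Matrix.unitaryGroup (Fin n) 𝕜) (X : Matrix (Fin n) (Fin n) 𝕜)
    (k : ℕ) : centeredPow (conjugate U X) k = conjugate U (centeredPow X k) := by
  have h1 : ∀ (A : Matrix (Fin n) (Fin n) 𝕜) (c : 𝕜),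
      conjugate U (A - c • 1) = conjugate U A - c • conjugate U 1 := fun A c => by
    simp [conjugate, Matrix.mul_sub, Matrix.sub_mul]
  rw [centeredPow, centeredPow, conjugate_pow, trace_conjugate, h1, conjugate_one]

/-- Invariance under simultaneous conjugation: rotating `P` by `U*` has the same effect as rotating
the other matrix by `U`, so it does not matter which of the two has an invariant law. -/
theorem compressionEnergy_conjugate (U : Matrix.unitaryGroup (Fin n) 𝕜)
    (P B : Matrix (Fin n) (Fin n) 𝕜) :
    compressionEnergy (conjugate U P) (conjugate U B) = compressionEnergy P B := by
  rw [compressionEnergy, compressionEnergy]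
  simp only [← conjugate_mul]
  rw [trace_conjugate]

theorem toEuclideanLin_pow_apply {X : Matrix (Fin n) (Fin n) 𝕜}
    {e : OrthonormalBasis (Fin n) 𝕜 (EuclideanSpace 𝕜 (Fin n))} {x : Fin n → ℝ}
    (hX : Matrix.toEuclideanLin X = diagOp e x) (k : ℕ) (y : EuclideanSpace 𝕜 (Fin n)) :
    Matrix.toEuclideanLin (X ^ k) y = diagOp e (fun i => x i ^ k) y := by
  induction k generalizing y with
  | zero =>
    rw [pow_zero, toEuclideanLin_one_apply, diagOp_apply_eq_self]
    simp
  | succ k ih =>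
    rw [pow_succ, toEuclideanLin_mul_apply, ih, hX, diagOp_diagOp]
    simp only [pow_succ]

theorem trace_pow_eq {X : Matrix (Fin n) (Fin n) 𝕜}
    {e : OrthonormalBasis (Fin n) 𝕜 (EuclideanSpace 𝕜 (Fin n))} {x : Fin n → ℝ}
    (hX : Matrix.toEuclideanLin X = diagOp e x) (k : ℕ) :
    (X ^ k).trace = ((∑ i, x i ^ k : ℝ) : 𝕜) := by
  rw [← sum_inner_toEuclideanLin _ e]
  push_cast
  refine Finset.sum_congr rfl fun i _ => ?_
  rw [toEuclideanLin_pow_apply hX, inner_diagOp, inner_self_eq_norm_sq_to_K, e.norm_eq_one]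
  simp

theorem toEuclideanLin_centeredPow {X : Matrix (Fin n) (Fin n) 𝕜}
    {e : OrthonormalBasis (Fin n) 𝕜 (EuclideanSpace 𝕜 (Fin n))} {x : Fin n → ℝ}
    (hX : Matrix.toEuclideanLin X = diagOp e x) (k : ℕ) (y : EuclideanSpace 𝕜 (Fin n)) :
    Matrix.toEuclideanLin (centeredPow X k) y
      = diagOp e (fun i => x i ^ k) y - (((n : ℝ)⁻¹ * ∑ i, x i ^ k : ℝ) : 𝕜) • y := by
  rw [centeredPow, map_sub, LinearMap.sub_apply, map_smul, LinearMap.smul_apply,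
    toEuclideanLin_one_apply, toEuclideanLin_pow_apply hX, trace_pow_eq hX]
  push_cast
  rfl

theorem isHermitian_centeredPow {X : Matrix (Fin n) (Fin n) 𝕜} (hX : X.IsHermitian) (k : ℕ) :
    (centeredPow X k).IsHermitian := by
  obtain ⟨e, he⟩ := exists_eigenbasis hX
  rw [← Matrix.isSymmetric_toEuclideanLin_iff]
  intro y z
  rw [toEuclideanLin_centeredPow he, toEuclideanLin_centeredPow he, inner_sub_left, inner_sub_right,
    diagOp_symm, inner_smul_left, inner_smul_right, RCLike.conj_ofReal]

theorem trace_centeredPow (hn : 0 < n) (X : Matrix (Fin n) (Fin n) 𝕜) (k : ℕ) :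
    (centeredPow X k).trace = 0 := by
  have : (n : 𝕜) ≠ 0 := by exact_mod_cast hn.ne'
  rw [centeredPow, Matrix.trace_sub, Matrix.trace_smul, Matrix.trace_one, Fintype.card_fin,
    smul_eq_mul]
  field_simp
  ring

theorem norm_centeredPow_le {X : Matrix (Fin n) (Fin n) 𝕜} (hX : X.IsHermitian) {K : ℝ}
    (hK : 0 ≤ K) (hXK : ∀ y, ‖Matrix.toEuclideanLin X y‖ ≤ K * ‖y‖) (k : ℕ)
    (y : EuclideanSpace 𝕜 (Fin n)) :
    ‖Matrix.toEuclideanLin (centeredPow X k) y‖ ≤ 2 * K ^ k * ‖y‖ := by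
  obtain ⟨e, he⟩ := exists_eigenbasis hX
  set x : Fin n → ℝ := fun i => orderedEigenvalue X i
  have hx : ∀ i, |x i ^ k| ≤ K ^ k := by
    intro i
    have h1 := hXK (e i)
    have h2 : diagOp e x (e i) = (x i : 𝕜) • e i := ext_orthonormalBasis e fun j => by
      have := orthonormal_iff_ite.1 e.orthonormal j i
      rw [inner_diagOp, inner_smul_right, this]
      by_cases hj : j = i <;> simp [hj]
    rw [he, h2, norm_smul, e.norm_eq_one, mul_one, mul_one, RCLike.norm_ofReal] at h1
    rw [abs_pow]
    exact pow_le_pow_left₀ (abs_nonneg _) h1 k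
  rw [toEuclideanLin_centeredPow he]
  refine (norm_sub_le _ _).trans ?_
  have h3 := norm_diagOp_le e (by positivity) hx y
  have h4 := abs_average_le (by positivity) hx
  rw [norm_smul, RCLike.norm_ofReal]
  have h5 := mul_le_mul_of_nonneg_right h4 (norm_nonneg y)
  linarith

end Compressions

/-! ### Averaging the energy over the unitary group. -/

section Invariance

variable {𝕜 : Type*} [RCLike 𝕜] {n r : ℕ}

/-- The matrices whose operator norm is at most `K`. -/
def normBall (𝕜 : Type*) [RCLike 𝕜] (n : ℕ) (K : ℝ) : Set (Matrix (Fin n) (Fin n) 𝕜) :=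
  {X | ∀ y, ‖Matrix.toEuclideanLin X y‖ ≤ K * ‖y‖}

theorem continuous_toEuclideanLin_apply (y : EuclideanSpace 𝕜 (Fin n)) :
    Continuous fun A : Matrix (Fin n) (Fin n) 𝕜 => Matrix.toEuclideanLin A y :=
  LinearMap.continuous_of_finiteDimensional
    ((LinearMap.applyₗ y).comp
      (Matrix.toEuclideanLin (𝕜 := 𝕜) (m := Fin n) (n := Fin n)).toLinearMap)

theorem measurableSet_normBall (K : ℝ) : MeasurableSet (normBall 𝕜 n K) := by
  refine IsClosed.measurableSet ?_
  simp only [normBall, Set.ofPred_forall]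
  exact isClosed_iInter fun y => isClosed_le (continuous_toEuclideanLin_apply y).norm
    continuous_const

theorem star_conjugate (U : Matrix.unitaryGroup (Fin n) 𝕜) (A : Matrix (Fin n) (Fin n) 𝕜) :
    conjugate (star U) (conjugate U A) = A := by
  have h : star U * U = 1 := Unitary.star_mul_self U
  rw [← conjugate_mul_left, h]
  simp [conjugate]

theorem conjugate_mem_normBall {K : ℝ} (U : Matrix.unitaryGroup (Fin n) 𝕜)
    (X : Matrix (Fin n) (Fin n) 𝕜) : conjugate U X ∈ normBall 𝕜 n K ↔ X ∈ normBall 𝕜 n K :=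
  ⟨fun h y => by
    simpa only [star_conjugate] using norm_conjugate_apply_le (star U) h y,
    fun h => norm_conjugate_apply_le U h⟩

/-- The squared compression energy of the traceless part of `X ^ k`, truncated to `‖X‖ ≤ K`. -/
def truncatedEnergy (K : ℝ) (k : ℕ)
    (p : Matrix (Fin n) (Fin n) 𝕜 × Matrix (Fin n) (Fin n) 𝕜) : ℝ≥0∞ :=
  (normBall 𝕜 n K ×ˢ Set.univ).indicator
    (fun p => ENNReal.ofReal (compressionEnergy p.2 (centeredPow p.1 k) ^ 2)) p

theorem measurable_truncatedEnergy (K : ℝ) (k : ℕ) :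
    Measurable (truncatedEnergy (𝕜 := 𝕜) (n := n) K k) := by
  refine Measurable.indicator ?_ ((measurableSet_normBall K).prod MeasurableSet.univ)
  refine ENNReal.measurable_ofReal.comp (Continuous.measurable ?_)
  unfold compressionEnergy centeredPow
  fun_prop

theorem truncatedEnergy_conjugate (K : ℝ) (k : ℕ) (U : Matrix.unitaryGroup (Fin n) 𝕜)
    (X P : Matrix (Fin n) (Fin n) 𝕜) :
    truncatedEnergy K k (conjugate U X, conjugate U P) = truncatedEnergy K k (X, P) := by
  by_cases h : X ∈ normBall 𝕜 n K
  · rw [truncatedEnergy, truncatedEnergy,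
      Set.indicator_of_mem (Set.mk_mem_prod ((conjugate_mem_normBall U X).2 h) (Set.mem_univ _)),
      Set.indicator_of_mem (Set.mk_mem_prod h (Set.mem_univ _))]
    simp only [centeredPow_conjugate, compressionEnergy_conjugate]
  · rw [truncatedEnergy, truncatedEnergy,
      Set.indicator_of_notMem fun h' => h ((conjugate_mem_normBall U X).1 h'.1),
      Set.indicator_of_notMem fun h' => h h'.1]

theorem measurable_conjugate (U : Matrix.unitaryGroup (Fin n) 𝕜) :
    Measurable (conjugate U : Matrix (Fin n) (Fin n) 𝕜 → Matrix (Fin n) (Fin n) 𝕜) := by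
  refine Continuous.measurable ?_
  unfold conjugate
  fun_prop

theorem measurable_uncurry_conjugate :
    Measurable fun q : Matrix (Fin n) (Fin n) 𝕜 × Matrix.unitaryGroup (Fin n) 𝕜 =>
      conjugate q.2 q.1 := by
  have hc : Continuous fun q : Matrix (Fin n) (Fin n) 𝕜 × Matrix.unitaryGroup (Fin n) 𝕜 =>
      conjugate q.2 q.1 := by
    unfold conjugate
    fun_prop
  exact hc.measurable

variable {Ω : Type*} [MeasurableSpace Ω] {Pr : Measure Ω} [IsProbabilityMeasure Pr]
  {X P : Ω → Matrix (Fin n) (Fin n) 𝕜}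

/-- By independence the joint law is a product, so rotating the invariant factor leaves the joint
law unchanged. -/
theorem lintegral_conjugate_left (hX : Measurable X) (hP : Measurable P) (hind : IndepFun X P Pr)
    (hinv : ConjInvariant Pr X)
    {F : Matrix (Fin n) (Fin n) 𝕜 × Matrix (Fin n) (Fin n) 𝕜 → ℝ≥0∞} (hF : Measurable F)
    (U : Matrix.unitaryGroup (Fin n) 𝕜) :
    ∫⁻ ω, F (conjugate U (X ω), P ω) ∂Pr = ∫⁻ ω, F (X ω, P ω) ∂Pr := by
  have hX' : Measurable fun ω => conjugate U (X ω) := (measurable_conjugate U).comp hX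
  have hind' : IndepFun (fun ω => conjugate U (X ω)) P Pr :=
    hind.comp (measurable_conjugate U) measurable_id
  have h1 := (indepFun_iff_map_prod_eq_prod_map_map hX.aemeasurable hP.aemeasurable).1 hind
  have h2 := (indepFun_iff_map_prod_eq_prod_map_map hX'.aemeasurable hP.aemeasurable).1 hind'
  have h3 : Measure.map (fun ω => conjugate U (X ω)) Pr = Measure.map X Pr := hinv U U.2
  rw [h3, ← h1] at h2
  rw [← lintegral_map hF (hX'.prodMk hP), h2, lintegral_map hF (hX.prodMk hP)]

theorem lintegral_truncatedEnergy_conjugate (hX : Measurable X) (hP : Measurable P)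
    (hind : IndepFun X P Pr) (hinv : ConjInvariant Pr X ∨ ConjInvariant Pr P) (K : ℝ) (k : ℕ)
    (U : Matrix.unitaryGroup (Fin n) 𝕜) :
    ∫⁻ ω, truncatedEnergy K k (conjugate U (X ω), P ω) ∂Pr
      = ∫⁻ ω, truncatedEnergy K k (X ω, P ω) ∂Pr := by
  rcases hinv with h | h
  · exact lintegral_conjugate_left hX hP hind h (measurable_truncatedEnergy K k) U
  -- Here `P` is the invariant factor: it is rotated by `star U`, and simultaneous conjugation moves
  -- the rotation onto `X`.
  · have h1 := lintegral_conjugate_left hP hX hind.symm h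
      ((measurable_truncatedEnergy K k).comp measurable_swap) (star U)
    simp only [Function.comp_apply, Prod.swap_prod_mk] at h1
    rw [← h1]
    refine lintegral_congr fun ω => ?_
    rw [← truncatedEnergy_conjugate K k (star U) (conjugate U (X ω)), star_conjugate]

/-- The truncated energy of a random pair, one of whose members has a conjugation invariant law, is
of order `1 / n²`. -/
theorem lintegral_truncatedEnergy_le (hn : 0 < n) (hX : Measurable X) (hP : Measurable P)
    (hind : IndepFun X P Pr) (hinv : ConjInvariant Pr X ∨ ConjInvariant Pr P)
    (hXh : ∀ ω, (X ω).IsHermitian) {θ : Fin r → ℝ}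
    (hPf : ∀ ω, ∃ v : Fin r → EuclideanSpace 𝕜 (Fin n), Orthonormal 𝕜 v ∧
      Matrix.toEuclideanLin (P ω) = frameOp v θ) {K : ℝ} (hK : 0 ≤ K) (k : ℕ) :
    ∫⁻ ω, truncatedEnergy K k (X ω, P ω) ∂Pr ≤ ENNReal.ofReal
      (r ^ 2 * (∑ k, ∑ l, (θ k ^ 2 * θ l ^ 2) ^ 2) * (192 * (2 * K ^ k) ^ 4 / n ^ 2)) := by
  set C : ℝ := r ^ 2 * (∑ k, ∑ l, (θ k ^ 2 * θ l ^ 2) ^ 2) * (192 * (2 * K ^ k) ^ 4 / n ^ 2)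
  have hconj : Measurable fun q : Ω × Matrix.unitaryGroup (Fin n) 𝕜 => conjugate q.2 (X q.1) := by
    have h1 : Measurable fun q : Ω × Matrix.unitaryGroup (Fin n) 𝕜 => X q.1 :=
      hX.comp measurable_fst
    have h2 : Measurable fun q : Ω × Matrix.unitaryGroup (Fin n) 𝕜 => (X q.1, q.2) :=
      h1.prodMk measurable_snd
    have h3 := measurable_uncurry_conjugate.comp h2
    exact h3
  have hjoint : Measurable fun q : Ω × Matrix.unitaryGroup (Fin n) 𝕜 =>
      truncatedEnergy K k (conjugate q.2 (X q.1), P q.1) :=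
    (measurable_truncatedEnergy K k).comp (hconj.prodMk (hP.comp measurable_fst))
  calc ∫⁻ ω, truncatedEnergy K k (X ω, P ω) ∂Pr
      -- The integral is unchanged by every fixed rotation, hence equals its Haar average. After
      -- Tonelli the inner integral is over `U` alone with `X ω`, `P ω` frozen, so a frame for `P ω`
      -- may be chosen pointwise.
      = ∫⁻ _, ∫⁻ ω, truncatedEnergy K k (X ω, P ω) ∂Pr ∂(unitaryHaar 𝕜 n) := by simp
    _ = ∫⁻ U, ∫⁻ ω, truncatedEnergy K k (conjugate U (X ω), P ω) ∂Pr ∂(unitaryHaar 𝕜 n) :=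
        lintegral_congr fun U =>
          (lintegral_truncatedEnergy_conjugate hX hP hind hinv K k U).symm
    _ = ∫⁻ ω, ∫⁻ U, truncatedEnergy K k (conjugate U (X ω), P ω) ∂(unitaryHaar 𝕜 n) ∂Pr :=
        (lintegral_lintegral_swap hjoint.aemeasurable).symm
    _ ≤ ∫⁻ _, ENNReal.ofReal C ∂Pr := by
        refine lintegral_mono fun ω => ?_
        by_cases hXK : X ω ∈ normBall 𝕜 n K
        · obtain ⟨v, hv, hPv⟩ := hPf ω
          have hcont : Continuous fun U : Matrix.unitaryGroup (Fin n) 𝕜 =>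
              compressionEnergy (P ω) (conjugate U (centeredPow (X ω) k)) ^ 2 := by
            unfold compressionEnergy conjugate
            fun_prop
          have h1 : ∀ U, truncatedEnergy K k (conjugate U (X ω), P ω) = ENNReal.ofReal
              (compressionEnergy (P ω) (conjugate U (centeredPow (X ω) k)) ^ 2) := fun U => by
            rw [truncatedEnergy, Set.indicator_of_mem
              (Set.mk_mem_prod ((conjugate_mem_normBall U _).2 hXK) (Set.mem_univ _)),
              centeredPow_conjugate]
          simp only [h1]
          rw [← ofReal_integral_eq_lintegral_ofReal (integrable_of_continuous_unitary hcont)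
            (.of_forall fun U => sq_nonneg _)]
          exact ENNReal.ofReal_le_ofReal (integral_compressionEnergy_sq_le
            (isHermitian_centeredPow (hXh ω) k) (trace_centeredPow hn _ k)
            (norm_centeredPow_le (hXh ω) hK hXK k) hv hPv)
        · have h1 : ∀ U, truncatedEnergy K k (conjugate U (X ω), P ω) = 0 := fun U => by
            rw [truncatedEnergy, Set.indicator_of_notMem
              fun h => hXK ((conjugate_mem_normBall U _).1 h.1)]
          simp [h1]
    _ = ENNReal.ofReal C := by simp

end Invariance

/-- Borel–Cantelli: random variables with summable first moments converge to zero. -/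
theorem ae_tendsto_zero_of_lintegral_le {Ω : Type*} [MeasurableSpace Ω] {Pr : Measure Ω}
    {F : ℕ → Ω → ℝ≥0∞} (hF : ∀ n, Measurable (F n)) {C : ℝ} {N : ℕ}
    (h : ∀ n, N ≤ n → ∫⁻ ω, F n ω ∂Pr ≤ ENNReal.ofReal (C * (1 / (n : ℝ) ^ 2))) (hC : 0 ≤ C) :
    ∀ᵐ ω ∂Pr, Tendsto (fun n => F n ω) atTop (𝓝 0) := by
  have hs : Summable fun n : ℕ => C * (1 / ((n + N : ℕ) : ℝ) ^ 2) :=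
    (summable_nat_add_iff (f := fun n : ℕ => C * (1 / (n : ℝ) ^ 2)) N).2
      ((Real.summable_one_div_nat_pow.2 one_lt_two).mul_left C)
  have h1 : ∫⁻ ω, ∑' n, F (n + N) ω ∂Pr ≠ ∞ := by
    rw [lintegral_tsum fun n => (hF _).aemeasurable]
    refine ne_top_of_le_ne_top ?_ (ENNReal.tsum_le_tsum fun n => h (n + N) (Nat.le_add_left _ _))
    rw [← ENNReal.ofReal_tsum_of_nonneg (fun n => by positivity) hs]
    exact ENNReal.ofReal_ne_top
  filter_upwards [ae_lt_top (.tsum fun n => hF (n + N)) h1] with ω hω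
  exact (tendsto_add_atTop_iff_nat N).1 (ENNReal.tendsto_atTop_zero_of_tsum_ne_top hω.ne)

/-! ### Almost sure convergence of the energies. -/

section Sequences

variable {𝕜 : Type*} [RCLike 𝕜] {r : ℕ} {Ω : Type*} [MeasurableSpace Ω] {Pr : Measure Ω}
  [IsProbabilityMeasure Pr] {X P : ∀ n : ℕ, Ω → Matrix (Fin n) (Fin n) 𝕜}

/-- The squared energy has expectation of order `1 / n²`, which is summable. Truncation to `‖X‖ ≤ K`
is needed because the norm is bounded only asymptotically and almost surely; taking `K` natural
keeps the exceptional sets countable in number. -/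
theorem ae_tendsto_compressionEnergy (hX : ∀ n, Measurable (X n)) (hP : ∀ n, Measurable (P n))
    (hind : ∀ n, r ≤ n → IndepFun (X n) (P n) Pr)
    (hinv : ∀ n, r ≤ n → ConjInvariant Pr (X n) ∨ ConjInvariant Pr (P n))
    (hXh : ∀ n ω, (X n ω).IsHermitian) {θ : Fin r → ℝ}
    (hPf : ∀ n, r ≤ n → ∀ ω, ∃ v : Fin r → EuclideanSpace 𝕜 (Fin n), Orthonormal 𝕜 v ∧
      Matrix.toEuclideanLin (P n ω) = frameOp v θ) :
    ∀ᵐ ω ∂Pr, ∀ K : ℕ, (∀ᶠ n in atTop, X n ω ∈ normBall 𝕜 n K) → ∀ k : ℕ,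
      Tendsto (fun n => compressionEnergy (P n ω) (centeredPow (X n ω) k)) atTop (𝓝 0) := by
  have h1 : ∀ᵐ ω ∂Pr, ∀ K k : ℕ,
      Tendsto (fun n => truncatedEnergy (K : ℝ) k (X n ω, P n ω)) atTop (𝓝 0) := by
    rw [ae_all_iff]; intro K
    rw [ae_all_iff]; intro k
    -- The hypotheses on `P n` start at `n = r`, and centring by the normalized trace needs `n > 0`.
    refine ae_tendsto_zero_of_lintegral_le (N := max r 1)
      (C := r ^ 2 * (∑ k, ∑ l, (θ k ^ 2 * θ l ^ 2) ^ 2) * (192 * (2 * (K : ℝ) ^ k) ^ 4))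
      (fun n => (measurable_truncatedEnergy _ _).comp ((hX n).prodMk (hP n))) (fun n hn => ?_)
      (by positivity)
    have hr := (le_max_left _ _).trans hn
    refine (lintegral_truncatedEnergy_le ((le_max_right _ _).trans hn) (hX n) (hP n) (hind n hr)
      (hinv n hr) (hXh n) (hPf n hr) K.cast_nonneg k).trans (le_of_eq ?_)
    congr 1
    ring
  filter_upwards [h1] with ω hω K hK k
  have h2 : Tendsto (fun n => compressionEnergy (P n ω) (centeredPow (X n ω) k) ^ 2) atTop
      (𝓝 0) := by
    have h3 := (ENNReal.tendsto_toReal ENNReal.zero_ne_top).comp (hω K k)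
    refine h3.congr' ?_
    filter_upwards [hK] with n hn
    rw [Function.comp_apply, truncatedEnergy,
      Set.indicator_of_mem (Set.mk_mem_prod hn (Set.mem_univ _)),
      ENNReal.toReal_ofReal (sq_nonneg _)]
  have h3 := h2.sqrt
  simp only [Real.sqrt_sq_eq_abs, Real.sqrt_zero] at h3
  exact (tendsto_zero_iff_abs_tendsto_zero _).2 h3

end Sequences

/-! ### Consequences on the almost sure event. -/

section Deterministic

variable {𝕜 : Type*} [RCLike 𝕜] {r : ℕ}

theorem integral_empiricalMeasure {n : ℕ} (A : Matrix (Fin n) (Fin n) 𝕜) (f : ℝ →ᵇ ℝ) :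
    ∫ t, f t ∂(empiricalMeasure A) = (n : ℝ)⁻¹ * ∑ i : Fin n, f (orderedEigenvalue A i) := by
  rw [empiricalMeasure, integral_smul_measure, integral_finsetSum_measure]
  · simp
  · exact fun i _ => f.integrable _

theorem orderedEigenvalue_nonneg {n : ℕ} {A : Matrix (Fin n) (Fin n) 𝕜} (hA : A.PosSemidef)
    (i : Fin n) : 0 ≤ orderedEigenvalue A i := by
  obtain ⟨σ, hσ⟩ := exists_equiv_eigenvalues_eq hA.1
  have := hσ (σ.symm i)
  rw [Equiv.apply_symm_apply] at this
  rw [← this]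
  exact hA.eigenvalues_nonneg _

variable {μ : Measure ℝ} {a b : ℝ}
    {e : ∀ n, OrthonormalBasis (Fin n) 𝕜 (EuclideanSpace 𝕜 (Fin n))}
    {v : ∀ n, Fin r → EuclideanSpace 𝕜 (Fin n)}
    {X P : ∀ n, Matrix (Fin n) (Fin n) 𝕜} {θ : Fin r → ℝ}

/-- The extreme eigenvalues confine the spectrum and put `X n` eventually in a fixed norm ball. Each
squared entry of the traceless power is then at most the energy divided by `θ_k² θ_l²`. -/
theorem isotropicLimit_of_tendsto_energy (hX : ∀ n, (X n).PosSemidef)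
    (he : ∀ n, Matrix.toEuclideanLin (X n) = diagOp (e n) fun i => orderedEigenvalue (X n) i)
    (hv : ∀ n, r ≤ n → Orthonormal 𝕜 (v n))
    (hP : ∀ n, r ≤ n → Matrix.toEuclideanLin (P n) = frameOp (v n) θ) (hθ : ∀ i, θ i ≠ 0)
    (hμ : WeaklyConverges (fun n => empiricalMeasure (X n)) μ)
    (hmax : Tendsto (fun n => orderedEigenvalue (X n) 0) atTop (𝓝 b))
    (hmin : Tendsto (fun n => orderedEigenvalue (X n) (n - 1)) atTop (𝓝 a))
    (hE : ∀ K : ℕ, (∀ᶠ n in atTop, X n ∈ normBall 𝕜 n K) → ∀ k : ℕ,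
      Tendsto (fun n => compressionEnergy (P n) (centeredPow (X n) k)) atTop (𝓝 0)) :
    IsotropicLimit μ a b e (fun n i => orderedEigenvalue (X n) i) v := by
  have hmem : ∀ δ > 0, ∀ᶠ n in atTop, ∀ i : Fin n,
      orderedEigenvalue (X n) i ∈ Set.Icc (a - δ) (b + δ) := by
    intro δ hδ
    filter_upwards [hmax.eventually_lt_const (show b < b + δ by linarith),
      hmin.eventually_const_lt (show a - δ < a by linarith)] with n h1 h2 i
    have hn : 0 < n := i.pos
    have h3 := orderedEigenvalue_antitone (hX n).1 (show (⟨0, hn⟩ : Fin n) ≤ i from Nat.zero_le _)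
    have h4 := orderedEigenvalue_antitone (hX n).1
      (show i ≤ (⟨n - 1, by omega⟩ : Fin n) from Nat.le_sub_one_of_lt i.2)
    exact ⟨h2.le.trans h4, h3.trans h1.le⟩
  refine ⟨eventually_atTop.2 ⟨r, hv⟩, hmem, fun f => ?_, fun m k l => ?_⟩
  · simpa only [integral_empiricalMeasure] using hμ f
  · obtain ⟨K, hK⟩ := exists_nat_ge (b + 1)
    have hball : ∀ᶠ n in atTop, X n ∈ normBall 𝕜 n K := by
      filter_upwards [hmem 1 one_pos] with n hn y
      rw [he]
      refine norm_diagOp_le _ K.cast_nonneg (fun i => ?_) y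
      rw [abs_of_nonneg (orderedEigenvalue_nonneg (hX n) i)]
      exact (hn i).2.trans hK
    have h1 := (hE K hball m).const_mul (θ k ^ 2 * θ l ^ 2)⁻¹
    rw [mul_zero] at h1
    have hpos : 0 < θ k ^ 2 * θ l ^ 2 := by have := hθ k; have := hθ l; positivity
    have h2 : Tendsto (fun n =>
        ‖⟪v n k, Matrix.toEuclideanLin (centeredPow (X n) m) (v n l)⟫_𝕜‖ ^ 2) atTop (𝓝 0) := by
      refine squeeze_zero' (.of_forall fun n => sq_nonneg _) ?_ h1
      filter_upwards [eventually_ge_atTop r] with n hn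
      rw [compressionEnergy_eq (hv n hn) (hP n hn) (isHermitian_centeredPow (hX n).1 m),
        le_inv_mul_iff₀ hpos]
      have h3 := Finset.single_le_sum (f := fun l => θ k ^ 2 * θ l ^ 2 *
        ‖⟪v n k, Matrix.toEuclideanLin (centeredPow (X n) m) (v n l)⟫_𝕜‖ ^ 2)
        (fun _ _ => by positivity) (Finset.mem_univ l)
      refine h3.trans ?_
      exact Finset.single_le_sum (f := fun k => ∑ l, θ k ^ 2 * θ l ^ 2 *
        ‖⟪v n k, Matrix.toEuclideanLin (centeredPow (X n) m) (v n l)⟫_𝕜‖ ^ 2)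
        (fun _ _ => by positivity) (Finset.mem_univ k)
    have h4 := h2.sqrt
    simp only [Real.sqrt_sq (norm_nonneg _), Real.sqrt_zero] at h4
    refine (tendsto_zero_iff_norm_tendsto_zero.2 h4).congr' ?_
    filter_upwards [eventually_ge_atTop r] with n hn
    rw [toEuclideanLin_centeredPow (he n), inner_sub_right, inner_smul_right,
      orthonormal_iff_ite.1 (hv n hn), mul_ite, mul_one, mul_zero]

/-- Components along `v k` with `θ k ≠ t` vanish in the limit, so the relation `I ∑ θ_k² |⟨v_k, u⟩|²
→ 1` becomes `I t²` times the squared projection tending to `1`. In particular `I t²` cannot be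
zero. -/
theorem IsotropicLimit.tendsto_projNorm_kerSub [IsProbabilityMeasure μ] {x : ∀ n, Fin n → ℝ}
    (h : IsotropicLimit μ a b e x v) (hμ : ∀ᵐ t ∂μ, t ∈ Set.Icc a b) (hab : a ≤ b)
    (hX : ∀ n, Matrix.toEuclideanLin (X n) = diagOp (e n) (x n))
    (hv : ∀ n, r ≤ n → Orthonormal 𝕜 (v n))
    (hP : ∀ n, r ≤ n → Matrix.toEuclideanLin (P n) = frameOp (v n) θ)
    {ρ : ℝ} (hρ : ρ ∉ Set.Icc a b) {l : ℕ → ℝ} (hl : Tendsto l atTop (𝓝 ρ))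
    {u : ∀ n, EuclideanSpace 𝕜 (Fin n)}
    (hu : ∀ n, r ≤ n → IsUnitEigenvector (perturbed (X n) (P n)) (l n) (u n))
    {t : ℝ} (ht : t ≠ 0) (hT : tTransform μ ρ = 1 / t) :
    Tendsto (fun n => projNorm (u n) (kerSub (P n) t) ^ 2) atTop
      (𝓝 (-1 / (t ^ 2 * ρ * deriv (tTransform μ) ρ + t))) := by
  have h1 := h.tendsto_sum_sq_eigenvector hμ hab hX hP hρ hl hu
  have h2 := integral_sq_div_sub_sq hμ hρ
  set I := ∫ s, (s / (ρ - s)) ^ 2 ∂μ with hI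
  have hrest : Tendsto (fun n => I * ∑ k with θ k ≠ t, θ k ^ 2 * ‖⟪v n k, u n⟫_𝕜‖ ^ 2) atTop
      (𝓝 0) := by
    have h3 : Tendsto (fun n => ∑ k with θ k ≠ t, θ k ^ 2 * ‖⟪v n k, u n⟫_𝕜‖ ^ 2) atTop
        (𝓝 (∑ k : Fin r with θ k ≠ t, θ k ^ 2 * 0)) := by
      refine tendsto_finsetSum _ fun k hk => Tendsto.const_mul _ ?_
      refine h.tendsto_inner_eigenvector hμ hab hX hP hρ hl hu k ?_
      rw [hT, one_div, Ne, inv_mul_eq_one₀ ht]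
      exact (Finset.mem_filter.1 hk).2.symm
    simpa using h3.const_mul I
  have h4 := h1.sub hrest
  rw [sub_zero] at h4
  have h5 : Tendsto (fun n => I * t ^ 2 * projNorm (u n) (kerSub (P n) t) ^ 2) atTop (𝓝 1) := by
    refine h4.congr' ?_
    filter_upwards [eventually_ge_atTop r] with n hn
    rw [kerSub_eq_span (hv n hn) (hP n hn) ht, projNorm_sq_span (hv n hn), ← mul_sub,
      ← Finset.sum_filter_add_sum_filter_not Finset.univ (fun k => θ k = t), add_sub_cancel_right,
      mul_assoc, Finset.mul_sum (a := t ^ 2)]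
    congr 1
    exact Finset.sum_congr rfl fun k hk => by rw [(Finset.mem_filter.1 hk).2]
  have hI0 : I * t ^ 2 ≠ 0 := by
    intro h0
    simp only [h0, zero_mul] at h5
    exact zero_ne_one (tendsto_nhds_unique tendsto_const_nhds h5)
  have h6 := h5.const_mul (I * t ^ 2)⁻¹
  simp only [← mul_assoc, inv_mul_cancel₀ hI0, one_mul, mul_one] at h6
  -- Uses `I = -ρ T'(ρ) - T(ρ)` and `t² T(ρ) = t`.
  have h7 : t ^ 2 * ρ * deriv (tTransform μ) ρ + t = -(I * t ^ 2) := by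
    rw [h2, hT]
    field_simp
    ring
  rwa [h7, neg_div_neg_eq, one_div]

theorem IsotropicLimit.tendsto_projNorm_iSup_kerSub {x : ∀ n, Fin n → ℝ}
    [IsProbabilityMeasure μ]
    (h : IsotropicLimit μ a b e x v) (hμ : ∀ᵐ t ∂μ, t ∈ Set.Icc a b) (hab : a ≤ b)
    (hX : ∀ n, Matrix.toEuclideanLin (X n) = diagOp (e n) (x n))
    (hv : ∀ n, r ≤ n → Orthonormal 𝕜 (v n))
    (hP : ∀ n, r ≤ n → Matrix.toEuclideanLin (P n) = frameOp (v n) θ) (hθ : ∀ i, θ i ≠ 0)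
    {ρ : ℝ} (hρ : ρ ∉ Set.Icc a b) {l : ℕ → ℝ} (hl : Tendsto l atTop (𝓝 ρ))
    {u : ∀ n, EuclideanSpace 𝕜 (Fin n)}
    (hu : ∀ n, r ≤ n → IsUnitEigenvector (perturbed (X n) (P n)) (l n) (u n))
    {t : ℝ} (ht : t ≠ 0) (hT : tTransform μ ρ = 1 / t) :
    Tendsto (fun n => projNorm (u n) (⨆ j : {j : Fin r // θ j ≠ t}, kerSub (P n) (θ j))) atTop
      (𝓝 0) := by
  have h1 : Tendsto (fun n => ∑ k with θ k ≠ t, ‖⟪v n k, u n⟫_𝕜‖ ^ 2) atTop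
      (𝓝 (∑ k : Fin r with θ k ≠ t, 0)) := by
    refine tendsto_finsetSum _ fun k hk => ?_
    refine h.tendsto_inner_eigenvector hμ hab hX hP hρ hl hu k ?_
    rw [hT, one_div, Ne, inv_mul_eq_one₀ ht]
    exact (Finset.mem_filter.1 hk).2.symm
  have h2 := h1.sqrt
  simp only [Finset.sum_const_zero, Real.sqrt_zero] at h2
  refine h2.congr' ?_
  filter_upwards [eventually_ge_atTop r] with n hn
  rw [iSup_kerSub_eq_span (hv n hn) (hP n hn) hθ, ← projNorm_sq_span (hv n hn),
    Real.sqrt_sq (by exact norm_nonneg _)]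

end Deterministic

end SpikedModel

end

/-! ### The main theorem. -/

theorem theorem2p7 {𝕜 : Type*} [RCLike 𝕜]
    {Ω : Type*} [MeasurableSpace Ω] (Pr : Measure Ω) [IsProbabilityMeasure Pr]
    -- the random matrices, the size-`n` matrices `X n` being non-negative definite
    (X P : ∀ n : ℕ, Ω → Matrix (Fin n) (Fin n) 𝕜)
    (hXm : ∀ n, Measurable (X n)) (hPm : ∀ n, Measurable (P n))
    (hXpos : ∀ n ω, (X n ω).PosSemidef)
    -- the limiting eigenvalue distribution
    (μ : Measure ℝ) [IsProbabilityMeasure μ] (hμc : IsCompact μ.support)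
    (hμ0 : μ ≠ Measure.dirac 0)
    (hμ : ∀ᵐ ω ∂Pr, SpikedModel.WeaklyConverges (fun n => SpikedModel.empiricalMeasure (X n ω)) μ)
    (a b : ℝ) (ha : IsGLB μ.support a) (hb : IsLUB μ.support b)
    (hmax : ∀ᵐ ω ∂Pr,
      Tendsto (fun n => SpikedModel.orderedEigenvalue (X n ω) 0) atTop (𝓝 b))
    (hmin : ∀ᵐ ω ∂Pr,
      Tendsto (fun n => SpikedModel.orderedEigenvalue (X n ω) (n - 1)) atTop (𝓝 a))
    -- the perturbation of rank `r`
    (r : ℕ) (θ : Fin r → ℝ) (hθ : Antitone θ) (hθ0 : ∀ i, θ i ≠ 0)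
    (hP : ∀ n, r ≤ n → ∀ ω, SpikedModel.HasNonzeroSpectrum (P n ω) θ)
    -- independence and invariance
    (hindep : ∀ n, r ≤ n → IndepFun (X n) (P n) Pr)
    (hinv : ∀ n, r ≤ n →
      SpikedModel.ConjInvariant Pr (X n) ∨ SpikedModel.ConjInvariant Pr (P n))
    -- the index of a supercritical eigenvalue of the perturbation
    (i₀ : Fin r)
    (hlow : SpikedModel.tTransformLeft μ a < ((1 / θ i₀ : ℝ) : EReal))
    (hup : ((1 / θ i₀ : ℝ) : EReal) < SpikedModel.tTransformRight μ b)
    -- the unit-norm eigenvectors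
    (u : ∀ n : ℕ, Ω → EuclideanSpace 𝕜 (Fin n))
    (hu : ∀ n, r ≤ n → ∀ ω, SpikedModel.IsUnitEigenvector
      (SpikedModel.perturbed (X n ω) (P n ω))
      (SpikedModel.outlierEigenvalue (X n ω) (P n ω) θ i₀) (u n ω)) :
    ∃ ρ : ℝ,
      -- `ρ = T_μ⁻¹ (1 / θ i₀)`
      (ρ ∉ Set.Icc a b ∧ SpikedModel.tTransform μ ρ = 1 / θ i₀ ∧
        ∀ z : ℝ, z ∉ Set.Icc a b → SpikedModel.tTransform μ z = 1 / θ i₀ → z = ρ) ∧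
      DifferentiableAt ℝ (SpikedModel.tTransform μ) ρ ∧
      (∀ᵐ ω ∂Pr, Tendsto
        (fun n => SpikedModel.outlierEigenvalue (X n ω) (P n ω) θ i₀) atTop (𝓝 ρ)) ∧
      (∀ᵐ ω ∂Pr, Tendsto
        (fun n => SpikedModel.projNorm (u n ω) (SpikedModel.kerSub (P n ω) (θ i₀)) ^ 2) atTop
        (𝓝 (-1 / (θ i₀ ^ 2 * ρ * deriv (SpikedModel.tTransform μ) ρ + θ i₀)))) ∧
      (∀ᵐ ω ∂Pr, Tendsto
        (fun n => SpikedModel.projNorm (u n ω)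
          (⨆ j : {j : Fin r // θ j ≠ θ i₀}, SpikedModel.kerSub (P n ω) (θ j))) atTop
        (𝓝 0)) := by
  have hXh : ∀ n ω, (X n ω).IsHermitian := fun n ω => (hXpos n ω).1
  have hsupp := SpikedModel.ae_mem_Icc ha hb
  have hab := SpikedModel.le_of_support ha hb
  -- Non-negativity of the support is not assumed; it is inherited from the smallest eigenvalue
  -- along one good `ω`.
  have ha0 : 0 ≤ a := by
    obtain ⟨ω, hω⟩ := hmin.exists
    refine ge_of_tendsto hω ?_
    filter_upwards [eventually_gt_atTop 0] with n hn
    exact SpikedModel.orderedEigenvalue_nonneg (hXpos n ω) ⟨n - 1, by omega⟩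
  obtain ⟨ρ, hTρ, hρ⟩ := SpikedModel.exists_tTransform_eq hsupp ha0 hab hμ0
    (one_div_ne_zero (hθ0 i₀)) hlow hup
  have hρ' : ρ ∉ Set.Icc a b := by
    rintro ⟨h1, h2⟩
    rcases hρ with h | h <;> linarith [h.2]
  have hframe := fun n hn ω => (hP n hn ω).exists_frame
  choose e he using fun n ω => SpikedModel.exists_eigenbasis (hXh n ω)
  have hframe' : ∀ n ω, ∃ v : Fin r → EuclideanSpace 𝕜 (Fin n), r ≤ n → Orthonormal 𝕜 v ∧
      Matrix.toEuclideanLin (P n ω) = SpikedModel.frameOp v θ := fun n ω => by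
    by_cases hn : r ≤ n
    · obtain ⟨v, hv⟩ := hframe n hn ω
      exact ⟨v, fun _ => hv⟩
    · exact ⟨0, fun h => absurd h hn⟩
  choose v hv using hframe'
  have hlim : ∀ᵐ ω ∂Pr, SpikedModel.IsotropicLimit μ a b (fun n => e n ω)
      (fun n i => SpikedModel.orderedEigenvalue (X n ω) i) (fun n => v n ω) := by
    filter_upwards [hμ, hmax, hmin, SpikedModel.ae_tendsto_compressionEnergy hXm hPm hindep hinv
      hXh hframe] with ω h1 h2 h3 h4
    exact SpikedModel.isotropicLimit_of_tendsto_energy (fun n => hXpos n ω) (fun n => he n ω)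
      (fun n hn => (hv n ω hn).1) (fun n hn => (hv n ω hn).2) hθ0 h1 h2 h3 h4
  have hout : ∀ᵐ ω ∂Pr, Tendsto
      (fun n => SpikedModel.outlierEigenvalue (X n ω) (P n ω) θ i₀) atTop (𝓝 ρ) := by
    filter_upwards [hlim] with ω h
    exact h.tendsto_outlier hsupp ha0 hab hμ0
      (fun n i => SpikedModel.orderedEigenvalue_nonneg (hXpos n ω) i) (fun n => he n ω) hθ
      (fun n hn => (hv n ω hn).2) i₀ hTρ hρ
  refine ⟨ρ, ⟨hρ', hTρ, fun z hz hTz =>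
      SpikedModel.eq_of_tTransform_eq hsupp ha0 hμ0 hρ hTρ hz hTz⟩,
    (SpikedModel.hasDerivAt_tTransform hsupp hρ').differentiableAt, hout, ?_, ?_⟩
  · filter_upwards [hlim, hout] with ω h ho
    exact h.tendsto_projNorm_kerSub hsupp hab (fun n => he n ω) (fun n hn => (hv n ω hn).1)
      (fun n hn => (hv n ω hn).2) hρ' ho (fun n hn => hu n hn ω) (hθ0 i₀) hTρ
  · filter_upwards [hlim, hout] with ω h ho
    exact h.tendsto_projNorm_iSup_kerSub hsupp hab (fun n => he n ω) (fun n hn => (hv n ω hn).1)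
      (fun n hn => (hv n ω hn).2) hθ0 hρ' ho (fun n hn => hu n hn ω) (hθ0 i₀) hTρ
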